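/- Let $a:\mathbb{R}\to\mathbb{R}$ be the even weight with $a=2$ in $(-1,1)$ and $a=1$ elsewhere. For $m=(m_1,m_2,m_3):\mathbb{R}\to\mathbb{S}^2$ let $$F(m)=\int_{\mathbb{R}}\Big(a(x)|\partial_x m|^2+a(x)(m_2^2+m_3^2)\Big)\,dx\in[0,\infty]$$ (with $F(m)=\infty$ if $m$ is not locally absolutely continuous), and let $G(\varphi)=F\big((\sin\varphi,\cos\varphi,0)\big)$ for $\varphi:\mathbb{R}\to\mathbb{R}$. Functions in $\dot H^1(\mathbb{R})$ (locally absolutely continuous with derivative in $L^2$) and in $H^1(\mathbb{R})=\dot H^1(\mathbb{R})\cap L^2(\mathbb{R})$ are identified with their continuous representatives. Put $e_1=(1,0,0)$, $e_2=(0,1,0)$. (i) There is exactly one $\varphi\in\dot H^1(\mathbb{R})$ that satisfies $\partial_x(a\,\partial_x\varphi)+a\sin\varphi\cos\varphi=0$ in the sense of distributions in $\mathbb{R}\setminus\{0\}$, $\varphi(0)=0$, $\varphi(\pm\infty)=\pm\frac{\pi}{2}$, and $-\frac{\pi}{2}\le\varphi(-x)\le 0\le\varphi(x)\le\frac{\pi}{2}$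 for every $x>0$. This $\varphi$ is unstable: there is $\eta\in H^1(\mathbb{R})$ with $$Q(\eta)=\frac12\frac{d^2}{dt^2}\Big|_{t=0}G(\varphi+t\eta)=\int_{\mathbb{R}}\Big(a(x)(\partial_x\eta)^2-a(x)\cos(2\varphi)\,\eta^2\Big)\,dx<0.$$ (ii) There is exactly one minimizer $m:\mathbb{R}\to\mathbb{S}^2$ of $F$ under the constraints $m(0)=e_2$ and $m(\pm\infty)=\pm e_1$. This $m$ is unstable: there is $v\in H^1(\mathbb{R},\mathbb{R}^3)$ with $v\cdot m=0$ in $\mathbb{R}$ and $$T(v)=\frac12\frac{d^2}{dt^2}\Big|_{t=0}F\Big(\frac{m+tv}{|m+tv|}\Big)=\int_{\mathbb{R}}\Big(a(x)|\partial_x v|^2+a(x)(v_2^2+v_3^2)-\lambda(x)|v|^2\Big)\,dx<0,$$ where $\lambda(x)=a(x)|\partial_x m|^2+a(x)m_2^2$. (iii) The infimum of $F$ over all maps $m:\mathbb{R}\to\mathbb{S}^2$ with $m(\pm\infty)=\pm e_1$ equals $4$, and it is not attained: $F$ has no minimizer under the constraints $m(\pm\infty)=\pm e_1$ alone. -/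

import Mathlib

open Set Filter Topology MeasureTheory
open scoped ENNReal ContDiff

noncomputable section

namespace DomainWall

/-- Euclidean three-space. -/
abbrev E3 : Type := EuclideanSpace ℝ (Fin 3)

/-- The vector `e₁ = (1, 0, 0)`. -/
def e1 : E3 := !₂[1, 0, 0]

/-- The vector `e₂ = (0, 1, 0)`. -/
def e2 : E3 := !₂[0, 1, 0]

section Sobolev

variable {E : Type*} [NormedAddCommGroup E] [NormedSpace ℝ E]

/-- Functions on the line that are absolutely continuous on every compact interval, i.e. the
continuous representatives of the functions in `W^{1,1}_loc(ℝ)`. When `E` is finite dimensional,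
they are differentiable almost everywhere and `deriv f` is the weak derivative. -/
def LocAC (f : ℝ → E) : Prop :=
  ∀ x y : ℝ, AbsolutelyContinuousOnInterval f x y

/-- The homogeneous Sobolev space `Ḣ¹(ℝ, E)` (continuous representatives). -/
def MemHdot1 (f : ℝ → E) : Prop :=
  LocAC f ∧ MemLp (deriv f) 2 volume

/-- The Sobolev space `H¹(ℝ, E)` (continuous representatives). -/
def MemH1 (f : ℝ → E) : Prop :=
  LocAC f ∧ MemLp f 2 volume ∧ MemLp (deriv f) 2 volume

end Sobolev

open Classical in
/-- The energy `F(m) = ∫ a |∂ₓm|² + a (m₂² + m₃²)`, with values in `[0, ∞]`; it is infinite for maps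
without a locally integrable weak derivative. (The components `m₁, m₂, m₃` have indices 0, 1, 2.) -/
def F (a : ℝ → ℝ) (m : ℝ → E3) : ℝ≥0∞ :=
  if LocAC m then
    ∫⁻ x, ENNReal.ofReal (a x * ‖deriv m x‖ ^ 2 + a x * (m x 1 ^ 2 + m x 2 ^ 2))
  else ⊤

/-- The planar map `(sin φ, cos φ, 0)`. -/
def planar (φ : ℝ → ℝ) (x : ℝ) : E3 :=
  !₂[Real.sin (φ x), Real.cos (φ x), 0]

/-- The reduced energy `G(φ) = F((sin φ, cos φ, 0))`. -/
def G (a : ℝ → ℝ) (φ : ℝ → ℝ) : ℝ≥0∞ :=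
  F a (planar φ)

/-- Maps `m : ℝ → 𝕊²` with `m(±∞) = ±e₁`. -/
def walls : Set (ℝ → E3) :=
  {m | (∀ x, ‖m x‖ = 1) ∧ Tendsto m atTop (𝓝 e1) ∧ Tendsto m atBot (𝓝 (-e1))}

/-- Maps `m : ℝ → 𝕊²` with `m(±∞) = ±e₁` and `m(0) = e₂`. -/
def centeredWalls : Set (ℝ → E3) :=
  {m | m ∈ walls ∧ m 0 = e2}

/-- `m` minimizes `F` in the class `S`. -/
def IsMinimizer (a : ℝ → ℝ) (S : Set (ℝ → E3)) (m : ℝ → E3) : Prop :=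
  m ∈ S ∧ ∀ m' ∈ S, F a m ≤ F a m'

/-- The weighted pendulum equation `∂ₓ(a ∂ₓφ) + a sin φ cos φ = 0` in the sense of distributions in
the set `U`. -/
def PendulumOn (a : ℝ → ℝ) (U : Set ℝ) (φ : ℝ → ℝ) : Prop :=
  ∀ ψ : ℝ → ℝ, ContDiff ℝ ∞ ψ → HasCompactSupport ψ → tsupport ψ ⊆ U →
    ∫ x, a x * deriv φ x * deriv ψ x = ∫ x, a x * Real.sin (φ x) * Real.cos (φ x) * ψ x

/-- `φ ∈ Ḣ¹(ℝ)` solves the weighted pendulum equation in `ℝ ∖ {0}` with `φ(0) = 0`,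
`φ(±∞) = ±π/2`, and `-π/2 ≤ φ(-x) ≤ 0 ≤ φ(x) ≤ π/2` for every `x > 0`. -/
structure IsPendulumSolution (a : ℝ → ℝ) (φ : ℝ → ℝ) : Prop where
  memHdot1 : MemHdot1 φ
  pendulum : PendulumOn a {0}ᶜ φ
  zero : φ 0 = 0
  tendsto_atTop : Tendsto φ atTop (𝓝 (Real.pi / 2))
  tendsto_atBot : Tendsto φ atBot (𝓝 (-(Real.pi / 2)))
  bounds : ∀ x, 0 < x →
    -(Real.pi / 2) ≤ φ (-x) ∧ φ (-x) ≤ 0 ∧ 0 ≤ φ x ∧ φ x ≤ Real.pi / 2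

/-- The quadratic form `Q(η) = ∫ a (∂ₓη)² - a cos(2φ) η²`. -/
def Q (a : ℝ → ℝ) (φ η : ℝ → ℝ) : ℝ :=
  ∫ x, (a x * deriv η x ^ 2 - a x * Real.cos (2 * φ x) * η x ^ 2)

/-- The Lagrange multiplier `λ = a |∂ₓm|² + a m₂²`. -/
def lagrange (a : ℝ → ℝ) (m : ℝ → E3) (x : ℝ) : ℝ :=
  a x * ‖deriv m x‖ ^ 2 + a x * m x 1 ^ 2

/-- The quadratic form `T(v) = ∫ a |∂ₓv|² + a (v₂² + v₃²) - λ |v|²`. -/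
def T (a : ℝ → ℝ) (m v : ℝ → E3) : ℝ :=
  ∫ x, (a x * ‖deriv v x‖ ^ 2 + a x * (v x 1 ^ 2 + v x 2 ^ 2) - lagrange a m x * ‖v x‖ ^ 2)

/-- The variation `(m + t v) / |m + t v|` of a sphere-valued map. -/
def variation (m v : ℝ → E3) (t : ℝ) (x : ℝ) : E3 :=
  ‖m x + t • v x‖⁻¹ • (m x + t • v x)

/-- `q = ½ d²/dt² e(t)` at `t = 0`: near `0` the energy `e` is finite and differentiable, and its
derivative has derivative `2 q` at `0`. -/
def IsHalfSecondDerivAtZero (e : ℝ → ℝ≥0∞) (q : ℝ) : Prop :=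
  (∀ᶠ t in 𝓝 0, e t ≠ ⊤) ∧
    ∃ e' : ℝ → ℝ, (∀ᶠ t in 𝓝 0, HasDerivAt (fun s => (e s).toReal) (e' t) t) ∧
      HasDerivAt e' (2 * q) 0

/-- The even weight equal to `2` in `(-1, 1)` and to `1` elsewhere. -/
def notch (x : ℝ) : ℝ :=
  if |x| < 1 then 2 else 1

end DomainWall

end

/-! Everything rests on one half-line profile. With the flux `p = a φ'`, the quantity `p ^ 2 - a ^ 2
* cos φ ^ 2` is constant wherever the weight is. Decay at infinity makes it vanish beyond the notch,
and continuity of the flux at `1` then makes it `-3 * cos (φ 1) ^ 2` inside. The inner profile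
therefore solves a first-order equation with the single parameter `s = φ 1`, found by shooting, and
the outer one is a shifted `arctan ∘ sinh` (`exists_halfWall`). The odd extension is the wall.

Minimality comes from a ground state substitution. On `(0, ∞)` both `sin φ` and `cos φ` are positive
and solve the Euler–Lagrange equations with the same multiplier. For a sphere-valued competitor `(f,
g, h)` the energy density equals that of the profile, plus a weighted sum of squares, plus the
derivative of `p (f² - sin² φ) / (sin φ cos φ)` (`ae_excess_eq`). The last function vanishes at both
ends, so the profile minimizes on the half-line (`halfEnergy_le`), and equality forces `f / sin φ`,
`g / cos φ` and `h / cos φ` to be constant (`eq_of_halfEnergy_le`). Applied on both half-lines, this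
gives the unique centered minimizer. Every admissible pendulum solution is such a profile
(`IsPendulumSolution.exists_halfWall`), so the equality case also yields uniqueness for the
equation.

Instability is seen by moving the center: `η = cos φ` is `1` at the origin. Integration by parts
turns `Q η` into the integral of `a cos² φ (φ'² - cos² φ)`, which is zero outside the notch and
negative inside (`Q_neg`). For `F` the direction is the tangential part of `e₁`; its normalized
variation is the planar map of angle `φ + arctan (t cos φ)`, which agrees with `φ + t η` to second
order.

Without centering, `a ≥ 1` and `|m₁'| ≤ |m'| (m₂² + m₃²)^(1/2)` bound the density below by `2 m₁'`,
whose integral is `4`. Translating the homogeneous wall to infinity reaches `4` in the limit.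
Equality would force `m₁² = 1` in the notch and `m₁' = 1 - m₁²` everywhere, hence a constant `m₁`.
-/

namespace DomainWall

/-! ### Absolutely continuous functions on the line -/

section AbsoluteContinuity

theorem absolutelyContinuousOnInterval_congr {X : Type*} [PseudoMetricSpace X] {f g : ℝ → X}
    {x y : ℝ} (hf : AbsolutelyContinuousOnInterval f x y) (h : EqOn f g (uIcc x y)) :
    AbsolutelyContinuousOnInterval g x y := by
  rw [absolutelyContinuousOnInterval_iff] at hf ⊢
  intro ε hε
  obtain ⟨δ, hδ, H⟩ := hf ε hε
  refine ⟨δ, hδ, fun E hE hlt => ?_⟩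
  have := H E hE hlt
  rwa [Finset.sum_congr rfl fun i hi => by rw [h (hE.1 i hi).1, h (hE.1 i hi).2]] at this

theorem absolutelyContinuousOnInterval_lipschitz_comp {X Y : Type*} [PseudoMetricSpace X]
    [PseudoMetricSpace Y] {g : X → Y} {K : NNReal} (hg : LipschitzWith K g) {f : ℝ → X} {x y : ℝ}
    (hf : AbsolutelyContinuousOnInterval f x y) :
    AbsolutelyContinuousOnInterval (fun t => g (f t)) x y := by
  rw [absolutelyContinuousOnInterval_iff] at hf ⊢
  intro ε hε
  obtain ⟨δ, hδ, H⟩ := hf (ε / (K + 1)) (by positivity)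
  refine ⟨δ, hδ, fun E hE hlt => ?_⟩
  have h1 := H E hE hlt
  calc ∑ i ∈ Finset.range E.1, dist (g (f (E.2 i).1)) (g (f (E.2 i).2))
      ≤ ∑ i ∈ Finset.range E.1, (K + 1) * dist (f (E.2 i).1) (f (E.2 i).2) := by
        refine Finset.sum_le_sum fun i _ => (hg.dist_le_mul _ _).trans ?_
        gcongr; linarith
    _ = (K + 1) * ∑ i ∈ Finset.range E.1, dist (f (E.2 i).1) (f (E.2 i).2) := by
        rw [Finset.mul_sum]
    _ < ε := by
        rw [lt_div_iff₀ (by positivity)] at h1; linarith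

theorem LocAC.lipschitz_comp {E E' : Type*} [NormedAddCommGroup E] [NormedSpace ℝ E]
    [NormedAddCommGroup E'] [NormedSpace ℝ E'] {g : E → E'} {K : NNReal} (hg : LipschitzWith K g)
    {f : ℝ → E} (hf : LocAC f) : LocAC (fun t => g (f t)) :=
  fun x y => absolutelyContinuousOnInterval_lipschitz_comp hg (hf x y)

theorem _root_.LipschitzWith.locAC {E : Type*} [NormedAddCommGroup E] [NormedSpace ℝ E] {K : NNReal}
    {f : ℝ → E} (hf : LipschitzWith K f) : LocAC f :=
  fun _ _ => (hf.lipschitzOnWith).absolutelyContinuousOnInterval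

/-- The fundamental theorem of calculus survives a countable exceptional set, so `f` is a constant
plus the primitive of an integrable function. The exceptional points will be those where the weight
jumps, and the origin. -/
theorem absolutelyContinuousOnInterval_of_hasDerivAt_off_countable {f f' : ℝ → ℝ} {x y : ℝ}
    (hxy : x ≤ y) {s : Set ℝ} (hs : s.Countable) (hc : ContinuousOn f (Icc x y))
    (hd : ∀ t ∈ Ioo x y \ s, HasDerivAt f (f' t) t) (hi : IntervalIntegrable f' volume x y) :
    AbsolutelyContinuousOnInterval f x y := by
  have h1 := hi.absolutelyContinuousOnInterval_intervalIntegral (c := x) left_mem_uIcc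
  have h2 : AbsolutelyContinuousOnInterval (fun _ : ℝ => f x) x y :=
    (LipschitzWith.const (f x)).lipschitzOnWith.absolutelyContinuousOnInterval
  refine absolutelyContinuousOnInterval_congr (h2.fun_add h1) fun t ht => ?_
  rw [uIcc_of_le hxy] at ht
  have := integral_eq_of_hasDerivAt_off_countable_of_le f f' ht.1 hs
    (hc.mono (Icc_subset_Icc_right ht.2))
    (fun u hu => hd u ⟨⟨hu.1.1, hu.1.2.trans_le ht.2⟩, hu.2⟩)
    (hi.mono_set (by rw [uIcc_of_le hxy, uIcc_of_le ht.1]; exact Icc_subset_Icc_right ht.2))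
  simp only [this]; ring

theorem LocAC.continuous {E : Type*} [NormedAddCommGroup E] [NormedSpace ℝ E] {f : ℝ → E}
    (hf : LocAC f) : Continuous f := by
  rw [continuous_iff_continuousAt]
  intro x
  refine (hf (x - 1) (x + 1)).continuousOn.continuousAt ?_
  rw [uIcc_of_le (by linarith)]
  exact Icc_mem_nhds (by linarith) (by linarith)

theorem LocAC.ae_differentiableAt {f : ℝ → ℝ} (hf : LocAC f) :
    ∀ᵐ x, DifferentiableAt ℝ f x := by
  have h : ∀ᵐ x, ∀ n : ℕ, x ∈ uIcc (-(n : ℝ)) n → DifferentiableAt ℝ f x :=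
    ae_all_iff.2 fun n => (hf _ _).ae_differentiableAt
  filter_upwards [h] with x hx
  obtain ⟨n, hn⟩ := exists_nat_ge |x|
  refine hx n ?_
  rw [uIcc_of_le (by linarith [abs_nonneg x])]
  exact abs_le.1 hn

theorem LocAC.component {m : ℝ → E3} (hm : LocAC m) (i : Fin 3) : LocAC (fun x => m x i) :=
  LocAC.lipschitz_comp (EuclideanSpace.proj i : E3 →L[ℝ] ℝ).lipschitz hm

theorem LocAC.ae_hasDerivAt_component {m : ℝ → E3} (hm : LocAC m) :
    ∀ᵐ x, HasDerivAt m (deriv m x) x ∧ ∀ i, HasDerivAt (fun y => m y i) (deriv m x i) x := by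
  have h : ∀ᵐ x, ∀ i, DifferentiableAt ℝ (fun y => m y i) x :=
    ae_all_iff.2 fun i => (hm.component i).ae_differentiableAt
  filter_upwards [h] with x hx
  have h1 : DifferentiableAt ℝ m x := (differentiableAt_euclidean).2 hx
  refine ⟨h1.hasDerivAt, fun i => ?_⟩
  exact ((EuclideanSpace.proj i : E3 →L[ℝ] ℝ).hasFDerivAt.comp_hasDerivAt x h1.hasDerivAt)

theorem norm_sq_eq (v : E3) : ‖v‖ ^ 2 = v 0 ^ 2 + v 1 ^ 2 + v 2 ^ 2 := by
  rw [EuclideanSpace.norm_sq_eq, Fin.sum_univ_three]; simp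

theorem LocAC.ae_norm_deriv_sq {m : ℝ → E3} (hm : LocAC m) :
    ∀ᵐ x, ‖deriv m x‖ ^ 2 = deriv (fun y => m y 0) x ^ 2 + deriv (fun y => m y 1) x ^ 2
      + deriv (fun y => m y 2) x ^ 2 := by
  filter_upwards [hm.ae_hasDerivAt_component] with x hx
  rw [(hx.2 0).deriv, (hx.2 1).deriv, (hx.2 2).deriv, norm_sq_eq]

theorem LocAC.comp_neg {E : Type*} [NormedAddCommGroup E] [NormedSpace ℝ E] {f : ℝ → E}
    (hf : LocAC f) : LocAC (fun x => f (-x)) := by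
  intro x y
  have h := hf (-x) (-y)
  rw [absolutelyContinuousOnInterval_iff] at h ⊢
  intro ε hε
  obtain ⟨δ, hδ, H⟩ := h ε hε
  refine ⟨δ, hδ, fun E hE hlt => ?_⟩
  have hmem : ∀ t, t ∈ uIcc x y → -t ∈ uIcc (-x) (-y) := by
    intro t ht
    simp only [mem_uIcc] at ht ⊢
    rcases ht with ht | ht
    · right; constructor <;> linarith
    · left; constructor <;> linarith
  have := H (E.1, fun i => (-(E.2 i).2, -(E.2 i).1))
    ⟨fun i hi => ⟨hmem _ (hE.1 i hi).2, hmem _ (hE.1 i hi).1⟩, ?_⟩ ?_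
  · refine lt_of_eq_of_lt (Finset.sum_congr rfl fun i _ => ?_) this
    simp [dist_comm]
  · intro i hi j hj hij
    have hd := hE.2 hi hj hij
    simp only [Function.onFun, uIoc, disjoint_iff_inter_eq_empty, Ioc_inter_Ioc, Ioc_eq_empty_iff] at hd ⊢
    grind
  · refine lt_of_eq_of_lt (Finset.sum_congr rfl fun i _ => ?_) hlt
    simp only [Real.dist_eq, neg_sub_neg]

theorem LocAC.neg {E : Type*} [NormedAddCommGroup E] [NormedSpace ℝ E] {f : ℝ → E}
    (hf : LocAC f) : LocAC (fun x => -f x) := fun x y => (hf x y).fun_neg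

end AbsoluteContinuity

/-! ### The weight -/

section Notch

theorem notch_of_lt {x : ℝ} (h : |x| < 1) : notch x = 2 := if_pos h
theorem notch_of_ge {x : ℝ} (h : 1 ≤ |x|) : notch x = 1 := if_neg h.not_gt
theorem one_le_notch (x : ℝ) : 1 ≤ notch x := by unfold notch; split_ifs <;> norm_num
theorem notch_le_two (x : ℝ) : notch x ≤ 2 := by unfold notch; split_ifs <;> norm_num
theorem notch_pos (x : ℝ) : 0 < notch x := zero_lt_one.trans_le (one_le_notch x)
theorem notch_neg (x : ℝ) : notch (-x) = notch x := by simp [notch]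

theorem measurable_notch : Measurable notch :=
  Measurable.ite (measurableSet_lt measurable_norm measurable_const) measurable_const
    measurable_const

theorem notch_eventuallyEq {x : ℝ} (h : |x| ≠ 1) : notch =ᶠ[𝓝 x] fun _ => notch x := by
  rcases lt_or_gt_of_ne h with h | h
  · filter_upwards [(isOpen_lt continuous_abs continuous_const).mem_nhds h] with y hy
    rw [notch_of_lt hy, notch_of_lt h]
  · filter_upwards [(isOpen_lt continuous_const continuous_abs).mem_nhds h] with y hy
    rw [notch_of_ge (le_of_lt hy), notch_of_ge h.le]

theorem intervalIntegrable_notch_mul {f : ℝ → ℝ} {x y : ℝ}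
    (hf : IntervalIntegrable f volume x y) :
    IntervalIntegrable (fun t => notch t * f t) volume x y := by
  rw [intervalIntegrable_iff] at hf ⊢
  refine hf.bdd_mul (c := 2) measurable_notch.aestronglyMeasurable (ae_of_all _ fun t => ?_)
  rw [Real.norm_eq_abs, abs_of_pos (notch_pos t)]; exact notch_le_two t

theorem intervalIntegrable_div_notch {f : ℝ → ℝ} {x y : ℝ}
    (hf : IntervalIntegrable f volume x y) :
    IntervalIntegrable (fun t => f t / notch t) volume x y := by
  rw [intervalIntegrable_iff] at hf ⊢
  simp only [div_eq_inv_mul]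
  refine hf.bdd_mul (c := 1) measurable_notch.inv.aestronglyMeasurable (ae_of_all _ fun t => ?_)
  rw [Real.norm_eq_abs, abs_of_pos (inv_pos.2 (notch_pos t))]
  exact inv_le_one_of_one_le₀ (one_le_notch t)

end Notch

/-! ### The energy in components and its splitting at the origin -/

section Energy

/-- The energy density of the map with components `f`, `g`, `h`. -/
noncomputable def density (f g h : ℝ → ℝ) (x : ℝ) : ℝ :=
  notch x * (deriv f x ^ 2 + deriv g x ^ 2 + deriv h x ^ 2) + notch x * (g x ^ 2 + h x ^ 2)

/-- The energy on the positive half-line of the map with components `f`, `g`, `h`. -/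
noncomputable def halfEnergy (f g h : ℝ → ℝ) : ℝ≥0∞ :=
  ∫⁻ x in Ioi 0, ENNReal.ofReal (density f g h x)

theorem density_nonneg (f g h : ℝ → ℝ) (x : ℝ) : 0 ≤ density f g h x := by
  have := notch_pos x
  unfold density; positivity

theorem measurable_density {f g h : ℝ → ℝ} (hg : Continuous g) (hh : Continuous h) :
    Measurable (density f g h) :=
  (measurable_notch.mul ((((measurable_deriv f).pow_const 2).add
    ((measurable_deriv g).pow_const 2)).add ((measurable_deriv h).pow_const 2))).add
    (measurable_notch.mul ((hg.measurable.pow_const 2).add (hh.measurable.pow_const 2)))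

theorem F_eq_lintegral {m : ℝ → E3} (hm : LocAC m) :
    F notch m = ∫⁻ x, ENNReal.ofReal
      (density (fun x => m x 0) (fun x => m x 1) (fun x => m x 2) x) := by
  rw [F, if_pos hm]
  refine lintegral_congr_ae ?_
  filter_upwards [hm.ae_norm_deriv_sq] with x hx
  rw [hx, density]

/-- The sign on the reflected first component makes the left half of a centered wall run from `e₂`
to `e₁` as the right half does, so one half-line estimate serves both. -/
theorem F_eq_halfEnergy_add {m : ℝ → E3} (hm : LocAC m) :
    F notch m = halfEnergy (fun x => m x 0) (fun x => m x 1) (fun x => m x 2)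
      + halfEnergy (fun x => -m (-x) 0) (fun x => m (-x) 1) (fun x => m (-x) 2) := by
  rw [F_eq_lintegral hm, ← lintegral_add_compl _ (measurableSet_Ioi (a := (0 : ℝ)))]
  congr 1
  rw [compl_Ioi, setLIntegral_congr (Iio_ae_eq_Iic).symm, halfEnergy,
    ← lintegral_indicator measurableSet_Iio, ← lintegral_indicator measurableSet_Ioi,
    ← lintegral_neg_eq_self]
  refine lintegral_congr fun x => ?_
  by_cases hx : 0 < x
  · rw [indicator_of_mem (by simpa using hx), indicator_of_mem (by simpa using hx)]
    simp only [density, notch_neg]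
    have h0 := deriv_comp_neg (fun y => m y 0) x
    have h1 := deriv_comp_neg (fun y => m y 1) x
    have h2 := deriv_comp_neg (fun y => m y 2) x
    rw [deriv.fun_neg, h0, h1, h2]
    ring_nf
  · rw [indicator_of_notMem (by simpa using hx), indicator_of_notMem (by simpa using hx)]

end Energy

/-! ### Half-line profiles: first integral and elementary bounds -/

/-- The angle `φ` and the flux `p = a ∂ₓφ` solve the weighted pendulum equation in `(0, ∞)`, off
the jump of the weight. -/
structure PendulumFlow (φ p : ℝ → ℝ) : Prop where
  continuous_angle : Continuous φ
  continuous_flux : Continuous p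
  hasDerivAt_angle : ∀ x, 0 < x → x ≠ 1 → HasDerivAt φ (p x / notch x) x
  hasDerivAt_flux : ∀ x, 0 < x → x ≠ 1 →
    HasDerivAt p (-(notch x * (Real.sin (φ x) * Real.cos (φ x)))) x

/-- The angle `φ` and the flux `p = a ∂ₓφ` of a profile on the half-line `[0, ∞)`: it solves the
weighted pendulum equation off the jump of the weight, starts at `0`, and increases to `π/2`. -/
structure HalfWall (φ p : ℝ → ℝ) : Prop extends PendulumFlow φ p where
  zero : φ 0 = 0
  pos : ∀ x, 0 < x → 0 < φ x
  lt : ∀ x, 0 < x → φ x < Real.pi / 2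
  flux_eq : ∀ x, 1 ≤ x → p x = Real.cos (φ x)
  tendsto : Tendsto φ atTop (𝓝 (Real.pi / 2))

namespace PendulumFlow

variable {φ p : ℝ → ℝ}

/-- Conservation of `p ^ 2 - 4 * cos φ ^ 2` inside the notch; the hypothesis at `1` evaluates it as
`(1 - 4) * cos (φ 1) ^ 2`. -/
theorem flux_sq (h : PendulumFlow φ p) (h1 : p 1 = Real.cos (φ 1)) {x : ℝ} (hx : x ∈ Icc (0 : ℝ) 1) :
    p x ^ 2 = 4 * Real.cos (φ x) ^ 2 - 3 * Real.cos (φ 1) ^ 2 := by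
  have hc : Continuous fun t => p t ^ 2 - 4 * Real.cos (φ t) ^ 2 :=
    (h.continuous_flux.pow 2).sub (continuous_const.mul
      ((Real.continuous_cos.comp h.continuous_angle).pow 2))
  have := integral_eq_of_hasDerivAt_off_countable_of_le
    (fun t => p t ^ 2 - 4 * Real.cos (φ t) ^ 2) (fun _ => 0) hx.2 countable_empty hc.continuousOn
    (fun t ht => by
      have ht0 : 0 < t := hx.1.trans_lt ht.1.1
      have h3 := h.hasDerivAt_angle t ht0 ht.1.2.ne
      have h2 := h.hasDerivAt_flux t ht0 ht.1.2.ne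
      rw [notch_of_lt (by rw [abs_of_pos ht0]; exact ht.1.2)] at h3 h2
      refine ((h2.pow 2).sub ((h3.cos.pow 2).const_mul 4)).congr_deriv ?_
      norm_num; ring) (by simp)
  simp only [intervalIntegral.integral_zero, h1] at this
  linarith

theorem continuous_sin (h : PendulumFlow φ p) : Continuous fun x => Real.sin (φ x) :=
  Real.continuous_sin.comp h.continuous_angle

theorem continuous_cos (h : PendulumFlow φ p) : Continuous fun x => Real.cos (φ x) :=
  Real.continuous_cos.comp h.continuous_angle

theorem flux_antitoneOn (h : PendulumFlow φ p)
    (hsc : ∀ x, 0 < x → 0 ≤ Real.sin (φ x) * Real.cos (φ x)) {s : Set ℝ} (hs : Convex ℝ s)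
    (hi : ∀ t ∈ interior s, 0 < t ∧ t ≠ 1) : AntitoneOn p s := by
  refine antitoneOn_of_deriv_nonpos hs h.continuous_flux.continuousOn
    (fun t ht => (h.hasDerivAt_flux t (hi t ht).1
      (hi t ht).2).differentiableAt.differentiableWithinAt) fun t ht => ?_
  rw [(h.hasDerivAt_flux t (hi t ht).1 (hi t ht).2).deriv, neg_nonpos]
  exact mul_nonneg (notch_pos t).le (hsc t (hi t ht).1)

theorem mul_sub_le_angle_sub (h : PendulumFlow φ p) {c x y : ℝ} (hx : 0 ≤ x) (hxy : x ≤ y)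
    (hc : ∀ t ∈ Ioo x y, t ≠ 1 ∧ c ≤ p t / notch t) : c * (y - x) ≤ φ y - φ x := by
  refine (convex_Icc x y).mul_sub_le_image_sub_of_le_deriv h.continuous_angle.continuousOn
    ?_ ?_ x (left_mem_Icc.2 hxy) y (right_mem_Icc.2 hxy) hxy <;> rw [interior_Icc] <;> intro t ht
  · exact (h.hasDerivAt_angle t (hx.trans_lt ht.1)
      (hc t ht).1).differentiableAt.differentiableWithinAt
  · rw [(h.hasDerivAt_angle t (hx.trans_lt ht.1) (hc t ht).1).deriv]
    exact (hc t ht).2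

theorem angle_sub_le_mul_sub (h : PendulumFlow φ p) {c x y : ℝ} (hx : 0 ≤ x) (hxy : x ≤ y)
    (hc : ∀ t ∈ Ioo x y, t ≠ 1 ∧ p t / notch t ≤ c) : φ y - φ x ≤ c * (y - x) := by
  refine (convex_Icc x y).image_sub_le_mul_sub_of_deriv_le h.continuous_angle.continuousOn
    ?_ ?_ x (left_mem_Icc.2 hxy) y (right_mem_Icc.2 hxy) hxy <;> rw [interior_Icc] <;> intro t ht
  · exact (h.hasDerivAt_angle t (hx.trans_lt ht.1)
      (hc t ht).1).differentiableAt.differentiableWithinAt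
  · rw [(h.hasDerivAt_angle t (hx.trans_lt ht.1) (hc t ht).1).deriv]
    exact (hc t ht).2

end PendulumFlow

namespace HalfWall

variable {φ p : ℝ → ℝ}

theorem sin_pos (h : HalfWall φ p) {x : ℝ} (hx : 0 < x) : 0 < Real.sin (φ x) :=
  Real.sin_pos_of_pos_of_lt_pi (h.pos x hx) (by linarith [h.lt x hx, Real.pi_pos])

theorem cos_pos (h : HalfWall φ p) {x : ℝ} (hx : 0 ≤ x) : 0 < Real.cos (φ x) := by
  rcases hx.eq_or_lt with rfl | hx
  · simp [h.zero]
  · exact Real.cos_pos_of_mem_Ioo ⟨by linarith [h.pos x hx, Real.pi_pos], h.lt x hx⟩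

theorem flux_one_pos (h : HalfWall φ p) : 0 < p 1 := by
  rw [h.flux_eq 1 le_rfl]; exact h.cos_pos zero_le_one

theorem flux_one_le (h : HalfWall φ p) {x : ℝ} (hx : x ∈ Icc (0 : ℝ) 1) : p 1 ≤ p x :=
  h.flux_antitoneOn (fun t ht => (mul_pos (h.sin_pos ht) (h.cos_pos ht.le)).le) (convex_Icc 0 1)
    (fun t ht => by rw [interior_Icc] at ht; exact ⟨ht.1, ht.2.ne⟩) hx
    (right_mem_Icc.2 zero_le_one) hx.2

theorem flux_pos (h : HalfWall φ p) {x : ℝ} (hx : 0 ≤ x) : 0 < p x := by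
  rcases le_total x 1 with h1 | h1
  · exact h.flux_one_pos.trans_le (h.flux_one_le ⟨hx, h1⟩)
  · rw [h.flux_eq x h1]; exact h.cos_pos hx

/-- Inside the notch the first integral gives `(p / 2) ^ 2 = cos φ ^ 2 - 3 / 4 * cos (φ 1) ^ 2`;
outside there is equality. The gap inside is what later makes the wall unstable. -/
theorem flux_div_notch_le (h : HalfWall φ p) {x : ℝ} (hx : 0 ≤ x) :
    p x / notch x ≤ Real.cos (φ x) := by
  rcases lt_or_ge x 1 with h1 | h1
  · rw [notch_of_lt (by rw [abs_of_nonneg hx]; exact h1), div_le_iff₀ two_pos]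
    refine abs_le_of_sq_le_sq' ?_ (by have := h.cos_pos hx; positivity) |>.2
    rw [h.flux_sq (h.flux_eq 1 le_rfl) ⟨hx, h1.le⟩]
    nlinarith [sq_nonneg (Real.cos (φ 1))]
  · rw [notch_of_ge (by rw [abs_of_nonneg hx]; exact h1), div_one, h.flux_eq x h1]

theorem mul_le_angle (h : HalfWall φ p) {x : ℝ} (hx : x ∈ Icc (0 : ℝ) 1) :
    p 1 / 2 * x ≤ φ x := by
  have := h.mul_sub_le_angle_sub (c := p 1 / 2) le_rfl hx.1 fun t ht => by
    have ht1 := ht.2.trans_le hx.2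
    rw [notch_of_lt (by rw [abs_of_pos ht.1]; exact ht1)]
    exact ⟨ht1.ne, by linarith [h.flux_one_le ⟨ht.1.le, ht1.le⟩]⟩
  simpa [h.zero] using this

theorem tendsto_sin (h : HalfWall φ p) : Tendsto (fun x => Real.sin (φ x)) atTop (𝓝 1) := by
  simpa [Function.comp_def] using (Real.continuous_sin.tendsto _).comp h.tendsto

end HalfWall

/-! ### Energy of the profile and regularity of the singular coefficients -/

/-- The Lagrange multiplier of the planar map with angle `φ` and flux `p`. -/
noncomputable def multiplier (φ p : ℝ → ℝ) (x : ℝ) : ℝ :=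
  p x ^ 2 / notch x + notch x * Real.cos (φ x) ^ 2

theorem multiplier_nonneg (φ p : ℝ → ℝ) (x : ℝ) : 0 ≤ multiplier φ p x := by
  have := notch_pos x
  unfold multiplier; positivity

/-- The coefficient `p / (sin φ cos φ)` of the null Lagrangian. -/
noncomputable def nullCoeff (φ p : ℝ → ℝ) (x : ℝ) : ℝ :=
  p x / (Real.sin (φ x) * Real.cos (φ x))

namespace HalfWall

variable {φ p : ℝ → ℝ}

theorem integrableOn_multiplier (h : HalfWall φ p) : IntegrableOn (multiplier φ p) (Ioi 0) := by
  rw [← Ioc_union_Ioi_eq_Ioi (zero_le_one (α := ℝ))]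
  refine IntegrableOn.union ?_ ?_
  · rw [← intervalIntegrable_iff_integrableOn_Ioc_of_le zero_le_one]
    exact (intervalIntegrable_div_notch ((h.continuous_flux.pow 2).intervalIntegrable _ _)).add
      (intervalIntegrable_notch_mul ((h.continuous_cos.pow 2).intervalIntegrable _ _))
  · have h1 := integrableOn_Ioi_deriv_of_nonneg (a := 1) (l := 2 * 1)
      (g := fun x => 2 * Real.sin (φ x)) (g' := multiplier φ p)
      (continuous_const.mul h.continuous_sin).continuousWithinAt
      (fun x hx => by
        have hx' : (1 : ℝ) < x := hx
        have hx0 : 0 < x := zero_lt_one.trans hx'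
        refine ((h.hasDerivAt_angle x hx0 hx'.ne').sin.const_mul 2).congr_deriv ?_
        rw [multiplier, notch_of_ge (by rw [abs_of_pos hx0]; exact hx'.le), h.flux_eq x hx'.le]
        ring)
      (fun x _ => multiplier_nonneg _ _ _) (h.tendsto_sin.const_mul 2)
    exact h1

theorem density_eq_multiplier (h : HalfWall φ p) {x : ℝ} (hx : 0 < x) (hx1 : x ≠ 1) :
    density (fun t => Real.sin (φ t)) (fun t => Real.cos (φ t)) (fun _ => 0) x
      = multiplier φ p x := by
  have hd := h.hasDerivAt_angle x hx hx1
  have hn := notch_pos x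
  rw [density, hd.sin.deriv, hd.cos.deriv, deriv_const, multiplier]
  have := Real.sin_sq_add_cos_sq (φ x)
  field_simp
  linear_combination (p x ^ 2) * this

theorem halfEnergy_eq (h : HalfWall φ p) :
    halfEnergy (fun t => Real.sin (φ t)) (fun t => Real.cos (φ t)) (fun _ => 0)
      = ENNReal.ofReal (∫ x in Ioi 0, multiplier φ p x) := by
  rw [ofReal_integral_eq_lintegral_ofReal h.integrableOn_multiplier
    (ae_of_all _ (multiplier_nonneg φ p)), halfEnergy]
  refine lintegral_congr_ae ?_
  have h1 : ∀ᵐ x : ℝ, x ≠ 1 := by simp [ae_iff]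
  rw [EventuallyEq, ae_restrict_iff' measurableSet_Ioi]
  filter_upwards [h1] with x hx hx0
  rw [h.density_eq_multiplier hx0 hx]

theorem hasDerivAt_nullCoeff (h : HalfWall φ p) {x : ℝ} (hx : 0 < x) (hx1 : x ≠ 1) :
    HasDerivAt (nullCoeff φ p) (-notch x - (p x ^ 2 * (Real.cos (φ x) ^ 2 - Real.sin (φ x) ^ 2)
      / (Real.sin (φ x) * Real.cos (φ x)) ^ 2) / notch x) x := by
  have hd := h.hasDerivAt_angle x hx hx1
  have hs := h.sin_pos hx
  have hc := h.cos_pos hx.le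
  have hn := notch_pos x
  refine ((h.hasDerivAt_flux x hx hx1).div (hd.sin.mul hd.cos)
    (mul_pos hs hc).ne').congr_deriv ?_
  simp only [Pi.mul_apply]
  field_simp
  ring

theorem absolutelyContinuous_nullCoeff (h : HalfWall φ p) {x y : ℝ} (hx : 0 < x) (hxy : x ≤ y) :
    AbsolutelyContinuousOnInterval (nullCoeff φ p) x y := by
  have hne : ∀ t ∈ Icc x y, Real.sin (φ t) * Real.cos (φ t) ≠ 0 := fun t ht =>
    (mul_pos (h.sin_pos (hx.trans_le ht.1)) (h.cos_pos (hx.trans_le ht.1).le)).ne'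
  refine absolutelyContinuousOnInterval_of_hasDerivAt_off_countable hxy (countable_singleton 1)
    (h.continuous_flux.continuousOn.div (h.continuous_sin.mul h.continuous_cos).continuousOn hne)
    (fun t ht => h.hasDerivAt_nullCoeff (hx.trans ht.1.1) ht.2) ?_
  refine IntervalIntegrable.sub ?_ (intervalIntegrable_div_notch ?_)
  · simpa using intervalIntegrable_notch_mul
      (continuous_const (y := (-1 : ℝ)).intervalIntegrable x y)
  · refine ContinuousOn.intervalIntegrable_of_Icc hxy ?_
    refine ContinuousOn.div ?_ ?_ fun t ht => pow_ne_zero 2 (hne t ht)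
    · exact ((h.continuous_flux.pow 2).mul
        ((h.continuous_cos.pow 2).sub (h.continuous_sin.pow 2))).continuousOn
    · exact ((h.continuous_sin.mul h.continuous_cos).pow 2).continuousOn

theorem absolutelyContinuous_angle (h : HalfWall φ p) {x y : ℝ} (hx : 0 ≤ x) (hxy : x ≤ y) :
    AbsolutelyContinuousOnInterval φ x y :=
  absolutelyContinuousOnInterval_of_hasDerivAt_off_countable hxy (countable_singleton 1)
    h.continuous_angle.continuousOn (fun t ht => h.hasDerivAt_angle t (hx.trans_lt ht.1.1) ht.2)
    (intervalIntegrable_div_notch (h.continuous_flux.intervalIntegrable _ _))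

theorem absolutelyContinuous_inv_sin (h : HalfWall φ p) {x y : ℝ} (hx : 0 < x) (hxy : x ≤ y) :
    AbsolutelyContinuousOnInterval (fun t => (Real.sin (φ t))⁻¹) x y := by
  have hne : ∀ t ∈ Icc x y, Real.sin (φ t) ≠ 0 := fun t ht => (h.sin_pos (hx.trans_le ht.1)).ne'
  refine absolutelyContinuousOnInterval_of_hasDerivAt_off_countable hxy (countable_singleton 1)
    (h.continuous_sin.continuousOn.inv₀ hne)
    (f' := fun t => (-(p t * Real.cos (φ t)) / Real.sin (φ t) ^ 2) / notch t)
    (fun t ht => ?_) (intervalIntegrable_div_notch (ContinuousOn.intervalIntegrable_of_Icc hxy ?_))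
  · have hn := notch_pos t
    have hs := h.sin_pos (hx.trans ht.1.1)
    refine ((h.hasDerivAt_angle t (hx.trans ht.1.1) ht.2).sin.inv hs.ne').congr_deriv ?_
    field_simp
  · exact (h.continuous_flux.mul h.continuous_cos).neg.continuousOn.div
      (h.continuous_sin.pow 2).continuousOn fun t ht => pow_ne_zero 2 (hne t ht)

theorem absolutelyContinuous_inv_cos (h : HalfWall φ p) {x y : ℝ} (hx : 0 ≤ x) (hxy : x ≤ y) :
    AbsolutelyContinuousOnInterval (fun t => (Real.cos (φ t))⁻¹) x y := by
  have hne : ∀ t ∈ Icc x y, Real.cos (φ t) ≠ 0 := fun t ht => (h.cos_pos (hx.trans ht.1)).ne'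
  refine absolutelyContinuousOnInterval_of_hasDerivAt_off_countable hxy (countable_singleton 1)
    (h.continuous_cos.continuousOn.inv₀ hne)
    (f' := fun t => ((p t * Real.sin (φ t)) / Real.cos (φ t) ^ 2) / notch t)
    (fun t ht => ?_) (intervalIntegrable_div_notch (ContinuousOn.intervalIntegrable_of_Icc hxy ?_))
  · have hn := notch_pos t
    have hs := h.cos_pos (hx.trans ht.1.1.le)
    refine ((h.hasDerivAt_angle t (hx.trans_lt ht.1.1) ht.2).cos.inv hs.ne').congr_deriv ?_
    field_simp
  · exact (h.continuous_flux.mul h.continuous_sin).continuousOn.div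
      (h.continuous_cos.pow 2).continuousOn fun t ht => pow_ne_zero 2 (hne t ht)

end HalfWall

/-! ### Ground state decomposition and minimality on the half-line -/

/-- The components of a sphere-valued map on `[0, ∞)` that runs from `e₂` to `e₁`. -/
structure HalfCompetitor (f g h : ℝ → ℝ) : Prop where
  locAC_f : LocAC f
  locAC_g : LocAC g
  locAC_h : LocAC h
  norm_sq : ∀ x, f x ^ 2 + g x ^ 2 + h x ^ 2 = 1
  f_zero : f 0 = 0
  g_zero : g 0 = 1
  h_zero : h 0 = 0
  tendsto : Tendsto f atTop (𝓝 1)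

/-- The sum of squares in the ground state decomposition of the energy density. -/
noncomputable def excess (φ p f g h : ℝ → ℝ) (x : ℝ) : ℝ :=
  notch x * ((deriv f x - Real.cos (φ x) / Real.sin (φ x) * (p x / notch x) * f x) ^ 2
    + (deriv g x + Real.sin (φ x) / Real.cos (φ x) * (p x / notch x) * g x) ^ 2
    + (deriv h x + Real.sin (φ x) / Real.cos (φ x) * (p x / notch x) * h x) ^ 2)

theorem excess_nonneg (φ p f g h : ℝ → ℝ) (x : ℝ) : 0 ≤ excess φ p f g h x := by
  have := notch_pos x
  unfold excess; positivity

/-- The null Lagrangian `p (f² - sin² φ) / (sin φ cos φ)`. -/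
noncomputable def nullLagrangian (φ p f : ℝ → ℝ) (x : ℝ) : ℝ :=
  nullCoeff φ p x * (f x ^ 2 - Real.sin (φ x) ^ 2)

/-- Pointwise form of the decomposition, with `s = sin φ` and `c = cos φ`. The factors `c / s * (p /
a)` and `-(s / c) * (p / a)` are the logarithmic derivatives of `sin φ` and `cos φ`. The sphere
constraint and its derivative eliminate `g ^ 2 + h ^ 2` and `g * g' + h * h'`, so the cross terms
depend on `f` alone and form a total derivative. -/
theorem excess_algebra {a s c p f g h f' g' h' : ℝ} (ha : 0 < a) (hs : 0 < s) (hc : 0 < c)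
    (hsc : s ^ 2 + c ^ 2 = 1) (hn : f ^ 2 + g ^ 2 + h ^ 2 = 1)
    (ho : f * f' + g * g' + h * h' = 0) :
    a * ((f' - c / s * (p / a) * f) ^ 2 + (g' + s / c * (p / a) * g) ^ 2
      + (h' + s / c * (p / a) * h) ^ 2)
    = (a * (f' ^ 2 + g' ^ 2 + h' ^ 2) + a * (g ^ 2 + h ^ 2)) - (p ^ 2 / a + a * c ^ 2)
      - ((-a - (p ^ 2 * (c ^ 2 - s ^ 2) / (s * c) ^ 2) / a) * (f ^ 2 - s ^ 2)
        + p / (s * c) * (2 * f * f' - 2 * s * (c * (p / a)))) := by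
  have h1 : g ^ 2 + h ^ 2 = 1 - f ^ 2 := by linarith
  have h2 : g * g' + h * h' = -(f * f') := by linarith
  have e1 : a * ((f' - c / s * (p / a) * f) ^ 2 + (g' + s / c * (p / a) * g) ^ 2
      + (h' + s / c * (p / a) * h) ^ 2)
    = a * (f' ^ 2 + g' ^ 2 + h' ^ 2) - 2 * (c / s) * p * (f * f')
      + 2 * (s / c) * p * (g * g' + h * h') + (c / s) ^ 2 * (p ^ 2 / a) * f ^ 2
      + (s / c) ^ 2 * (p ^ 2 / a) * (g ^ 2 + h ^ 2) := by
    field_simp; ring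
  rw [e1, h1, h2]
  have hc2 : c ^ 2 = 1 - s ^ 2 := by linarith
  field_simp
  have hc4 : c ^ 4 = (1 - s ^ 2) ^ 2 := by rw [← hc2]; ring
  have hc3 : c ^ 3 = c * (1 - s ^ 2) := by rw [← hc2]; ring
  ring_nf
  simp only [hc2, hc3, hc4]
  ring

namespace HalfWall

variable {φ p f g h : ℝ → ℝ}

theorem ae_excess_eq (w : HalfWall φ p) (c : HalfCompetitor f g h) :
    ∀ᵐ x, 0 < x → excess φ p f g h x
      = density f g h x - multiplier φ p x - deriv (nullLagrangian φ p f) x := by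
  have h1 : ∀ᵐ x : ℝ, x ≠ 1 := by simp [ae_iff]
  filter_upwards [h1, c.locAC_f.ae_differentiableAt, c.locAC_g.ae_differentiableAt,
    c.locAC_h.ae_differentiableAt] with x hx1 hf hg hh hx
  have ho : f x * deriv f x + g x * deriv g x + h x * deriv h x = 0 := by
    have h2 := ((hf.hasDerivAt.pow 2).add (hg.hasDerivAt.pow 2)).add (hh.hasDerivAt.pow 2)
    have h3 : (f ^ 2 + g ^ 2 + h ^ 2) = fun _ => (1 : ℝ) := funext c.norm_sq
    rw [h3] at h2
    have := h2.unique (hasDerivAt_const x 1)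
    norm_num at this
    linarith
  have hd : HasDerivAt (nullLagrangian φ p f) _ x :=
    (w.hasDerivAt_nullCoeff hx hx1).mul
      ((hf.hasDerivAt.pow 2).sub ((w.hasDerivAt_angle x hx hx1).sin.pow 2))
  rw [hd.deriv, excess, excess_algebra (notch_pos x) (w.sin_pos hx) (w.cos_pos hx.le)
    (Real.sin_sq_add_cos_sq _) (c.norm_sq x) ho, density, multiplier, nullCoeff]
  norm_num

theorem absolutelyContinuous_nullLagrangian (w : HalfWall φ p) (hf : LocAC f) {x y : ℝ}
    (hx : 0 < x) (hxy : x ≤ y) : AbsolutelyContinuousOnInterval (nullLagrangian φ p f) x y := by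
  have h1 := absolutelyContinuousOnInterval_lipschitz_comp Real.lipschitzWith_sin
    (w.absolutelyContinuous_angle hx.le hxy)
  have := (w.absolutelyContinuous_nullCoeff hx hxy).mul
    (((hf x y).mul (hf x y)).sub (h1.mul h1))
  convert this using 1
  ext t
  simp only [nullLagrangian, Pi.mul_apply, Pi.sub_apply]
  ring

theorem intervalIntegral_excess (w : HalfWall φ p) (c : HalfCompetitor f g h)
    (hD : IntegrableOn (density f g h) (Ioi 0)) {x y : ℝ} (hx : 0 < x) (hxy : x ≤ y) :
    IntervalIntegrable (excess φ p f g h) volume x y ∧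
    ∫ t in x..y, excess φ p f g h t = (∫ t in x..y, (density f g h t - multiplier φ p t))
      - (nullLagrangian φ p f y - nullLagrangian φ p f x) := by
  have hac := w.absolutelyContinuous_nullLagrangian c.locAC_f hx hxy
  have hsub : Ioc x y ⊆ Ioi 0 := fun t ht => hx.trans ht.1
  have hi : IntervalIntegrable (fun t => density f g h t - multiplier φ p t) volume x y := by
    rw [intervalIntegrable_iff_integrableOn_Ioc_of_le hxy]
    exact (hD.sub w.integrableOn_multiplier).mono_set hsub
  have hae : (excess φ p f g h) =ᵐ[volume.restrict (uIoc x y)]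
      fun t => density f g h t - multiplier φ p t - deriv (nullLagrangian φ p f) t := by
    rw [EventuallyEq, ae_restrict_iff' measurableSet_uIoc, uIoc_of_le hxy]
    filter_upwards [w.ae_excess_eq c] with t ht ht'
    exact ht (hsub ht')
  refine ⟨(hi.sub hac.intervalIntegrable_deriv).congr_ae hae.symm, ?_⟩
  rw [intervalIntegral.integral_congr_ae_restrict hae,
    intervalIntegral.integral_sub hi hac.intervalIntegrable_deriv, hac.integral_deriv_eq_sub]

/-- Beyond the notch `p = cos φ` cancels the vanishing cosine in the denominator and leaves `(f² -
sin² φ) / sin φ`. -/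
theorem tendsto_nullLagrangian_atTop (w : HalfWall φ p) (c : HalfCompetitor f g h) :
    Tendsto (nullLagrangian φ p f) atTop (𝓝 0) := by
  have h1 : Tendsto (fun x => (Real.sin (φ x))⁻¹ * (f x ^ 2 - Real.sin (φ x) ^ 2)) atTop
      (𝓝 ((1 : ℝ)⁻¹ * (1 ^ 2 - 1 ^ 2))) :=
    (w.tendsto_sin.inv₀ one_ne_zero).mul ((c.tendsto.pow 2).sub (w.tendsto_sin.pow 2))
  norm_num at h1
  refine h1.congr' ?_
  filter_upwards [eventually_ge_atTop 1] with x hx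
  have hc := w.cos_pos (zero_le_one.trans hx)
  rw [nullLagrangian, nullCoeff, w.flux_eq x hx]
  congr 1
  field_simp

end HalfWall

theorem integrableOn_deriv_sq_of_integrableOn_density {f g h : ℝ → ℝ} {s : Set ℝ}
    (hD : IntegrableOn (density f g h) s) :
    IntegrableOn (fun x => deriv f x ^ 2) s := by
  refine hD.mono' ((measurable_deriv f).pow_const 2).aestronglyMeasurable (ae_of_all _ fun x => ?_)
  rw [Real.norm_eq_abs, abs_of_nonneg (sq_nonneg _), density]
  nlinarith [one_le_notch x, sq_nonneg (deriv f x), sq_nonneg (deriv g x), sq_nonneg (deriv h x),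
    sq_nonneg (g x), sq_nonneg (h x), mul_nonneg (notch_pos x).le (sq_nonneg (deriv g x)),
    mul_nonneg (notch_pos x).le (sq_nonneg (deriv h x)), mul_nonneg (notch_pos x).le
    (sq_nonneg (g x)), mul_nonneg (notch_pos x).le (sq_nonneg (h x)),
    mul_le_mul_of_nonneg_right (one_le_notch x) (sq_nonneg (deriv f x))]

theorem sq_integral_le_mul_integral_sq {u : ℝ → ℝ} {x : ℝ} (hx : 0 < x)
    (hu : IntervalIntegrable u volume 0 x) (hu2 : IntervalIntegrable (fun t => u t ^ 2) volume 0 x) :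
    (∫ t in 0..x, u t) ^ 2 ≤ x * ∫ t in 0..x, u t ^ 2 := by
  -- The mean of `u`: nonnegativity of the variance is the Cauchy–Schwarz inequality.
  set μ := (∫ t in 0..x, u t) / x with hμ
  have h1 : 0 ≤ ∫ t in 0..x, (u t - μ) ^ 2 :=
    intervalIntegral.integral_nonneg hx.le fun t _ => sq_nonneg _
  have h2 : ∫ t in 0..x, (u t - μ) ^ 2
      = (∫ t in 0..x, u t ^ 2) - 2 * μ * (∫ t in 0..x, u t) + μ ^ 2 * x := by
    rw [← intervalIntegral.integral_const_mul, ← intervalIntegral.integral_sub hu2 (hu.const_mul _)]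
    have h3 : μ ^ 2 * x = ∫ _ in 0..x, μ ^ 2 := by simp [mul_comm]
    rw [h3, ← intervalIntegral.integral_add (hu2.sub (hu.const_mul _)) (by simp)]
    congr 1; ext t; ring
  have h4 : ∫ t in 0..x, u t = μ * x := by rw [hμ]; field_simp
  rw [h2] at h1
  rw [h4] at h1 ⊢
  nlinarith

namespace HalfWall

variable {φ p f g h : ℝ → ℝ}

/-- The bound `p ≤ 2 * cos φ` cancels the cosine, and `sin φ ≥ (2 / π) * φ ≥ (p 1 / π) * x` controls
the sine. -/
theorem nullCoeff_le (w : HalfWall φ p) {x : ℝ} (hx : x ∈ Ioo (0 : ℝ) 1) :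
    nullCoeff φ p x ≤ 2 * Real.pi / p 1 / x := by
  have hp := w.flux_one_pos
  have hx0 := hx.1
  have hs := w.sin_pos hx.1
  have hc := w.cos_pos hx.1.le
  have h1 : p x ≤ 2 * Real.cos (φ x) := by
    have := w.flux_div_notch_le hx.1.le
    rw [notch_of_lt (by rw [abs_of_pos hx.1]; exact hx.2)] at this
    linarith
  have h2 : p 1 / Real.pi * x ≤ Real.sin (φ x) := by
    have h3 := Real.mul_le_sin (w.pos x hx.1).le (w.lt x hx.1).le
    refine le_trans ?_ h3
    have := w.mul_le_angle ⟨hx.1.le, hx.2.le⟩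
    calc p 1 / Real.pi * x = 2 / Real.pi * (p 1 / 2 * x) := by ring
      _ ≤ _ := by gcongr
  have hπ := Real.pi_pos
  calc nullCoeff φ p x ≤ 2 * Real.cos (φ x) / (Real.sin (φ x) * Real.cos (φ x)) := by
        unfold nullCoeff; gcongr
    _ = 2 / Real.sin (φ x) := by field_simp
    _ ≤ 2 / (p 1 / Real.pi * x) := by gcongr
    _ = _ := by field_simp

/-- The coefficient is singular like `1 / x`, but `f 0 = 0` and Cauchy–Schwarz give `f x ^ 2 ≤ x * ∫
f'²` over `(0, x)`. The product is thus bounded by a multiple of this small integral. The other part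
of the null Lagrangian, `-p * tan φ`, is continuous and vanishes at the origin. -/
theorem tendsto_nullLagrangian_zero (w : HalfWall φ p) (c : HalfCompetitor f g h)
    (hD : IntegrableOn (density f g h) (Ioi 0)) :
    Tendsto (nullLagrangian φ p f) (𝓝[>] 0) (𝓝 0) := by
  have hf2 := integrableOn_deriv_sq_of_integrableOn_density hD
  have hI : Tendsto (fun x => ∫ t in 0..x, (Ioi (0 : ℝ)).indicator (fun t => deriv f t ^ 2) t)
      (𝓝[>] 0) (𝓝 0) := by
    have hcont := intervalIntegral.continuous_primitive
      (fun a b => ((integrable_indicator_iff measurableSet_Ioi).2 hf2).intervalIntegrable) 0 |>.tendsto 0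
    simp only [intervalIntegral.integral_same] at hcont
    exact hcont.mono_left nhdsWithin_le_nhds
  have hpt : Tendsto (fun x => p x / Real.cos (φ x) * Real.sin (φ x)) (𝓝[>] 0) (𝓝 0) := by
    have hcont : ContinuousAt (fun x => p x / Real.cos (φ x) * Real.sin (φ x)) 0 :=
      ((w.continuous_flux.continuousAt).div w.continuous_cos.continuousAt
        (w.cos_pos le_rfl).ne').mul w.continuous_sin.continuousAt
    have := hcont.tendsto
    simp only [w.zero, Real.sin_zero, mul_zero] at this
    exact this.mono_left nhdsWithin_le_nhds
  have hkey : Tendsto (fun x => nullCoeff φ p x * f x ^ 2) (𝓝[>] 0) (𝓝 0) := by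
    have hI2 := hI.const_mul (2 * Real.pi / p 1)
    rw [mul_zero] at hI2
    refine tendsto_of_tendsto_of_tendsto_of_le_of_le' tendsto_const_nhds hI2 ?_ ?_
    · filter_upwards [self_mem_nhdsWithin] with x hx
      have := w.sin_pos hx
      have := w.cos_pos (le_of_lt hx)
      have := w.flux_pos (le_of_lt hx)
      unfold nullCoeff; positivity
    · filter_upwards [Ioo_mem_nhdsGT (zero_lt_one (α := ℝ))] with x hx
      have hi2 : IntervalIntegrable (fun t => deriv f t ^ 2) volume 0 x := by
        rw [intervalIntegrable_iff_integrableOn_Ioc_of_le hx.1.le]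
        exact hf2.mono_set fun t ht => ht.1
      have h1 := sq_integral_le_mul_integral_sq hx.1 (c.locAC_f 0 x).intervalIntegrable_deriv hi2
      rw [(c.locAC_f 0 x).integral_deriv_eq_sub, c.f_zero, sub_zero] at h1
      have h2 : ∫ t in 0..x, (Ioi (0 : ℝ)).indicator (fun t => deriv f t ^ 2) t
          = ∫ t in 0..x, deriv f t ^ 2 := by
        refine intervalIntegral.integral_congr_ae (ae_of_all _ fun t ht => ?_)
        rw [uIoc_of_le hx.1.le] at ht
        exact indicator_of_mem (show t ∈ Ioi 0 from ht.1) _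
      rw [h2]
      have hx0 := hx.1
      have hp := w.flux_one_pos
      calc nullCoeff φ p x * f x ^ 2 ≤ 2 * Real.pi / p 1 / x * (x * ∫ t in 0..x, deriv f t ^ 2) := by
            gcongr
            exact w.nullCoeff_le hx
        _ = _ := by field_simp
  have := hkey.sub hpt
  rw [sub_zero] at this
  refine this.congr' ?_
  filter_upwards [self_mem_nhdsWithin] with x hx
  have hs := w.sin_pos hx
  have hc := w.cos_pos (le_of_lt hx)
  unfold nullLagrangian nullCoeff
  field_simp

/-- The excess is nonnegative, so its integral only grows when the interval is enlarged to `[1 / (n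
+ 1), n]`; as `n → ∞` the boundary terms disappear. The compact interval avoids any claim of
integrability of the excess up to the endpoints. -/
theorem integral_excess_mem (w : HalfWall φ p) (c : HalfCompetitor f g h)
    (hD : IntegrableOn (density f g h) (Ioi 0)) {x y : ℝ} (hx : 0 < x) (hxy : x ≤ y) :
    ∫ t in x..y, excess φ p f g h t ≤ (∫ t in Ioi 0, density f g h t)
      - ∫ t in Ioi 0, multiplier φ p t := by
  rw [← integral_sub hD w.integrableOn_multiplier]
  have hint := hD.sub w.integrableOn_multiplier
  set u : ℝ → ℝ := (Ioi (0 : ℝ)).indicator fun t => density f g h t - multiplier φ p t with hu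
  have hui : Integrable u := (integrable_indicator_iff measurableSet_Ioi).2 hint
  have hcp := intervalIntegral.continuous_primitive (fun a b => hui.intervalIntegrable) 0
  have hseq0 : Tendsto (fun n : ℕ => 1 / ((n : ℝ) + 1)) atTop (𝓝[>] 0) :=
    tendsto_nhdsWithin_iff.2 ⟨tendsto_one_div_add_atTop_nhds_zero_nat,
      Eventually.of_forall fun n => by simp only [mem_Ioi]; positivity⟩
  have hseq1 : Tendsto (fun n : ℕ => (n : ℝ)) atTop atTop := tendsto_natCast_atTop_atTop
  have hlim : Tendsto (fun n : ℕ => ((∫ t in 0..(n : ℝ), u t) - ∫ t in 0..(1 / ((n : ℝ) + 1)), u t)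
      - (nullLagrangian φ p f n - nullLagrangian φ p f (1 / ((n : ℝ) + 1)))) atTop
      (𝓝 (((∫ t in Ioi 0, u t) - 0) - (0 - 0))) := by
    refine ((?_ : Tendsto _ _ _).sub ?_).sub
      (((w.tendsto_nullLagrangian_atTop c).comp hseq1).sub
        ((w.tendsto_nullLagrangian_zero c hD).comp hseq0))
    · exact intervalIntegral_tendsto_integral_Ioi 0 hui.integrableOn hseq1
    · have := hcp.tendsto 0
      simp only [intervalIntegral.integral_same] at this
      exact this.comp (hseq0.mono_right nhdsWithin_le_nhds)
  have hlast : ∫ t in Ioi 0, u t = ∫ t in Ioi 0, (density f g h t - multiplier φ p t) := by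
    rw [hu, setIntegral_indicator measurableSet_Ioi, inter_self]
  rw [sub_zero, sub_zero, sub_zero, hlast] at hlim
  refine ge_of_tendsto hlim ?_
  have hev0 : ∀ᶠ n : ℕ in atTop, 1 / ((n : ℝ) + 1) ≤ x :=
    (hseq0.mono_right nhdsWithin_le_nhds).eventually_le_const hx
  filter_upwards [hev0, hseq1.eventually_ge_atTop y] with n hn0 hn1
  have hpos : (0 : ℝ) < 1 / ((n : ℝ) + 1) := by positivity
  have hle : 1 / ((n : ℝ) + 1) ≤ (n : ℝ) := hn0.trans (hxy.trans hn1)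
  obtain ⟨hi, he⟩ := w.intervalIntegral_excess c hD hpos hle
  have hu2 : ∫ t in (1 / ((n : ℝ) + 1))..(n : ℝ), (density f g h t - multiplier φ p t)
      = ∫ t in (1 / ((n : ℝ) + 1))..(n : ℝ), u t := by
    refine intervalIntegral.integral_congr_ae (ae_of_all _ fun t ht => ?_)
    rw [uIoc_of_le hle] at ht
    rw [hu, indicator_of_mem (show t ∈ Ioi 0 from hpos.trans ht.1)]
  rw [hu2, ← intervalIntegral.integral_interval_sub_left hui.intervalIntegrable
    hui.intervalIntegrable] at he
  rw [← he]
  exact intervalIntegral.integral_mono_interval hn0 hxy hn1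
    (ae_of_all _ fun t => excess_nonneg φ p f g h t) hi

end HalfWall

theorem integrableOn_density_of_halfEnergy_ne_top {f g h : ℝ → ℝ} (hg : Continuous g)
    (hh : Continuous h) (hE : halfEnergy f g h ≠ ⊤) : IntegrableOn (density f g h) (Ioi 0) := by
  refine ⟨(measurable_density hg hh).aestronglyMeasurable, ?_⟩
  rw [hasFiniteIntegral_iff_ofReal (ae_of_all _ (density_nonneg f g h))]
  exact hE.lt_top

theorem halfEnergy_eq_ofReal {f g h : ℝ → ℝ} (hD : IntegrableOn (density f g h) (Ioi 0)) :
    halfEnergy f g h = ENNReal.ofReal (∫ x in Ioi 0, density f g h x) := by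
  rw [ofReal_integral_eq_lintegral_ofReal hD (ae_of_all _ (density_nonneg f g h)), halfEnergy]

namespace HalfWall

variable {φ p f g h : ℝ → ℝ}

theorem halfEnergy_le (w : HalfWall φ p) (c : HalfCompetitor f g h) :
    ENNReal.ofReal (∫ x in Ioi 0, multiplier φ p x) ≤ halfEnergy f g h := by
  by_cases hE : halfEnergy f g h = ⊤
  · rw [hE]; exact le_top
  have hD := integrableOn_density_of_halfEnergy_ne_top c.locAC_g.continuous c.locAC_h.continuous hE
  rw [halfEnergy_eq_ofReal hD]
  refine ENNReal.ofReal_le_ofReal ?_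
  have := w.integral_excess_mem c hD one_pos le_rfl
  rw [intervalIntegral.integral_same] at this
  linarith

theorem ae_excess_eq_zero (w : HalfWall φ p) (c : HalfCompetitor f g h)
    (hE : halfEnergy f g h ≤ ENNReal.ofReal (∫ x in Ioi 0, multiplier φ p x)) {x y : ℝ}
    (hx : 0 < x) (hxy : x ≤ y) : ∀ᵐ t, t ∈ uIcc x y → excess φ p f g h t = 0 := by
  have hD := integrableOn_density_of_halfEnergy_ne_top c.locAC_g.continuous c.locAC_h.continuous
    (hE.trans_lt ENNReal.ofReal_lt_top).ne
  rw [halfEnergy_eq_ofReal hD, ENNReal.ofReal_le_ofReal_iff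
    (setIntegral_nonneg measurableSet_Ioi fun t _ => multiplier_nonneg φ p t)] at hE
  have h1 := w.integral_excess_mem c hD hx hxy
  have h2 : 0 ≤ ∫ t in x..y, excess φ p f g h t :=
    intervalIntegral.integral_nonneg hxy fun t _ => excess_nonneg φ p f g h t
  have h3 := (intervalIntegral.integral_eq_zero_iff_of_le_of_nonneg_ae hxy
    (ae_of_all _ fun t => excess_nonneg φ p f g h t) (w.intervalIntegral_excess c hD hx hxy).1).1
    (by linarith)
  rw [EventuallyEq, ae_restrict_iff' measurableSet_Ioc] at h3
  have hne : ∀ᵐ t : ℝ, t ≠ x := by simp [ae_iff]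
  filter_upwards [h3, hne] with t ht htx hmem
  rw [uIcc_of_le hxy] at hmem
  exact ht ⟨lt_of_le_of_ne hmem.1 htx.symm, hmem.2⟩

/-- Vanishing of the first square says that `f` and `sin φ` satisfy the same linear first-order
equation, so their quotient is constant. This works only away from `0`, where `sin φ` vanishes. -/
theorem div_sin_eq (w : HalfWall φ p) (c : HalfCompetitor f g h)
    (hE : halfEnergy f g h ≤ ENNReal.ofReal (∫ x in Ioi 0, multiplier φ p x)) {x y : ℝ}
    (hx : 0 < x) (hxy : x ≤ y) :
    f x * (Real.sin (φ x))⁻¹ = f y * (Real.sin (φ y))⁻¹ := by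
  have hac := (c.locAC_f x y).mul (w.absolutelyContinuous_inv_sin hx hxy)
  have h1 : ∀ᵐ t : ℝ, t ≠ 1 := by simp [ae_iff]
  obtain ⟨C, hC⟩ := hac.const_of_ae_hasDerivAt_zero (by
    filter_upwards [w.ae_excess_eq_zero c hE hx hxy, c.locAC_f.ae_differentiableAt, h1]
      with t ht hf ht1 hmem
    have hmem' := hmem
    rw [uIcc_of_le hxy] at hmem'
    have ht0 : 0 < t := hx.trans_le hmem'.1
    have hn := notch_pos t
    have hs := w.sin_pos ht0
    have h0 := ht hmem
    rw [excess, mul_eq_zero_iff_left hn.ne'] at h0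
    have h2 : deriv f t - Real.cos (φ t) / Real.sin (φ t) * (p t / notch t) * f t = 0 := by
      rw [← sq_eq_zero_iff]
      linarith [sq_nonneg (deriv f t - Real.cos (φ t) / Real.sin (φ t) * (p t / notch t) * f t),
        sq_nonneg (deriv g t + Real.sin (φ t) / Real.cos (φ t) * (p t / notch t) * g t),
        sq_nonneg (deriv h t + Real.sin (φ t) / Real.cos (φ t) * (p t / notch t) * h t)]
    refine (hf.hasDerivAt.mul
      ((w.hasDerivAt_angle t ht0 ht1).sin.inv hs.ne')).congr_deriv ?_
    rw [sub_eq_zero.1 h2]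
    simp only [Pi.inv_apply]
    field_simp
    ring)
  exact (hC x left_mem_uIcc).trans (hC y right_mem_uIcc).symm

/-- Same argument as for `div_sin_eq`, with `u` standing for the second or third component. Since
`cos φ` equals `1` at `0`, the constant quotient is identified by letting the point tend to `0`. -/
theorem div_cos_eq {u : ℝ → ℝ} (w : HalfWall φ p) (hu : LocAC u)
    (hE : ∀ x y : ℝ, 0 < x → x ≤ y → ∀ᵐ t, t ∈ uIcc x y →
      deriv u t + Real.sin (φ t) / Real.cos (φ t) * (p t / notch t) * u t = 0) {x : ℝ}
    (hx : 0 ≤ x) : u x = u 0 * Real.cos (φ x) := by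
  have key : ∀ x y, 0 < x → x ≤ y → u x * (Real.cos (φ x))⁻¹ = u y * (Real.cos (φ y))⁻¹ := by
    intro x y hx hxy
    have hac := (hu x y).mul (w.absolutelyContinuous_inv_cos hx.le hxy)
    have h1 : ∀ᵐ t : ℝ, t ≠ 1 := by simp [ae_iff]
    obtain ⟨C, hC⟩ := hac.const_of_ae_hasDerivAt_zero (by
      filter_upwards [hE x y hx hxy, hu.ae_differentiableAt, h1] with t ht hf ht1 hmem
      have hmem' := hmem
      rw [uIcc_of_le hxy] at hmem'
      have ht0 : 0 < t := hx.trans_le hmem'.1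
      have hn := notch_pos t
      have hs := w.cos_pos ht0.le
      refine (hf.hasDerivAt.mul
        ((w.hasDerivAt_angle t ht0 ht1).cos.inv hs.ne')).congr_deriv ?_
      rw [eq_neg_of_add_eq_zero_left (ht hmem)]
      simp only [Pi.inv_apply]
      field_simp
      ring)
    exact (hC x left_mem_uIcc).trans (hC y right_mem_uIcc).symm
  rcases hx.eq_or_lt with rfl | hx
  · simp [w.zero]
  have hlim : Tendsto (fun t => u t * (Real.cos (φ t))⁻¹) (𝓝[>] 0) (𝓝 (u 0)) := by
    have : ContinuousAt (fun t => u t * (Real.cos (φ t))⁻¹) 0 :=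
      hu.continuous.continuousAt.mul
        (w.continuous_cos.continuousAt.inv₀ (w.cos_pos le_rfl).ne')
    have := this.tendsto
    simp only [w.zero, Real.cos_zero, inv_one, mul_one] at this
    exact this.mono_left nhdsWithin_le_nhds
  have h2 : Tendsto (fun t => u t * (Real.cos (φ t))⁻¹) (𝓝[>] 0)
      (𝓝 (u x * (Real.cos (φ x))⁻¹)) := by
    refine tendsto_const_nhds.congr' ?_
    filter_upwards [Ioo_mem_nhdsGT hx] with t ht
    exact (key t x ht.1 ht.2.le).symm
  have hc := w.cos_pos hx.le
  rw [← tendsto_nhds_unique h2 hlim]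
  field_simp

/-- Equality in the minimality estimate kills all three squares. The constant ratio for `f` is
normalized at infinity, those for `g` and `h` at the origin. -/
theorem eq_of_halfEnergy_le (w : HalfWall φ p) (c : HalfCompetitor f g h)
    (hE : halfEnergy f g h ≤ ENNReal.ofReal (∫ x in Ioi 0, multiplier φ p x)) {x : ℝ}
    (hx : 0 ≤ x) : f x = Real.sin (φ x) ∧ g x = Real.cos (φ x) ∧ h x = 0 := by
  have hsq : ∀ t, excess φ p f g h t = 0 →
      deriv g t + Real.sin (φ t) / Real.cos (φ t) * (p t / notch t) * g t = 0 ∧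
      deriv h t + Real.sin (φ t) / Real.cos (φ t) * (p t / notch t) * h t = 0 := by
    intro t h0
    rw [excess, mul_eq_zero_iff_left (notch_pos t).ne'] at h0
    rw [← sq_eq_zero_iff, ← sq_eq_zero_iff (a := deriv h t + _)]
    constructor <;>
    linarith [sq_nonneg (deriv f t - Real.cos (φ t) / Real.sin (φ t) * (p t / notch t) * f t),
        sq_nonneg (deriv g t + Real.sin (φ t) / Real.cos (φ t) * (p t / notch t) * g t),
        sq_nonneg (deriv h t + Real.sin (φ t) / Real.cos (φ t) * (p t / notch t) * h t)]
  refine ⟨?_, ?_, ?_⟩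
  · rcases hx.eq_or_lt with rfl | hx
    · simp [w.zero, c.f_zero]
    have hlim : Tendsto (fun t => f t * (Real.sin (φ t))⁻¹) atTop (𝓝 (1 * 1⁻¹)) :=
      c.tendsto.mul (w.tendsto_sin.inv₀ one_ne_zero)
    have h2 : Tendsto (fun t => f t * (Real.sin (φ t))⁻¹) atTop
        (𝓝 (f x * (Real.sin (φ x))⁻¹)) := by
      refine tendsto_const_nhds.congr' ?_
      filter_upwards [eventually_ge_atTop x] with t ht
      exact w.div_sin_eq c hE hx ht
    have h3 := tendsto_nhds_unique h2 hlim
    have hs := w.sin_pos hx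
    field_simp at h3
    exact h3
  · rw [w.div_cos_eq c.locAC_g (fun x y hx hxy => ?_) hx, c.g_zero, one_mul]
    filter_upwards [w.ae_excess_eq_zero c hE hx hxy] with t ht hmem
    exact (hsq t (ht hmem)).1
  · rw [w.div_cos_eq c.locAC_h (fun x y hx hxy => ?_) hx, c.h_zero, zero_mul]
    filter_upwards [w.ae_excess_eq_zero c hE hx hxy] with t ht hmem
    exact (hsq t (ht hmem)).2

end HalfWall

/-! ### Existence of the half-line profile by shooting -/

section OuterWall

theorem cos_arctan_sinh (t : ℝ) : Real.cos (Real.arctan (Real.sinh t)) = 1 / Real.cosh t := by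
  rw [Real.cos_arctan, ← Real.cosh_sq', Real.sqrt_sq (Real.cosh_pos t).le]

theorem hasDerivAt_arctan_sinh (t : ℝ) :
    HasDerivAt (fun t => Real.arctan (Real.sinh t)) (Real.cos (Real.arctan (Real.sinh t))) t := by
  refine (Real.hasDerivAt_sinh t).arctan.congr_deriv ?_
  rw [cos_arctan_sinh, ← Real.cosh_sq']
  have := Real.cosh_pos t
  field_simp

theorem tendsto_arctan_sinh_atTop :
    Tendsto (fun t => Real.arctan (Real.sinh t)) atTop (𝓝 (Real.pi / 2)) := by
  have h : Tendsto Real.sinh atTop atTop := Real.sinhOrderIso.tendsto_atTop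
  exact (Real.tendsto_arctan_atTop.mono_right nhdsWithin_le_nhds).comp h

theorem tendsto_arctan_sinh_atBot :
    Tendsto (fun t => Real.arctan (Real.sinh t)) atBot (𝓝 (-(Real.pi / 2))) := by
  have h : Tendsto Real.sinh atBot atBot := Real.sinhOrderIso.tendsto_atBot
  exact (Real.tendsto_arctan_atBot.mono_right nhdsWithin_le_nhds).comp h

end OuterWall

/-- The speed `√(cos² u - ¾ cos² s)` of the profile inside the notch, truncated from below. -/
noncomputable def innerSpeed (s u : ℝ) : ℝ :=
  √(max (Real.cos 1 ^ 2 / 4) (Real.cos u ^ 2 - 3 / 4 * Real.cos s ^ 2))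

theorem cos_one_sq_pos : 0 < Real.cos 1 ^ 2 / 4 := by
  have := Real.cos_one_pos; positivity

theorem innerSpeed_pos (s u : ℝ) : 0 < innerSpeed s u :=
  Real.sqrt_pos.2 (lt_max_of_lt_left cos_one_sq_pos)

theorem innerSpeed_le_one (s u : ℝ) : innerSpeed s u ≤ 1 := by
  rw [innerSpeed, Real.sqrt_le_one]
  refine max_le ?_ ?_
  · nlinarith [Real.cos_sq_le_one 1]
  · nlinarith [Real.cos_sq_le_one u, sq_nonneg (Real.cos s)]

theorem continuous_innerSpeed : Continuous (Function.uncurry innerSpeed) := by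
  unfold innerSpeed Function.uncurry
  fun_prop

/-- The time that the profile inside the notch needs to reach the angle `θ`. -/
noncomputable def innerTime (s θ : ℝ) : ℝ := ∫ u in 0..θ, (innerSpeed s u)⁻¹

theorem continuous_innerSpeed_inv (s : ℝ) : Continuous fun u => (innerSpeed s u)⁻¹ :=
  (continuous_innerSpeed.comp (Continuous.prodMk_right s)).inv₀ fun u => (innerSpeed_pos s u).ne'

theorem hasDerivAt_innerTime (s θ : ℝ) : HasDerivAt (innerTime s) (innerSpeed s θ)⁻¹ θ :=
  (continuous_innerSpeed_inv s).integral_hasStrictDerivAt 0 θ |>.hasDerivAt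

theorem one_le_innerSpeed_inv (s u : ℝ) : 1 ≤ (innerSpeed s u)⁻¹ :=
  (one_le_inv₀ (innerSpeed_pos s u)).2 (innerSpeed_le_one s u)

theorem innerTime_zero (s : ℝ) : innerTime s 0 = 0 := intervalIntegral.integral_same

theorem strictMono_innerTime (s : ℝ) : StrictMono (innerTime s) :=
  strictMono_of_hasDerivAt_pos (hasDerivAt_innerTime s) fun θ => inv_pos.2 (innerSpeed_pos s θ)

theorem continuous_innerTime (s : ℝ) : Continuous (innerTime s) :=
  continuous_iff_continuousAt.2 fun θ => (hasDerivAt_innerTime s θ).continuousAt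

/-- As the speed is at most one, time grows at least as fast as the angle. This gives surjectivity
of the time map and the upper endpoint of the shooting argument. -/
theorem monotone_innerTime_sub (s : ℝ) : Monotone fun θ => innerTime s θ - θ :=
  monotone_of_hasDerivAt_nonneg (fun θ => (hasDerivAt_innerTime s θ).sub (hasDerivAt_id θ))
    fun θ => sub_nonneg.2 (one_le_innerSpeed_inv s θ)

theorem surjective_innerTime (s : ℝ) : Function.Surjective (innerTime s) := by
  refine (continuous_innerTime s).surjective ?_ ?_
  · refine tendsto_atTop_mono' _ ?_ tendsto_id
    filter_upwards [eventually_ge_atTop 0] with θ hθ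
    have := monotone_innerTime_sub s hθ
    simp only [innerTime_zero] at this
    simp only [id]; linarith
  · refine tendsto_atBot_mono' _ ?_ tendsto_id
    filter_upwards [eventually_le_atBot 0] with θ hθ
    have := monotone_innerTime_sub s hθ
    simp only [innerTime_zero] at this
    simp only [id]; linarith

/-- The profile inside the notch, as the inverse of the time map. -/
noncomputable def innerAngle (s : ℝ) : ℝ ≃o ℝ :=
  ((strictMono_innerTime s).orderIsoOfSurjective _ (surjective_innerTime s)).symm

theorem innerTime_innerAngle (s x : ℝ) : innerTime s (innerAngle s x) = x :=
  ((strictMono_innerTime s).orderIsoOfSurjective _ (surjective_innerTime s)).apply_symm_apply x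

theorem innerAngle_innerTime (s θ : ℝ) : innerAngle s (innerTime s θ) = θ :=
  ((strictMono_innerTime s).orderIsoOfSurjective _ (surjective_innerTime s)).symm_apply_apply θ

theorem hasDerivAt_innerAngle (s x : ℝ) :
    HasDerivAt (innerAngle s) (innerSpeed s (innerAngle s x)) x := by
  have := HasDerivAt.of_local_left_inverse (innerAngle s).continuous.continuousAt
    (hasDerivAt_innerTime s (innerAngle s x)) (inv_pos.2 (innerSpeed_pos _ _)).ne'
    (Eventually.of_forall (innerTime_innerAngle s))
  rwa [inv_inv] at this

/-- Shooting: the angle `s` at the edge of the notch must be reached exactly at `x = 1`. The time to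
reach `s` depends continuously on `s`, is `0` for `s = 0` and at least `1` for `s = 1`. -/
theorem exists_innerTime_eq_one : ∃ s ∈ Ioc (0 : ℝ) 1, innerTime s s = 1 := by
  have hc : Continuous fun s => innerTime s s :=
    intervalIntegral.continuous_parametric_intervalIntegral_of_continuous
      (f := fun s u => (innerSpeed s u)⁻¹)
      (continuous_innerSpeed.inv₀ fun x => (innerSpeed_pos x.1 x.2).ne') continuous_id
  have h1 : 1 ≤ innerTime 1 1 := by
    have := monotone_innerTime_sub 1 zero_le_one
    simp only [innerTime_zero] at this
    linarith
  obtain ⟨s, hs, hs1⟩ := intermediate_value_Icc zero_le_one hc.continuousOn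
    (show (1 : ℝ) ∈ Icc (innerTime 0 0) (innerTime 1 1) from ⟨by rw [innerTime_zero]; exact zero_le_one, h1⟩)
  refine ⟨s, ⟨lt_of_le_of_ne hs.1 fun h => ?_, hs.2⟩, hs1⟩
  rw [← h] at hs1
  simp [innerTime_zero] at hs1

/-- The truncation, which keeps the speed positive for all arguments, is inactive here: `cos u ^ 2 -
3 / 4 * cos s ^ 2 ≥ cos s ^ 2 / 4 ≥ cos 1 ^ 2 / 4`. -/
theorem innerSpeed_eq {s u : ℝ} (hs : s ∈ Ioc (0 : ℝ) 1) (hu : u ∈ Icc 0 s) :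
    innerSpeed s u = √(Real.cos u ^ 2 - 3 / 4 * Real.cos s ^ 2) := by
  have hπ := Real.pi_gt_three
  have h1 : Real.cos s ≤ Real.cos u :=
    Real.cos_le_cos_of_nonneg_of_le_pi hu.1 (by linarith [hs.2]) hu.2
  have h2 : Real.cos 1 ≤ Real.cos s :=
    Real.cos_le_cos_of_nonneg_of_le_pi hs.1.le (by linarith) hs.2
  have h3 := Real.cos_one_pos
  rw [innerSpeed, max_eq_right]
  nlinarith

theorem exists_innerAngle {s : ℝ} (hs1 : innerTime s s = 1) :
    ∃ Y : ℝ ≃o ℝ, (∀ x, HasDerivAt Y (innerSpeed s (Y x)) x) ∧ Y 0 = 0 ∧ Y 1 = s := by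
  refine ⟨innerAngle s, hasDerivAt_innerAngle s, ?_, ?_⟩
  · have := innerAngle_innerTime s 0
    rwa [innerTime_zero] at this
  · have := innerAngle_innerTime s s
    rwa [hs1] at this

theorem exists_outerAngle {s : ℝ} (hs : s ∈ Ioo (-(Real.pi / 2)) (Real.pi / 2)) :
    ∃ Z : ℝ → ℝ, (∀ x, HasDerivAt Z (Real.cos (Z x)) x) ∧ Z 1 = s ∧ StrictMono Z ∧
      (∀ x, Z x < Real.pi / 2) ∧ Tendsto Z atTop (𝓝 (Real.pi / 2)) := by
  -- The shift for which `arctan (sinh b) = s`, so that the outer wall passes through `s` at `x =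
  -- 1`.
  set b := Real.arsinh (Real.tan s) with hb
  have hd : ∀ x, HasDerivAt (fun x => Real.arctan (Real.sinh (x - 1 + b)))
      (Real.cos (Real.arctan (Real.sinh (x - 1 + b)))) x := fun x => by
    have := (hasDerivAt_arctan_sinh (x - 1 + b)).comp x
      (((hasDerivAt_id x).sub_const 1).add_const b)
    exact this.congr_deriv (mul_one _)
  refine ⟨fun x => Real.arctan (Real.sinh (x - 1 + b)), hd, ?_,
    strictMono_of_hasDerivAt_pos hd fun x => Real.cos_arctan_pos _,
    fun x => Real.arctan_lt_pi_div_two _, tendsto_arctan_sinh_atTop.comp ?_⟩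
  · simp only [sub_self, zero_add, hb, Real.sinh_arsinh]
    exact Real.arctan_tan hs.1 hs.2
  · exact tendsto_atTop_add_const_right _ _ (tendsto_atTop_add_const_right _ (-1) tendsto_id)

theorem exists_continuous_glue {f g : ℝ → ℝ} (hf : Continuous f) (hg : Continuous g)
    (h : f 1 = g 1) :
    ∃ u : ℝ → ℝ, Continuous u ∧ (∀ x, x ≤ 1 → u x = f x) ∧ ∀ x, 1 ≤ x → u x = g x := by
  refine ⟨fun x => if x ≤ 1 then f x else g x, Continuous.if_le hf hg continuous_id
    continuous_const fun x hx => by rw [show x = 1 from hx, h], fun x hx => if_pos hx,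
    fun x hx => ?_⟩
  rcases hx.eq_or_lt with rfl | hx
  · simp only [le_refl, if_true, h]
  · simp only [hx.not_ge, if_false]

theorem exists_halfWall : ∃ φ p, HalfWall φ p := by
  obtain ⟨s, hs, hs1⟩ := exists_innerTime_eq_one
  have hπ := Real.pi_gt_three
  have hsπ : s < Real.pi / 2 := by linarith [hs.2]
  have hcs : 0 < Real.cos s := Real.cos_pos_of_mem_Ioo ⟨by linarith [hs.1], hsπ⟩
  obtain ⟨Y, hYd, hY0, hY1⟩ := exists_innerAngle hs1
  obtain ⟨Z, hZd, hZ1, hZmono, hZlt, hZtend⟩ := exists_outerAngle ⟨by linarith [hs.1], hsπ⟩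
  have hZc : Continuous Z := continuous_iff_continuousAt.2 fun x => (hZd x).continuousAt
  -- Continuity of the flux across the edge. The coefficient `3 / 4` in the speed is dictated by
  -- this identity: the inner flux at the angle `s` is `2 * √(cos s ^ 2 / 4)`.
  have hsp1 : 2 * innerSpeed s s = Real.cos s := by
    rw [innerSpeed_eq hs ⟨hs.1.le, le_rfl⟩,
      show Real.cos s ^ 2 - 3 / 4 * Real.cos s ^ 2 = (Real.cos s / 2) ^ 2 by ring,
      Real.sqrt_sq (by positivity)]
    ring
  have hspc : Continuous fun x => 2 * innerSpeed s (Y x) :=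
    continuous_const.mul ((continuous_innerSpeed.comp (Continuous.prodMk_right s)).comp Y.continuous)
  have hYmem : ∀ x ∈ Icc (0 : ℝ) 1, Y x ∈ Icc 0 s := fun x hx =>
    ⟨hY0 ▸ Y.monotone hx.1, hY1 ▸ Y.monotone hx.2⟩
  have hin : ∀ x : ℝ, 0 < x → x < 1 → notch x = 2 := fun x h0 h1 =>
    notch_of_lt (by rwa [abs_of_pos h0])
  have hout : ∀ x : ℝ, 1 < x → notch x = 1 := fun x h1 =>
    notch_of_ge (by rw [abs_of_pos (zero_lt_one.trans h1)]; exact h1.le)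
  obtain ⟨φ, hφc, hφY, hφZ⟩ := exists_continuous_glue Y.continuous hZc (hY1.trans hZ1.symm)
  obtain ⟨p, hpc, hpY, hpZ⟩ := exists_continuous_glue hspc (Real.continuous_cos.comp hZc)
    (by rw [hY1, hsp1, Function.comp_apply, hZ1])
  refine ⟨φ, p, ⟨hφc, hpc, ?_, ?_⟩, by rw [hφY 0 zero_le_one, hY0], ?_, ?_, ?_, ?_⟩
  · intro x hx hx1
    rcases lt_or_gt_of_ne hx1 with h1 | h1
    · rw [hpY x h1.le, hin x hx h1, mul_div_cancel_left₀ _ two_ne_zero]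
      refine (hYd x).congr_of_eventuallyEq ?_
      filter_upwards [eventually_lt_nhds h1] with t ht
      exact hφY t ht.le
    · rw [hpZ x h1.le, hout x h1, div_one]
      refine (hZd x).congr_of_eventuallyEq ?_
      filter_upwards [eventually_gt_nhds h1] with t ht
      exact hφZ t ht.le
  · intro x hx hx1
    rcases lt_or_gt_of_ne hx1 with h1 | h1
    · rw [hφY x h1.le, hin x hx h1]
      have hmem := hYmem x ⟨hx.le, h1.le⟩
      have hpos : 0 < Real.cos (Y x) ^ 2 - 3 / 4 * Real.cos s ^ 2 := by
        have h2 : Real.cos s ≤ Real.cos (Y x) :=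
          Real.cos_le_cos_of_nonneg_of_le_pi hmem.1 (by linarith) hmem.2
        nlinarith
      have hd2 := (((hYd x).cos.pow 2).sub_const (3 / 4 * Real.cos s ^ 2)).sqrt hpos.ne'
      have hsq := Real.sqrt_pos.2 hpos
      refine ((hd2.const_mul 2).congr_of_eventuallyEq ?_).congr_deriv ?_
      · filter_upwards [Ioo_mem_nhds hx h1] with t ht
        rw [hpY t ht.2.le, innerSpeed_eq hs (hYmem t ⟨ht.1.le, ht.2.le⟩)]
        simp only [Pi.pow_apply]
      · rw [innerSpeed_eq hs hmem]
        simp only [Pi.pow_apply]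
        generalize √(Real.cos (Y x) ^ 2 - 3 / 4 * Real.cos s ^ 2) = r at hsq ⊢
        norm_num
        field_simp
    · rw [hφZ x h1.le, hout x h1]
      refine ((hZd x).cos.congr_of_eventuallyEq ?_).congr_deriv (by ring)
      filter_upwards [eventually_gt_nhds h1] with t ht
      exact hpZ t ht.le
  · intro x hx
    rcases le_total x 1 with h1 | h1
    · rw [hφY x h1, ← hY0]; exact Y.strictMono hx
    · rw [hφZ x h1]
      have := hZmono.monotone h1
      rw [hZ1] at this; linarith [hs.1]
  · intro x hx
    rcases le_total x 1 with h1 | h1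
    · rw [hφY x h1]
      exact (hYmem x ⟨hx.le, h1⟩).2.trans_lt hsπ
    · rw [hφZ x h1]
      exact hZlt x
  · intro x hx
    rw [hpZ x hx, hφZ x hx, Function.comp_apply]
  · refine hZtend.congr' ?_
    filter_upwards [eventually_ge_atTop 1] with x hx
    exact (hφZ x hx).symm

/-! ### From the half-line to the line -/

/-- The odd extension of a function on the half-line. -/
noncomputable def oddExtension (φ : ℝ → ℝ) (x : ℝ) : ℝ := if 0 ≤ x then φ x else -φ (-x)

theorem oddExtension_of_nonneg (φ : ℝ → ℝ) {x : ℝ} (hx : 0 ≤ x) : oddExtension φ x = φ x :=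
  if_pos hx

theorem oddExtension_neg {φ : ℝ → ℝ} (h0 : φ 0 = 0) (x : ℝ) :
    oddExtension φ (-x) = -oddExtension φ x := by
  unfold oddExtension
  rcases lt_trichotomy x 0 with hx | rfl | hx
  · rw [if_pos (by linarith), if_neg (by linarith), neg_neg]
  · simp [h0]
  · rw [if_neg (by linarith), if_pos hx.le, neg_neg]

theorem HalfWall.oddExtension {φ p : ℝ → ℝ} (w : HalfWall φ p) :
    HalfWall (oddExtension φ) p where
  continuous_angle := by
    refine Continuous.if_le w.continuous_angle (w.continuous_angle.comp continuous_neg).neg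
      continuous_const continuous_id fun x hx => ?_
    rw [← show (0 : ℝ) = x from hx]; simp [w.zero]
  continuous_flux := w.continuous_flux
  zero := by rw [oddExtension_of_nonneg φ le_rfl, w.zero]
  pos x hx := by rw [oddExtension_of_nonneg φ hx.le]; exact w.pos x hx
  lt x hx := by rw [oddExtension_of_nonneg φ hx.le]; exact w.lt x hx
  hasDerivAt_angle x hx hx1 := by
    refine (w.hasDerivAt_angle x hx hx1).congr_of_eventuallyEq ?_
    filter_upwards [eventually_gt_nhds hx] with t ht
    rw [oddExtension_of_nonneg φ ht.le]
  hasDerivAt_flux x hx hx1 := by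
    rw [oddExtension_of_nonneg φ hx.le]; exact w.hasDerivAt_flux x hx hx1
  flux_eq x hx := by
    rw [oddExtension_of_nonneg φ (zero_le_one.trans hx)]; exact w.flux_eq x hx
  tendsto := by
    refine w.tendsto.congr' ?_
    filter_upwards [eventually_ge_atTop 0] with x hx
    rw [oddExtension_of_nonneg φ hx]

theorem integrable_comp_abs {f : ℝ → ℝ} (hf : IntegrableOn f (Ioi 0)) :
    Integrable fun x => f |x| := by
  have h1 : IntegrableOn (fun x => f |x|) (Ioi 0) :=
    hf.congr_fun (fun x hx => by rw [abs_of_pos hx]) measurableSet_Ioi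
  have h2 : IntegrableOn (fun x => f |x|) (Iic 0) := by
    rw [← Measure.map_neg_eq_self (volume : Measure ℝ)]
    let m : MeasurableEmbedding fun x : ℝ => -x := (Homeomorph.neg ℝ).measurableEmbedding
    rw [m.integrableOn_map_iff]
    simp_rw [Function.comp_def, abs_neg, neg_preimage, neg_Iic, neg_zero]
    exact Iff.mpr integrableOn_Ici_iff_integrableOn_Ioi h1
  rw [← integrableOn_univ, ← Iic_union_Ioi (a := (0 : ℝ))]
  exact h2.union h1

theorem integral_mul_deriv_eq_neg {A A' ψ : ℝ → ℝ} {s : Set ℝ} (hs : s.Countable)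
    (hA : Continuous A) (hd : ∀ x, x ∉ s → HasDerivAt A (A' x) x)
    (hi : ∀ x y, IntervalIntegrable A' volume x y) (hψ : ContDiff ℝ ∞ ψ)
    (hcs : HasCompactSupport ψ) : ∫ x, A x * deriv ψ x = -∫ x, A' x * ψ x := by
  have hψ' : Continuous (deriv ψ) := hψ.continuous_deriv (by simp)
  -- The endpoints `-(R + 1)` and `R + 1` lie outside the support of `ψ`, so integration by parts
  -- leaves no boundary terms.
  obtain ⟨R, hR⟩ := hcs.isCompact.isBounded.subset_closedBall 0
  have hbd : ∀ x, x ∉ Ioo (-(R + 1)) (R + 1) → x ∉ tsupport ψ := by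
    intro x hx hmem
    have := hR hmem
    rw [Real.closedBall_eq_Icc] at this
    exact hx ⟨by linarith [this.1], by linarith [this.2]⟩
  have hzero : ∀ x, x ∉ Ioc (-(R + 1)) (R + 1) → x ∉ tsupport ψ := fun x hx =>
    hbd x fun h => hx ⟨h.1, h.2.le⟩
  have e2 : ∫ x, A x * deriv ψ x = ∫ x in (-(R + 1))..(R + 1), A x * deriv ψ x := by
    rw [intervalIntegral.integral_eq_integral_of_support_subset]
    intro x hx
    by_contra hne
    have : deriv ψ x = 0 := image_eq_zero_of_notMem_tsupport
      fun h => hzero x hne (tsupport_deriv_subset h)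
    exact hx (by simp [this])
  have e3 : ∫ x, A' x * ψ x = ∫ x in (-(R + 1))..(R + 1), A' x * ψ x := by
    rw [intervalIntegral.integral_eq_integral_of_support_subset]
    intro x hx
    by_contra hne
    exact hx (by simp [image_eq_zero_of_notMem_tsupport (hzero x hne)])
  have i1 : IntervalIntegrable (fun x => A x * deriv ψ x) volume (-(R + 1)) (R + 1) :=
    (hA.mul hψ').intervalIntegrable _ _
  have i2 : IntervalIntegrable (fun x => A' x * ψ x) volume (-(R + 1)) (R + 1) :=
    (hi _ _).mul_continuousOn hψ.continuous.continuousOn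
  rw [e2, e3, eq_neg_iff_add_eq_zero, ← intervalIntegral.integral_add i1 i2,
    integral_eq_of_hasDerivAt_off_countable (fun x => A x * ψ x) _ hs
    (hA.mul hψ.continuous).continuousOn (fun x hx => ?_) (i1.add i2),
    image_eq_zero_of_notMem_tsupport (hbd _ (fun h => h.2.false)),
    image_eq_zero_of_notMem_tsupport (hbd _ (fun h => h.1.false))]
  · ring
  · refine ((hd x hx.2).mul (hψ.differentiable (by simp) x).hasDerivAt).congr_deriv ?_
    ring

theorem LocAC.mul {f g : ℝ → ℝ} (hf : LocAC f) (hg : LocAC g) : LocAC (fun x => f x * g x) :=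
  fun x y => (hf x y).fun_mul (hg x y)

theorem locAC_const {E : Type*} [NormedAddCommGroup E] [NormedSpace ℝ E] (c : E) :
    LocAC (fun _ : ℝ => c) :=
  (LipschitzWith.const c).locAC

theorem LocAC.sin {φ : ℝ → ℝ} (hφ : LocAC φ) : LocAC (fun x => Real.sin (φ x)) :=
  hφ.lipschitz_comp Real.lipschitzWith_sin

theorem LocAC.cos {φ : ℝ → ℝ} (hφ : LocAC φ) : LocAC (fun x => Real.cos (φ x)) :=
  hφ.lipschitz_comp Real.lipschitzWith_cos

theorem locAC_vec {f g h : ℝ → ℝ} (hf : LocAC f) (hg : LocAC g) (hh : LocAC h) :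
    LocAC (fun x => (!₂[f x, g x, h x] : E3)) := by
  intro x y
  have h1 := ((hf x y).fun_smul (locAC_const (!₂[1, 0, 0] : E3) x y)).fun_add
    (((hg x y).fun_smul (locAC_const (!₂[0, 1, 0] : E3) x y)).fun_add
    ((hh x y).fun_smul (locAC_const (!₂[0, 0, 1] : E3) x y)))
  refine absolutelyContinuousOnInterval_congr h1 fun t _ => ?_
  ext i
  fin_cases i <;> simp

theorem LocAC.planar {φ : ℝ → ℝ} (hφ : LocAC φ) : LocAC (planar φ) :=
  locAC_vec hφ.sin hφ.cos (locAC_const 0)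

theorem norm_planar (φ : ℝ → ℝ) (x : ℝ) : ‖planar φ x‖ = 1 := by
  have : ‖planar φ x‖ ^ 2 = 1 := by
    rw [norm_sq_eq]; simp [planar]
  nlinarith [norm_nonneg (planar φ x)]

theorem planar_mem_walls {φ : ℝ → ℝ} (h1 : Tendsto φ atTop (𝓝 (Real.pi / 2)))
    (h2 : Tendsto φ atBot (𝓝 (-(Real.pi / 2)))) : planar φ ∈ walls := by
  have hc : Continuous fun θ : ℝ => (!₂[Real.sin θ, Real.cos θ, 0] : E3) :=
    ((LipschitzWith.id (α := ℝ)).locAC.planar (φ := fun θ => θ)).continuous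
  refine ⟨norm_planar φ, ?_, ?_⟩
  · have : e1 = !₂[Real.sin (Real.pi / 2), Real.cos (Real.pi / 2), 0] := by
      ext i; fin_cases i <;> simp [e1]
    rw [this]
    exact (hc.tendsto _).comp h1
  · have : -e1 = !₂[Real.sin (-(Real.pi / 2)), Real.cos (-(Real.pi / 2)), 0] := by
      ext i; fin_cases i <;> simp [e1]
    rw [this]
    exact (hc.tendsto _).comp h2

namespace HalfWall

variable {φ p : ℝ → ℝ}

theorem hasDerivAt_angle_of_odd (w : HalfWall φ p) (ho : ∀ x, φ (-x) = -φ x) {x : ℝ}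
    (hx : x ∉ ({0, 1, -1} : Set ℝ)) : HasDerivAt φ (p |x| / notch x) x := by
  simp only [mem_insert_iff, mem_singleton_iff, not_or] at hx
  rcases lt_or_gt_of_ne hx.1 with h | h
  · have h1 := w.hasDerivAt_angle (-x) (by linarith) (fun h => hx.2.2 (by linarith))
    have h2 := (h1.comp x (hasDerivAt_neg x)).neg
    rw [abs_of_neg h]
    have h3 : φ = -(φ ∘ Neg.neg) := by ext t; simp [ho]
    rw [h3]
    refine h2.congr_deriv ?_
    rw [notch_neg]; ring
  · rw [abs_of_pos h]
    exact w.hasDerivAt_angle x h hx.2.1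

theorem hasDerivAt_flux_of_odd (w : HalfWall φ p) (ho : ∀ x, φ (-x) = -φ x) {x : ℝ}
    (hx : x ∉ ({0, 1, -1} : Set ℝ)) :
    HasDerivAt (fun t => p |t|) (-(notch x * (Real.sin (φ x) * Real.cos (φ x)))) x := by
  simp only [mem_insert_iff, mem_singleton_iff, not_or] at hx
  rcases lt_or_gt_of_ne hx.1 with h | h
  · have h1 := w.hasDerivAt_flux (-x) (by linarith) (fun h => hx.2.2 (by linarith))
    refine ((h1.comp x (hasDerivAt_neg x)).congr_of_eventuallyEq ?_).congr_deriv ?_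
    · filter_upwards [eventually_lt_nhds h] with t ht
      rw [abs_of_neg ht]; rfl
    · rw [notch_neg, ho, Real.sin_neg, Real.cos_neg]; ring
  · refine (w.hasDerivAt_flux x h hx.2.1).congr_of_eventuallyEq ?_
    filter_upwards [eventually_gt_nhds h] with t ht
    rw [abs_of_pos ht]

theorem countable_jumps : ({0, 1, -1} : Set ℝ).Countable := by simp

theorem ae_notMem_jumps : ∀ᵐ x : ℝ, x ∉ ({0, 1, -1} : Set ℝ) :=
  countable_jumps.ae_notMem volume

theorem continuous_flux_abs (w : HalfWall φ p) : Continuous fun x => p |x| :=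
  w.continuous_flux.comp continuous_abs

theorem locAC_of_odd (w : HalfWall φ p) (ho : ∀ x, φ (-x) = -φ x) : LocAC φ := by
  have key : ∀ x y, x ≤ y → AbsolutelyContinuousOnInterval φ x y := fun x y hxy =>
    absolutelyContinuousOnInterval_of_hasDerivAt_off_countable hxy countable_jumps
      w.continuous_angle.continuousOn (fun t ht => w.hasDerivAt_angle_of_odd ho ht.2)
      (intervalIntegrable_div_notch (w.continuous_flux_abs.intervalIntegrable _ _))
  intro x y
  rcases le_total x y with h | h
  · exact key x y h
  · exact (key y x h).symm

theorem multiplier_abs (ho : ∀ x, φ (-x) = -φ x) (x : ℝ) :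
    multiplier φ p |x| = p |x| ^ 2 / notch x + notch x * Real.cos (φ x) ^ 2 := by
  rcases abs_choice x with h | h
  · rw [multiplier]; simp only [h]
  · rw [multiplier]; simp only [h, notch_neg, ho, Real.cos_neg]

theorem integrable_multiplier_abs (w : HalfWall φ p) :
    Integrable (fun x => multiplier φ p |x|) :=
  integrable_comp_abs w.integrableOn_multiplier

theorem memLp_deriv_of_odd (w : HalfWall φ p) (ho : ∀ x, φ (-x) = -φ x) :
    MemLp (deriv φ) 2 volume := by
  rw [memLp_two_iff_integrable_sq (measurable_deriv φ).aestronglyMeasurable]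
  refine w.integrable_multiplier_abs.mono'
    ((measurable_deriv φ).pow_const 2).aestronglyMeasurable ?_
  filter_upwards [ae_notMem_jumps] with x hx
  have hn := one_le_notch x
  rw [(w.hasDerivAt_angle_of_odd ho hx).deriv, multiplier_abs ho, Real.norm_eq_abs,
    abs_of_nonneg (sq_nonneg _), div_pow]
  have : p |x| ^ 2 / notch x ^ 2 ≤ p |x| ^ 2 / notch x := by
    gcongr; nlinarith
  have : 0 ≤ notch x * Real.cos (φ x) ^ 2 := by positivity
  linarith

theorem memLp_cos_of_odd (w : HalfWall φ p) (ho : ∀ x, φ (-x) = -φ x) :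
    MemLp (fun x => Real.cos (φ x)) 2 volume := by
  rw [memLp_two_iff_integrable_sq w.continuous_cos.aestronglyMeasurable]
  refine w.integrable_multiplier_abs.mono' (w.continuous_cos.pow 2).aestronglyMeasurable
    (ae_of_all _ fun x => ?_)
  have hn := one_le_notch x
  rw [multiplier_abs ho, Real.norm_eq_abs, abs_of_nonneg (sq_nonneg _)]
  have : 0 ≤ p |x| ^ 2 / notch x := by positivity
  nlinarith [sq_nonneg (Real.cos (φ x))]

/-- An odd angle has the even flux `p |x|`, which is continuous at the origin and at the jumps. The
weak equation thus holds across the origin too, and `U` is arbitrary. -/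
theorem pendulumOn_of_odd (w : HalfWall φ p) (ho : ∀ x, φ (-x) = -φ x) (U : Set ℝ) :
    PendulumOn notch U φ := by
  intro ψ hψ hcs _
  have e1 : ∫ x, notch x * deriv φ x * deriv ψ x = ∫ x, p |x| * deriv ψ x := by
    refine integral_congr_ae ?_
    filter_upwards [ae_notMem_jumps] with x hx
    rw [(w.hasDerivAt_angle_of_odd ho hx).deriv, mul_div_cancel₀ _ (notch_pos x).ne']
  rw [e1, integral_mul_deriv_eq_neg countable_jumps w.continuous_flux_abs
    (fun x hx => w.hasDerivAt_flux_of_odd ho hx) (fun x y => ?_) hψ hcs, ← integral_neg]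
  · congr 1; ext x; ring
  · exact (intervalIntegrable_notch_mul
      ((w.continuous_sin.mul w.continuous_cos).intervalIntegrable x y)).neg

theorem isPendulumSolution (w : HalfWall φ p) (ho : ∀ x, φ (-x) = -φ x) :
    IsPendulumSolution notch φ where
  memHdot1 := ⟨w.locAC_of_odd ho, w.memLp_deriv_of_odd ho⟩
  pendulum := w.pendulumOn_of_odd ho _
  zero := w.zero
  tendsto_atTop := w.tendsto
  tendsto_atBot := by
    have := (w.tendsto.comp tendsto_neg_atBot_atTop).neg
    refine this.congr fun x => ?_
    simp [ho]
  bounds x hx := by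
    have h1 := w.pos x hx
    have h2 := w.lt x hx
    rw [ho]
    exact ⟨by linarith, by linarith, h1.le, h2.le⟩

theorem planar_mem_centeredWalls (w : HalfWall φ p) (ho : ∀ x, φ (-x) = -φ x) :
    planar φ ∈ centeredWalls := by
  have h := w.isPendulumSolution ho
  refine ⟨planar_mem_walls h.tendsto_atTop h.tendsto_atBot, ?_⟩
  ext i; fin_cases i <;> simp [planar, e2, w.zero]

theorem F_planar (w : HalfWall φ p) (ho : ∀ x, φ (-x) = -φ x) :
    F notch (planar φ) = ENNReal.ofReal (∫ x in Ioi 0, multiplier φ p x)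
      + ENNReal.ofReal (∫ x in Ioi 0, multiplier φ p x) := by
  rw [F_eq_halfEnergy_add (w.locAC_of_odd ho).planar, ← w.halfEnergy_eq]
  simp [planar, ho]

end HalfWall

/-! ### The unique centered minimizer -/

theorem halfCompetitor_of_mem_centeredWalls {m : ℝ → E3} (hm : m ∈ centeredWalls)
    (hac : LocAC m) :
    HalfCompetitor (fun x => m x 0) (fun x => m x 1) (fun x => m x 2) where
  locAC_f := hac.component 0
  locAC_g := hac.component 1
  locAC_h := hac.component 2
  norm_sq x := by rw [← norm_sq_eq, hm.1.1 x, one_pow]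
  f_zero := by rw [hm.2]; simp [e2]
  g_zero := by rw [hm.2]; simp [e2]
  h_zero := by rw [hm.2]; simp [e2]
  tendsto := by
    have := ((EuclideanSpace.proj 0 : E3 →L[ℝ] ℝ).continuous.tendsto _).comp hm.1.2.1
    simpa [e1, Function.comp_def] using this

theorem halfCompetitor_reflect_of_mem_centeredWalls {m : ℝ → E3} (hm : m ∈ centeredWalls)
    (hac : LocAC m) :
    HalfCompetitor (fun x => -m (-x) 0) (fun x => m (-x) 1) (fun x => m (-x) 2) where
  locAC_f := (hac.component 0).comp_neg.neg
  locAC_g := (hac.component 1).comp_neg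
  locAC_h := (hac.component 2).comp_neg
  norm_sq x := by rw [neg_sq, ← norm_sq_eq, hm.1.1, one_pow]
  f_zero := by rw [neg_zero, hm.2]; simp [e2]
  g_zero := by rw [neg_zero, hm.2]; simp [e2]
  h_zero := by rw [neg_zero, hm.2]; simp [e2]
  tendsto := by
    have := (((EuclideanSpace.proj 0 : E3 →L[ℝ] ℝ).continuous.tendsto _).comp
      (hm.1.2.2.comp tendsto_neg_atTop_atBot)).neg
    simpa [e1, Function.comp_def] using this

namespace HalfWall

variable {φ p : ℝ → ℝ}

theorem isMinimizer_planar (w : HalfWall φ p) (ho : ∀ x, φ (-x) = -φ x) :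
    IsMinimizer notch centeredWalls (planar φ) := by
  refine ⟨w.planar_mem_centeredWalls ho, fun m hm => ?_⟩
  by_cases hac : LocAC m
  · rw [w.F_planar ho, F_eq_halfEnergy_add hac]
    exact add_le_add (w.halfEnergy_le (halfCompetitor_of_mem_centeredWalls hm hac))
      (w.halfEnergy_le (halfCompetitor_reflect_of_mem_centeredWalls hm hac))
  · rw [F, F, if_neg hac]; exact le_top

theorem eq_planar_of_isMinimizer (w : HalfWall φ p) (ho : ∀ x, φ (-x) = -φ x) {m : ℝ → E3}
    (hm : IsMinimizer notch centeredWalls m) : m = planar φ := by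
  have hle := hm.2 _ (w.planar_mem_centeredWalls ho)
  have hac : LocAC m := by
    by_contra hac
    rw [w.F_planar ho, F, if_neg hac, top_le_iff] at hle
    exact ENNReal.add_ne_top.2 ⟨ENNReal.ofReal_ne_top, ENNReal.ofReal_ne_top⟩ hle
  have c1 := halfCompetitor_of_mem_centeredWalls hm.1 hac
  have c2 := halfCompetitor_reflect_of_mem_centeredWalls hm.1 hac
  have l1 := w.halfEnergy_le c1
  have l2 := w.halfEnergy_le c2
  rw [w.F_planar ho, F_eq_halfEnergy_add hac] at hle
  -- Each half has at least the optimal energy and the sum has at most twice that, so both halves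
  -- are optimal; cancellation needs the finiteness of the optimal value.
  have k1 := ENNReal.le_of_add_le_add_right ENNReal.ofReal_ne_top
    ((add_le_add_right l2 _).trans hle)
  have k2 := ENNReal.le_of_add_le_add_left ENNReal.ofReal_ne_top
    ((add_le_add_left l1 _).trans hle)
  have r1 := fun x => w.eq_of_halfEnergy_le (x := x) c1 k1
  have r2 := fun x => w.eq_of_halfEnergy_le (x := x) c2 k2
  funext x
  ext i
  rcases le_total 0 x with hx | hx
  · obtain ⟨a, b, c⟩ := r1 x hx
    fin_cases i <;> simpa [planar]
  · obtain ⟨a, b, c⟩ := r2 (-x) (by linarith)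
    simp only [neg_neg, ho, Real.sin_neg, neg_inj, Real.cos_neg] at a b c
    fin_cases i <;> simpa [planar]

end HalfWall

/-! ### Weak solutions are half-line profiles -/

/-- The lemma of du Bois-Reymond on a half-line. -/
theorem ae_eq_const_of_integral_mul_deriv_eq_zero {w : ℝ → ℝ} (hw : LocallyIntegrable w)
    (h : ∀ ψ : ℝ → ℝ, ContDiff ℝ ∞ ψ → HasCompactSupport ψ → tsupport ψ ⊆ Ioi 0 →
      ∫ x, w x * deriv ψ x = 0) : ∃ C, ∀ᵐ x, 0 < x → w x = C := by
  -- A reference bump of integral one, supported in `[1, 3]` and hence inside the half-line.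
  let b : ContDiffBump (2 : ℝ) := ⟨1 / 2, 1, by norm_num, by norm_num⟩
  set ρ : ℝ → ℝ := b.normed volume with hρ
  have hρc : ContDiff ℝ ∞ ρ := b.contDiff_normed
  have hρs : tsupport ρ = Icc 1 3 := by
    rw [hρ, b.tsupport_normed_eq, Real.closedBall_eq_Icc]; norm_num [b]
  have hρcs : HasCompactSupport ρ := b.hasCompactSupport_normed
  have hρ1 : ∫ x, ρ x = 1 := b.integral_normed
  have hint : ∀ χ : ℝ → ℝ, Continuous χ → HasCompactSupport χ →
      Integrable fun x => w x * χ x := fun χ hc hs =>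
    hw.integrable_smul_right_of_hasCompactSupport hc hs
  refine ⟨∫ x, w x * ρ x, ?_⟩
  set C := ∫ x, w x * ρ x with hC
  have key := isOpen_Ioi.ae_eq_zero_of_integral_contDiff_smul_eq_zero (μ := volume)
    (U := Ioi (0 : ℝ)) (f := fun x => w x - C)
    ((hw.sub (locallyIntegrable_const C)).locallyIntegrableOn _) (fun χ hχ hχs hχU => by
    set c := ∫ x, χ x with hc
    -- Removing the mean of `χ` makes the primitive of `u` compactly supported. It vanishes outside
    -- `[α, β]` with `α > 0`, so it is an admissible test function.
    set u : ℝ → ℝ := fun x => χ x - c * ρ x with hu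
    have huc : ContDiff ℝ ∞ u := hχ.sub (contDiff_const.mul hρc)
    have huint : ∫ x, u x = 0 := by
      rw [hu, integral_sub (hχ.continuous.integrable_of_hasCompactSupport hχs)
        ((hρc.continuous.integrable_of_hasCompactSupport hρcs).const_mul c), integral_const_mul,
        hρ1, mul_one, ← hc, sub_self]
    have hKc : IsCompact (tsupport χ ∪ Icc 1 3) := hχs.isCompact.union isCompact_Icc
    have hKne : (tsupport χ ∪ Icc (1 : ℝ) 3).Nonempty := ⟨1, Or.inr (by norm_num)⟩
    obtain ⟨α, hα⟩ := hKc.exists_isLeast hKne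
    obtain ⟨β, hβ⟩ := hKc.exists_isGreatest hKne
    have hα0 : 0 < α := by
      rcases hα.1 with h | h
      · exact hχU h
      · exact zero_lt_one.trans_le h.1
    have hu0 : ∀ x, x ∉ Icc α β → u x = 0 := by
      intro x hx
      have hx' : x ∉ tsupport χ ∪ Icc 1 3 := fun h => hx ⟨hα.2 h, hβ.2 h⟩
      have h1 : χ x = 0 := image_eq_zero_of_notMem_tsupport fun h => hx' (Or.inl h)
      have h2 : ρ x = 0 := image_eq_zero_of_notMem_tsupport fun h => hx' (Or.inr (hρs ▸ h))
      simp [hu, h1, h2]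
    have hucs : HasCompactSupport u := HasCompactSupport.intro isCompact_Icc hu0
    set ψ : ℝ → ℝ := fun x => ∫ t in 0..x, u t with hψ
    have hψd : ∀ x, HasDerivAt ψ (u x) x := fun x =>
      (huc.continuous.integral_hasStrictDerivAt 0 x).hasDerivAt
    have hψ' : deriv ψ = u := funext fun x => (hψd x).deriv
    have hψc : ContDiff ℝ ∞ ψ := by
      rw [contDiff_infty_iff_deriv, hψ']
      exact ⟨fun x => (hψd x).differentiableAt, huc⟩
    have hψ0 : ∀ x, x ∉ Icc α β → ψ x = 0 := by
      intro x hx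
      rw [mem_Icc, not_and_or, not_le, not_le] at hx
      rcases hx with hx | hx
      · refine intervalIntegral.integral_zero_ae (ae_of_all _ fun t ht => hu0 t fun h => ?_)
        rw [mem_uIoc] at ht
        rcases ht with ht | ht <;> linarith [h.1, ht.2]
      · have hαβ : α ≤ β := hα.2 hβ.1
        refine Eq.trans (intervalIntegral.integral_eq_integral_of_support_subset ?_) huint
        intro t ht
        by_contra hne
        exact ht (hu0 t fun h => hne ⟨hα0.trans_le h.1, h.2.trans hx.le⟩)
    have hψcs : HasCompactSupport ψ := HasCompactSupport.intro isCompact_Icc hψ0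
    have hψU : tsupport ψ ⊆ Ioi 0 := by
      refine (closure_minimal (fun x hx => ?_) isClosed_Icc).trans
        fun x (hx : x ∈ Icc α β) => hα0.trans_le hx.1
      by_contra hne
      exact hx (hψ0 x hne)
    have h1 := h ψ hψc hψcs hψU
    rw [hψ'] at h1
    have h2 : ∫ x, w x * u x = (∫ x, w x * χ x) - c * C := by
      rw [hC, ← integral_const_mul, ← integral_sub (hint χ hχ.continuous hχs)
        ((hint ρ hρc.continuous hρcs).const_mul c)]
      congr 1; ext x; simp only [hu]; ring
    have h3 : ∫ x, χ x • (w x - C) = (∫ x, w x * χ x) - C * c := by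
      rw [hc, ← integral_const_mul, ← integral_sub (hint χ hχ.continuous hχs)
        ((hχ.continuous.integrable_of_hasCompactSupport hχs).const_mul C)]
      congr 1; ext x; rw [smul_eq_mul]; ring
    rw [h3]; linarith)
  filter_upwards [key] with x hx hx0
  exact sub_eq_zero.1 (hx hx0)

/-- With `A` a primitive of `a sin φ cos φ`, the weak equation makes `a φ' + A` orthogonal to all
derivatives of test functions on the half-line, hence a.e. equal to a constant `C`. The continuous
representative of the flux is `C - A`. -/
theorem IsPendulumSolution.exists_pendulumFlow {φ : ℝ → ℝ} (h : IsPendulumSolution notch φ) :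
    ∃ p, PendulumFlow φ p := by
  have hφ := h.memHdot1.1.continuous
  set f : ℝ → ℝ := fun x => Real.sin (φ x) * Real.cos (φ x) with hf
  have hfc : Continuous f := (Real.continuous_sin.comp hφ).mul (Real.continuous_cos.comp hφ)
  set A' : ℝ → ℝ := fun x => notch x * f x with hA'
  have hA'i : ∀ x y, IntervalIntegrable A' volume x y := fun x y =>
    intervalIntegrable_notch_mul (hfc.intervalIntegrable x y)
  set A : ℝ → ℝ := fun x => ∫ t in 0..x, A' t with hA
  have hAc : Continuous A := intervalIntegral.continuous_primitive hA'i 0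
  have hAd : ∀ x, x ∉ ({1, -1} : Set ℝ) → HasDerivAt A (A' x) x := by
    intro x hx
    simp only [mem_insert_iff, mem_singleton_iff, not_or] at hx
    refine intervalIntegral.integral_hasDerivAt_right (hA'i 0 x)
      (measurable_notch.mul hfc.measurable).stronglyMeasurable.stronglyMeasurableAtFilter ?_
    have : A' =ᶠ[𝓝 x] fun t => notch x * f t := by
      filter_upwards [notch_eventuallyEq (x := x) (fun h => by
        rcases (abs_eq zero_le_one).1 h with h | h
        · exact hx.1 h
        · exact hx.2 h)] with t ht
      rw [hA']; simp only [ht]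
    exact (continuousAt_const.mul hfc.continuousAt).congr this.symm
  have hlip : LocallyIntegrable fun x => notch x * deriv φ x := by
    have h1 : LocallyIntegrable (deriv φ) := h.memHdot1.2.locallyIntegrable (by norm_num)
    intro x
    obtain ⟨s, hs, hi⟩ := h1 x
    refine ⟨s, hs, Integrable.bdd_mul (c := 2) hi measurable_notch.aestronglyMeasurable
      (ae_of_all _ fun t => ?_)⟩
    rw [Real.norm_eq_abs, abs_of_pos (notch_pos t)]; exact notch_le_two t
  obtain ⟨C, hC⟩ := ae_eq_const_of_integral_mul_deriv_eq_zero
    (w := fun x => notch x * deriv φ x + A x) (hlip.add hAc.locallyIntegrable)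
    (fun ψ hψ hcs hU => by
      have hψ' : Continuous (deriv ψ) := hψ.continuous_deriv (by simp)
      have h1 := h.pendulum ψ hψ hcs (hU.trans fun x (hx : 0 < x) => hx.ne')
      have h2 := integral_mul_deriv_eq_neg (by simp) hAc hAd hA'i hψ hcs
      have i1 : Integrable fun x => notch x * deriv φ x * deriv ψ x :=
        hlip.integrable_smul_right_of_hasCompactSupport hψ' hcs.deriv
      have i2 : Integrable fun x => A x * deriv ψ x :=
        hAc.locallyIntegrable.integrable_smul_right_of_hasCompactSupport hψ' hcs.deriv
      simp only [add_mul]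
      rw [integral_add i1 i2, h1, h2, ← sub_eq_add_neg, sub_eq_zero]
      congr 1; ext x; simp only [hA', hf]; ring)
  set p : ℝ → ℝ := fun x => C - A x with hp
  have hpc : Continuous p := continuous_const.sub hAc
  have hpi : ∀ x y, IntervalIntegrable (fun t => p t / notch t) volume x y := fun x y =>
    intervalIntegrable_div_notch (hpc.intervalIntegrable x y)
  refine ⟨p, hφ, hpc, fun x hx hx1 => ?_, fun x hx hx1 => ?_⟩
  · have h1 : HasDerivAt (fun t => ∫ u in 0..t, p u / notch u) (p x / notch x) x := by
      refine intervalIntegral.integral_hasDerivAt_right (hpi 0 x)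
        (hpc.measurable.div measurable_notch).stronglyMeasurable.stronglyMeasurableAtFilter ?_
      have : (fun t => p t / notch t) =ᶠ[𝓝 x] fun t => p t / notch x := by
        filter_upwards [notch_eventuallyEq (x := x) (by rwa [abs_of_pos hx])] with t ht
        simp only [ht]
      exact (hpc.continuousAt.div_const _).congr this.symm
    refine (h1.const_add (φ 0)).congr_of_eventuallyEq ?_
    filter_upwards [eventually_gt_nhds hx] with t ht
    have h2 := (h.memHdot1.1 0 t).integral_deriv_eq_sub
    rw [← sub_eq_iff_eq_add', ← h2]
    refine intervalIntegral.integral_congr_ae ?_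
    filter_upwards [hC] with u hu hmem
    rw [uIoc_of_le ht.le] at hmem
    rw [eq_div_iff (notch_pos u).ne', hp]
    linarith [hu hmem.1]
  · exact ((hAd x (by
      simp only [mem_insert_iff, mem_singleton_iff, not_or]
      exact ⟨hx1, by linarith⟩)).const_sub C)

/-- The confinement `0 ≤ φ ≤ π / 2` makes the flux monotone on each side of the jump. Boundedness of
the angle then forces it to be nonnegative and to vanish at infinity, which selects the zero level
of the first integral and its positive branch. -/
theorem IsPendulumSolution.exists_halfWall {φ : ℝ → ℝ} (h : IsPendulumSolution notch φ) :
    ∃ p, HalfWall φ p := by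
  obtain ⟨p, w⟩ := h.exists_pendulumFlow
  refine ⟨p, ?_⟩
  have hπ := Real.pi_pos
  have hb : ∀ x, 0 ≤ x → 0 ≤ φ x ∧ φ x ≤ Real.pi / 2 := by
    intro x hx
    rcases hx.eq_or_lt with rfl | hx
    · rw [h.zero]; exact ⟨le_rfl, by positivity⟩
    · exact (h.bounds x hx).2.2
  have hcos : ∀ x, 0 ≤ x → 0 ≤ Real.cos (φ x) := fun x hx =>
    Real.cos_nonneg_of_mem_Icc ⟨by linarith [(hb x hx).1], (hb x hx).2⟩
  have hsc : ∀ x, 0 < x → 0 ≤ Real.sin (φ x) * Real.cos (φ x) := fun x hx =>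
    mul_nonneg (Real.sin_nonneg_of_nonneg_of_le_pi (hb x hx.le).1
      (by linarith [(hb x hx.le).2])) (hcos x hx.le)
  have anti1 : AntitoneOn p (Icc 0 1) := w.flux_antitoneOn hsc (convex_Icc 0 1) fun t ht => by
    rw [interior_Icc] at ht; exact ⟨ht.1, ht.2.ne⟩
  have anti2 : AntitoneOn p (Ici 1) := w.flux_antitoneOn hsc (convex_Ici 1) fun t ht => by
    rw [interior_Ici] at ht; exact ⟨zero_lt_one.trans ht, ne_of_gt ht⟩
  have hout : ∀ x : ℝ, 1 ≤ x → notch x = 1 := fun x hx =>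
    notch_of_ge (by rw [abs_of_nonneg (zero_le_one.trans hx)]; exact hx)
  have hin : ∀ x : ℝ, 0 ≤ x → x < 1 → notch x = 2 := fun x h0 h1 =>
    notch_of_lt (by rwa [abs_of_nonneg h0])
  -- A negative flux would stay below `p x`, and over a length `π / (-p x)` the angle would fall by
  -- at least `π`, more than the width of its range.
  have hp0 : ∀ x, 1 ≤ x → 0 ≤ p x := by
    intro x hx
    by_contra! hneg
    have hle : x ≤ x + Real.pi / (-p x) := by
      have : 0 < Real.pi / (-p x) := div_pos hπ (neg_pos.2 hneg)
      linarith
    have h1 := w.angle_sub_le_mul_sub (c := p x) (zero_le_one.trans hx) hle fun t ht => by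
      rw [hout t (hx.trans ht.1.le), div_one]
      exact ⟨(hx.trans_lt ht.1).ne', anti2 hx (hx.trans ht.1.le) ht.1.le⟩
    have h2 : p x * (x + Real.pi / (-p x) - x) = -Real.pi := by
      have := hneg.ne
      field_simp; ring
    rw [h2] at h1
    linarith [(hb x (zero_le_one.trans hx)).2,
      (hb (x + Real.pi / (-p x)) ((zero_le_one.trans hx).trans hle)).1]
  -- Since `p` decreases beyond `1`, the angle gains at least `p x * (x - 1)` on `[1, x]`, and this
  -- is at most `π / 2`.
  have hplim : Tendsto p atTop (𝓝 0) := by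
    have hl : Tendsto (fun x : ℝ => Real.pi / 2 / (x - 1)) atTop (𝓝 0) :=
      tendsto_const_nhds.div_atTop (tendsto_atTop_add_const_right _ (-1) tendsto_id)
    refine tendsto_of_tendsto_of_tendsto_of_le_of_le' tendsto_const_nhds hl ?_ ?_
    · filter_upwards [eventually_ge_atTop 1] with x hx
      exact hp0 x hx
    · filter_upwards [eventually_gt_atTop 1] with x hx
      rw [le_div_iff₀ (by linarith)]
      have h1 := w.mul_sub_le_angle_sub (c := p x) zero_le_one hx.le fun t ht => by
        rw [hout t ht.1.le, div_one]
        exact ⟨ht.1.ne', anti2 ht.1.le hx.le ht.2.le⟩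
      linarith [(hb x (zero_le_one.trans hx.le)).2, (hb 1 zero_le_one).1]
  have hflux : ∀ x, 1 ≤ x → p x = Real.cos (φ x) := by
    intro x hx
    have hcont : Continuous fun t => p t ^ 2 - Real.cos (φ t) ^ 2 :=
      (w.continuous_flux.pow 2).sub (w.continuous_cos.pow 2)
    have hconst : ∀ y, x ≤ y → p x ^ 2 - Real.cos (φ x) ^ 2 = p y ^ 2 - Real.cos (φ y) ^ 2 := by
      intro y hy
      have := integral_eq_of_hasDerivAt_off_countable_of_le
        (fun t => p t ^ 2 - Real.cos (φ t) ^ 2) (fun _ => 0) hy countable_empty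
        hcont.continuousOn (fun t ht => by
          have ht1 : 1 < t := hx.trans_lt ht.1.1
          have h1 := w.hasDerivAt_angle t (zero_lt_one.trans ht1) ht1.ne'
          have h2 := w.hasDerivAt_flux t (zero_lt_one.trans ht1) ht1.ne'
          rw [hout t ht1.le] at h1 h2
          refine ((h2.pow 2).sub (h1.cos.pow 2)).congr_deriv ?_
          norm_num; ring) (by simp)
      simp only [intervalIntegral.integral_zero] at this
      linarith
    have hcl : Tendsto (fun t => Real.cos (φ t)) atTop (𝓝 0) := by
      simpa [Function.comp_def] using (Real.continuous_cos.tendsto _).comp h.tendsto_atTop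
    have h1 : Tendsto (fun y => p y ^ 2 - Real.cos (φ y) ^ 2) atTop (𝓝 (0 ^ 2 - 0 ^ 2)) :=
      (hplim.pow 2).sub (hcl.pow 2)
    have h2 : Tendsto (fun y => p y ^ 2 - Real.cos (φ y) ^ 2) atTop
        (𝓝 (p x ^ 2 - Real.cos (φ x) ^ 2)) := by
      refine tendsto_const_nhds.congr' ?_
      filter_upwards [eventually_ge_atTop x] with y hy
      exact hconst y hy
    have h3 := tendsto_nhds_unique h2 h1
    rw [sub_self, sub_eq_zero] at h3
    exact (sq_eq_sq₀ (hp0 x hx) (hcos x (zero_le_one.trans hx))).1 h3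
  have hspeed : ∀ x, 0 ≤ x → p x / notch x ≤ Real.pi / 2 - φ x := by
    intro x hx
    have h1 : p x / notch x ≤ Real.cos (φ x) := by
      rcases lt_or_ge x 1 with h1 | h1
      · rw [hin x hx h1, div_le_iff₀ two_pos]
        refine abs_le_of_sq_le_sq' ?_ (by have := hcos x hx; positivity) |>.2
        rw [w.flux_sq (hflux 1 le_rfl) ⟨hx, h1.le⟩]
        nlinarith [sq_nonneg (Real.cos (φ 1))]
      · rw [hout x h1, div_one, hflux x h1]
    refine h1.trans ?_
    rw [← Real.sin_pi_div_two_sub]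
    exact Real.sin_le (by linarith [(hb x hx).2])
  -- Gronwall argument: the speed is at most `π / 2 - φ`, so the gap to `π / 2` decays no faster
  -- than `exp (-x)` and never closes.
  have hmono : ∀ s : Set ℝ, Convex ℝ s → (∀ t ∈ interior s, 0 < t ∧ t ≠ 1) →
      MonotoneOn (fun x => (Real.pi / 2 - φ x) * Real.exp x) s := by
    intro s hs hi
    have hd : ∀ t ∈ interior s, HasDerivAt (fun x => (Real.pi / 2 - φ x) * Real.exp x)
        (-(p t / notch t) * Real.exp t + (Real.pi / 2 - φ t) * Real.exp t) t := fun t ht =>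
      ((w.hasDerivAt_angle t (hi t ht).1 (hi t ht).2).const_sub _).mul (Real.hasDerivAt_exp t)
    refine monotoneOn_of_deriv_nonneg hs
      ((continuous_const.sub h.memHdot1.1.continuous).mul Real.continuous_exp).continuousOn
      (fun t ht => (hd t ht).differentiableAt.differentiableWithinAt) fun t ht => ?_
    rw [(hd t ht).deriv, ← add_mul]
    exact mul_nonneg (by linarith [hspeed t (hi t ht).1.le]) (Real.exp_pos t).le
  have hm1 := hmono (Icc 0 1) (convex_Icc 0 1) fun t ht => by
    rw [interior_Icc] at ht; exact ⟨ht.1, ht.2.ne⟩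
  have hm2 := hmono (Ici 1) (convex_Ici 1) fun t ht => by
    rw [interior_Ici] at ht; exact ⟨zero_lt_one.trans ht, ne_of_gt ht⟩
  have hlt : ∀ x, 0 < x → φ x < Real.pi / 2 := by
    intro x hx
    have h0 : ∀ y ∈ Icc (0 : ℝ) 1, 0 < (Real.pi / 2 - φ y) * Real.exp y := fun y hy => by
      have := hm1 (left_mem_Icc.2 zero_le_one) hy hy.1
      simp only [h.zero, sub_zero, Real.exp_zero, mul_one] at this
      linarith
    have h1 : 0 < (Real.pi / 2 - φ x) * Real.exp x := by
      rcases le_total x 1 with hx1 | hx1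
      · exact h0 x ⟨hx.le, hx1⟩
      · exact (h0 1 ⟨zero_le_one, le_rfl⟩).trans_le (hm2 self_mem_Ici hx1 hx1)
    linarith [pos_of_mul_pos_left h1 (Real.exp_pos x).le]
  have hp1 : 0 < p 1 := by
    rw [hflux 1 le_rfl]
    exact Real.cos_pos_of_mem_Ioo ⟨by linarith [(hb 1 zero_le_one).1], hlt 1 one_pos⟩
  have hpos1 : ∀ x ∈ Ioc (0 : ℝ) 1, 0 < φ x := by
    intro x hx
    have := w.mul_sub_le_angle_sub (c := p 1 / 2) le_rfl hx.1.le fun t ht => by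
      have ht1 := ht.2.trans_le hx.2
      rw [hin t ht.1.le ht1]
      have := anti1 ⟨ht.1.le, ht1.le⟩ (right_mem_Icc.2 zero_le_one) ht1.le
      exact ⟨ht1.ne, by linarith⟩
    rw [h.zero] at this
    have h2 := mul_pos (half_pos hp1) hx.1
    linarith
  refine ⟨w, h.zero, fun x hx => ?_, hlt, hflux, h.tendsto_atTop⟩
  rcases le_total x 1 with hx1 | hx1
  · exact hpos1 x ⟨hx, hx1⟩
  · have := w.mul_sub_le_angle_sub (c := 0) zero_le_one hx1 fun t ht => by
      rw [hout t ht.1.le, div_one]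
      exact ⟨ht.1.ne', hp0 t ht.1.le⟩
    linarith [hpos1 1 ⟨one_pos, le_rfl⟩]

/-! ### Second variation of the energy along families of angles -/

theorem isHalfSecondDerivAtZero_of_dominated {f f' f'' : ℝ → ℝ → ℝ} {b : ℝ → ℝ} {e : ℝ → ℝ≥0∞}
    {q : ℝ} (he : ∀ t, e t = ∫⁻ x, ENNReal.ofReal (f t x)) (hf0 : ∀ t x, 0 ≤ f t x)
    (hfi : ∀ t ∈ Ioo (-1 : ℝ) 1, Integrable (f t))
    (hfm' : ∀ t, AEStronglyMeasurable (f' t)) (hfm'' : ∀ t, AEStronglyMeasurable (f'' t))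
    (hd : ∀ t x, HasDerivAt (fun s => f s x) (f' t x) t)
    (hd' : ∀ t x, HasDerivAt (fun s => f' s x) (f'' t x) t)
    (hb : Integrable b) (hb' : ∀ᵐ x, ∀ t ∈ Ioo (-1 : ℝ) 1, |f' t x| ≤ b x)
    (hb'' : ∀ᵐ x, ∀ t ∈ Ioo (-1 : ℝ) 1, |f'' t x| ≤ b x) (hq : ∫ x, f'' 0 x = 2 * q) :
    IsHalfSecondDerivAtZero e q := by
  have hI : Ioo (-1 : ℝ) 1 ∈ 𝓝 (0 : ℝ) := Ioo_mem_nhds (by norm_num) (by norm_num)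
  have he' : ∀ t ∈ Ioo (-1 : ℝ) 1, e t = ENNReal.ofReal (∫ x, f t x) := fun t ht => by
    rw [he, ofReal_integral_eq_lintegral_ofReal (hfi t ht) (ae_of_all _ (hf0 t))]
  have h1 : ∀ t ∈ Ioo (-1 : ℝ) 1, Integrable (f' t) ∧
      HasDerivAt (fun s => ∫ x, f s x) (∫ x, f' t x) t := fun t ht =>
    hasDerivAt_integral_of_dominated_loc_of_deriv_le (isOpen_Ioo.mem_nhds ht)
      (by filter_upwards [isOpen_Ioo.mem_nhds ht] with s hs using (hfi s hs).aestronglyMeasurable)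
      (hfi t ht) (hfm' t) hb' hb (ae_of_all _ fun x s _ => hd s x)
  refine ⟨?_, fun t => ∫ x, f' t x, ?_, ?_⟩
  · filter_upwards [hI] with t ht
    rw [he' t ht]; exact ENNReal.ofReal_ne_top
  · filter_upwards [hI] with t ht
    refine (h1 t ht).2.congr_of_eventuallyEq ?_
    filter_upwards [isOpen_Ioo.mem_nhds ht] with s hs
    rw [he' s hs, ENNReal.toReal_ofReal (integral_nonneg (hf0 s))]
  · rw [← hq]
    exact (hasDerivAt_integral_of_dominated_loc_of_deriv_le hI
      (Eventually.of_forall hfm') (h1 0 (by norm_num)).1 (hfm'' 0) hb'' hb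
      (ae_of_all _ fun x s _ => hd' s x)).2

/-- A smooth one-parameter family `θ t y` of perturbations of an angle, tangent to `t y` to second
order at `t = 0`, where `σ` is the derivative in `y`. -/
structure AngleVariation (θ θ' θ'' σ σ' σ'' : ℝ → ℝ → ℝ) : Prop where
  hasDerivAt : ∀ t y, HasDerivAt (fun s => θ s y) (θ' t y) t
  hasDerivAt' : ∀ t y, HasDerivAt (fun s => θ' s y) (θ'' t y) t
  hasDerivAt_slope : ∀ t y, HasDerivAt (fun s => σ s y) (σ' t y) t
  hasDerivAt_slope' : ∀ t y, HasDerivAt (fun s => σ' s y) (σ'' t y) t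
  hasDerivAt_right : ∀ t y, HasDerivAt (θ t) (σ t y) y
  lipschitz : ∀ t, ∃ K, LipschitzWith K (θ t)
  continuous' : ∀ t, Continuous (θ' t)
  continuous'' : ∀ t, Continuous (θ'' t)
  continuous_slope : ∀ t, Continuous (σ t)
  continuous_slope' : ∀ t, Continuous (σ' t)
  continuous_slope'' : ∀ t, Continuous (σ'' t)
  bound : ∀ t ∈ Ioo (-1 : ℝ) 1, ∀ y ∈ Icc (-1 : ℝ) 1, |θ t y| ≤ |y| ∧ |θ' t y| ≤ |y| ∧
    |θ'' t y| ≤ 2 * |y| ∧ |σ t y| ≤ 1 ∧ |σ' t y| ≤ 1 ∧ |σ'' t y| ≤ 8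
  initial : ∀ y, θ 0 y = 0 ∧ θ' 0 y = y ∧ θ'' 0 y = 0 ∧ σ 0 y = 0 ∧ σ' 0 y = 1 ∧ σ'' 0 y = 0

/-- The family `φ + t η` used for `G`. -/
theorem angleVariation_linear :
    AngleVariation (fun t y => t * y) (fun _ y => y) (fun _ _ => 0) (fun t _ => t) (fun _ _ => 1)
      (fun _ _ => 0) where
  hasDerivAt t y := hasDerivAt_mul_const y
  hasDerivAt' t y := hasDerivAt_const t y
  hasDerivAt_slope t _ := hasDerivAt_id t
  hasDerivAt_slope' t _ := hasDerivAt_const t 1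
  hasDerivAt_right t y := by simpa using (hasDerivAt_id y).const_mul t
  lipschitz t := ⟨_, lipschitzWith_smul t⟩
  continuous' _ := continuous_id
  continuous'' _ := continuous_const
  continuous_slope _ := continuous_const
  continuous_slope' _ := continuous_const
  continuous_slope'' _ := continuous_const
  bound t ht y _ := by
    have h := abs_lt.2 ⟨ht.1, ht.2⟩
    refine ⟨?_, le_rfl, by simp, h.le, by simp, by simp⟩
    rw [abs_mul]
    nlinarith [abs_nonneg y]
  initial y := by simp

theorem lipschitzWith_arctan : LipschitzWith 1 Real.arctan :=
  lipschitzWith_of_nnnorm_deriv_le Real.differentiable_arctan fun x => by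
    rw [← NNReal.coe_le_coe, coe_nnnorm, Real.deriv_arctan, Real.norm_eq_abs,
      abs_of_pos (by positivity), NNReal.coe_one, div_le_one (by positivity)]
    nlinarith [sq_nonneg x]

/-- The family produced by normalizing `m + t v` on the sphere. The arctangent is odd, so its second
derivative in `t` vanishes at `0` and the second variation is that of the linear family. -/
theorem angleVariation_arctan :
    AngleVariation (fun t y => Real.arctan (t * y)) (fun t y => y / (1 + (t * y) ^ 2))
      (fun t y => -(2 * t * y ^ 3) / (1 + (t * y) ^ 2) ^ 2) (fun t y => t / (1 + (t * y) ^ 2))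
      (fun t y => (1 - (t * y) ^ 2) / (1 + (t * y) ^ 2) ^ 2)
      (fun t y => (-(6 * t * y ^ 2) + 2 * t ^ 3 * y ^ 4) / (1 + (t * y) ^ 2) ^ 3) where
  hasDerivAt t y := by
    refine ((hasDerivAt_mul_const y).arctan).congr_deriv ?_
    ring
  hasDerivAt' t y := by
    have h : (1 + (t * y) ^ 2) ≠ 0 := by positivity
    refine ((hasDerivAt_const t y).div
      (((hasDerivAt_mul_const y).pow 2).const_add 1) h).congr_deriv ?_
    simp only [Pi.pow_apply]
    norm_num
    ring
  hasDerivAt_slope t y := by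
    have h : (1 + (t * y) ^ 2) ≠ 0 := by positivity
    refine ((hasDerivAt_id t).div
      (((hasDerivAt_mul_const y).pow 2).const_add 1) h).congr_deriv ?_
    simp only [Pi.pow_apply, id]
    norm_num
    ring
  hasDerivAt_slope' t y := by
    have h : (1 + (t * y) ^ 2) ≠ 0 := by positivity
    refine ((((hasDerivAt_mul_const y).pow 2).const_sub 1).div
      ((((hasDerivAt_mul_const y).pow 2).const_add 1).pow 2) (pow_ne_zero 2 h)).congr_deriv ?_
    simp only [Pi.pow_apply]
    norm_num
    field_simp
    ring
  hasDerivAt_right t y := by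
    have : HasDerivAt (fun y => t * y) t y := by simpa using (hasDerivAt_id y).const_mul t
    refine this.arctan.congr_deriv ?_
    ring
  lipschitz t := ⟨_, lipschitzWith_arctan.comp (lipschitzWith_smul t)⟩
  continuous' t := continuous_id.div (by fun_prop) fun y => by positivity
  continuous'' t := Continuous.div (by fun_prop) (by fun_prop) fun y => by positivity
  continuous_slope t := Continuous.div (by fun_prop) (by fun_prop) fun y => by positivity
  continuous_slope' t := Continuous.div (by fun_prop) (by fun_prop) fun y => by positivity
  continuous_slope'' t := Continuous.div (by fun_prop) (by fun_prop) fun y => by positivity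
  bound t ht y hy := by
    have ht' := (abs_lt.2 ⟨ht.1, ht.2⟩).le
    have hy' := abs_le.2 hy
    have hz : 0 ≤ (t * y) ^ 2 := sq_nonneg _
    have hp : 0 < 1 + (t * y) ^ 2 := by positivity
    have h1 : 1 ≤ (1 + (t * y) ^ 2) ^ 2 := by nlinarith
    have h2 : 1 ≤ (1 + (t * y) ^ 2) ^ 3 := by nlinarith
    have hty : |t| * |y| ≤ |y| := by nlinarith [abs_nonneg y]
    have hy2 : |y| ^ 2 ≤ 1 := by nlinarith [abs_nonneg y]
    refine ⟨?_, ?_, ?_, ?_, ?_, ?_⟩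
    · have := lipschitzWith_arctan.dist_le_mul (t * y) 0
      simp only [Real.dist_eq, Real.arctan_zero, sub_zero, NNReal.coe_one, one_mul, abs_mul] at this
      linarith
    · rw [abs_div, abs_of_pos hp, div_le_iff₀ hp]
      nlinarith [abs_nonneg y]
    · rw [abs_div, abs_of_pos (pow_pos hp 2), div_le_iff₀ (pow_pos hp 2), abs_neg, abs_mul,
        abs_mul, abs_pow, abs_two]
      have h3 : |t| * |y| ^ 3 ≤ |y| := by
        calc |t| * |y| ^ 3 = (|t| * |y|) * |y| ^ 2 := by ring
          _ ≤ |y| * 1 := by gcongr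
          _ = |y| := mul_one _
      nlinarith [abs_nonneg y]
    · rw [abs_div, abs_of_pos hp, div_le_iff₀ hp]
      linarith
    · rw [abs_div, abs_of_pos (pow_pos hp 2), div_le_iff₀ (pow_pos hp 2), abs_le]
      constructor <;> nlinarith
    · rw [abs_div, abs_of_pos (pow_pos hp 3), div_le_iff₀ (pow_pos hp 3)]
      have h3 : |-(6 * t * y ^ 2) + 2 * t ^ 3 * y ^ 4| ≤ 6 * |t| * |y| ^ 2 + 2 * |t| ^ 3 * |y| ^ 4 := by
        refine (abs_add_le _ _).trans (le_of_eq ?_)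
        simp [abs_mul, abs_pow]
      have h4 : |t| * |y| ^ 2 ≤ 1 := mul_le_one₀ ht' (by positivity) hy2
      have h5 : |t| ^ 3 * |y| ^ 4 ≤ 1 :=
        mul_le_one₀ (pow_le_one₀ (abs_nonneg _) ht') (by positivity) (pow_le_one₀ (abs_nonneg _) hy')
      linarith
  initial y := by simp

theorem G_eq_lintegral {ψ : ℝ → ℝ} (hψ : LocAC ψ) :
    G notch ψ = ∫⁻ x, ENNReal.ofReal (notch x * (deriv ψ x ^ 2 + Real.cos (ψ x) ^ 2)) := by
  rw [G, F_eq_lintegral hψ.planar]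
  refine lintegral_congr_ae ?_
  filter_upwards [hψ.ae_differentiableAt] with x hx
  have h0 : deriv (fun y => planar ψ y 0) x = Real.cos (ψ x) * deriv ψ x :=
    hx.hasDerivAt.sin.deriv
  have h1 : deriv (fun y => planar ψ y 1) x = -Real.sin (ψ x) * deriv ψ x :=
    hx.hasDerivAt.cos.deriv
  have h2 : deriv (fun y => planar ψ y 2) x = 0 := deriv_const _ _
  rw [density, h0, h1, h2]
  congr 1
  have e1 : planar ψ x 1 = Real.cos (ψ x) := rfl
  have e2 : planar ψ x 2 = 0 := rfl
  rw [e1, e2]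
  linear_combination (notch x * deriv ψ x ^ 2) * Real.sin_sq_add_cos_sq (ψ x)

/-- With `|y| ≤ |cos x|`, the perturbed cosine remains dominated by the square-integrable
unperturbed one. -/
theorem abs_cos_add_le (x y : ℝ) : |Real.cos (x + y)| ≤ |Real.cos x| + |y| := by
  rw [Real.cos_add]
  refine (abs_sub _ _).trans ?_
  rw [abs_mul, abs_mul]
  have h1 := Real.abs_cos_le_one y
  have h2 := Real.abs_sin_le_one x
  have h3 : |Real.sin y| ≤ |y| := Real.abs_sin_le_abs
  have := abs_nonneg (Real.cos x)
  have := abs_nonneg (Real.sin y)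
  nlinarith

theorem abs_sin_two_mul_add_le (x y : ℝ) :
    |Real.sin (2 * (x + y))| ≤ 2 * |Real.cos x| + 2 * |y| := by
  rw [Real.sin_two_mul, abs_mul, abs_mul, abs_two]
  have h1 := abs_cos_add_le x y
  have h2 := Real.abs_sin_le_one (x + y)
  have := abs_nonneg (Real.cos (x + y))
  nlinarith

/-- The second derivative of the energy along `φ + θ t (cos φ)` is the quadratic form `Q`. -/
theorem isHalfSecondDerivAtZero_G {φ : ℝ → ℝ} (hφ : LocAC φ) (hφ' : MemLp (deriv φ) 2 volume)
    (hη : MemLp (fun x => Real.cos (φ x)) 2 volume) {θ θ' θ'' σ σ' σ'' : ℝ → ℝ → ℝ}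
    (hv : AngleVariation θ θ' θ'' σ σ' σ'') :
    IsHalfSecondDerivAtZero (fun t => G notch fun x => φ x + θ t (Real.cos (φ x)))
      (Q notch φ fun x => Real.cos (φ x)) := by
  set η : ℝ → ℝ := fun x => Real.cos (φ x) with hηdef
  have hηc : Continuous η := Real.continuous_cos.comp hφ.continuous
  have hηac : LocAC η := hφ.cos
  have hφm := measurable_deriv φ
  have hηm := measurable_deriv η
  have hmem : ∀ x, η x ∈ Icc (-1 : ℝ) 1 := fun x => Real.cos_mem_Icc _
  have hη' : ∀ᵐ x, |deriv η x| ≤ |deriv φ x| := by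
    filter_upwards [hφ.ae_differentiableAt] with x hx
    rw [hηdef, hx.hasDerivAt.cos.deriv, abs_mul, abs_neg]
    nlinarith [Real.abs_sin_le_one (φ x), abs_nonneg (deriv φ x)]
  -- A common dominating function for the density and its first two `t`-derivatives; `100` is a
  -- generous constant.
  have hA : Integrable fun x => 100 * (deriv φ x ^ 2 + η x ^ 2) :=
    (((memLp_two_iff_integrable_sq hφm.aestronglyMeasurable).1 hφ').add
      ((memLp_two_iff_integrable_sq hηc.aestronglyMeasurable).1 hη)).const_mul _
  have hθc : ∀ t, Continuous (θ t) := fun t => (hv.lipschitz t).choose_spec.continuous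
  have ms : ∀ t, Measurable fun x => σ t (η x) := fun t =>
    ((hv.continuous_slope t).comp hηc).measurable
  have ms' : ∀ t, Measurable fun x => σ' t (η x) := fun t =>
    ((hv.continuous_slope' t).comp hηc).measurable
  have ms'' : ∀ t, Measurable fun x => σ'' t (η x) := fun t =>
    ((hv.continuous_slope'' t).comp hηc).measurable
  have mθ : ∀ t, Measurable fun x => φ x + θ t (η x) := fun t =>
    (hφ.continuous.add ((hθc t).comp hηc)).measurable
  have mθ' : ∀ t, Measurable fun x => θ' t (η x) := fun t =>
    ((hv.continuous' t).comp hηc).measurable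
  have mθ'' : ∀ t, Measurable fun x => θ'' t (η x) := fun t =>
    ((hv.continuous'' t).comp hηc).measurable
  have mn := measurable_notch
  have mslope : ∀ t, Measurable fun x => deriv φ x + σ t (η x) * deriv η x := fun t =>
    hφm.add ((ms t).mul hηm)
  have msin : ∀ t, Measurable fun x => Real.sin (2 * (φ x + θ t (η x))) := fun t =>
    Real.measurable_sin.comp ((mθ t).const_mul 2)
  refine isHalfSecondDerivAtZero_of_dominated
    (f := fun t x => notch x * ((deriv φ x + σ t (η x) * deriv η x) ^ 2
      + Real.cos (φ x + θ t (η x)) ^ 2))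
    (f' := fun t x => notch x * (2 * (deriv φ x + σ t (η x) * deriv η x) * (σ' t (η x) * deriv η x)
      - Real.sin (2 * (φ x + θ t (η x))) * θ' t (η x)))
    (f'' := fun t x => notch x * (2 * (σ' t (η x) * deriv η x) ^ 2
      + 2 * (deriv φ x + σ t (η x) * deriv η x) * (σ'' t (η x) * deriv η x)
      - 2 * Real.cos (2 * (φ x + θ t (η x))) * θ' t (η x) ^ 2
      - Real.sin (2 * (φ x + θ t (η x))) * θ'' t (η x)))
    (b := fun x => 100 * (deriv φ x ^ 2 + η x ^ 2)) ?_ ?_ ?_ ?_ ?_ ?_ ?_ hA ?_ ?_ ?_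
  · intro t
    obtain ⟨K, hK⟩ := hv.lipschitz t
    have hac : LocAC fun x => φ x + θ t (η x) := fun x y =>
      (hφ x y).fun_add (LocAC.lipschitz_comp hK hηac x y)
    rw [G_eq_lintegral hac]
    refine lintegral_congr_ae ?_
    filter_upwards [hφ.ae_differentiableAt, hηac.ae_differentiableAt] with x h1 h2
    have h3 := h1.hasDerivAt.add ((hv.hasDerivAt_right t (η x)).comp x h2.hasDerivAt)
    have h4 : deriv (fun x => φ x + θ t (η x)) x = deriv φ x + σ t (η x) * deriv η x := h3.deriv
    rw [h4]
  · intro t x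
    have := notch_pos x
    positivity
  · intro t ht
    refine hA.mono' (mn.mul (((mslope t).pow_const 2).add
      ((Real.measurable_cos.comp (mθ t)).pow_const 2))).aestronglyMeasurable ?_
    filter_upwards [hη'] with x hx
    obtain ⟨b1, b2, b3, b4, b5, b6⟩ := hv.bound t ht (η x) (hmem x)
    have hn := notch_pos x
    rw [Real.norm_eq_abs, abs_of_nonneg (by positivity)]
    have c1 : |deriv φ x + σ t (η x) * deriv η x| ≤ 2 * |deriv φ x| := by
      refine (abs_add_le _ _).trans ?_
      rw [abs_mul]
      nlinarith [abs_nonneg (deriv η x)]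
    have c2 : |Real.cos (φ x + θ t (η x))| ≤ 2 * |η x| := by
      linarith [abs_cos_add_le (φ x) (θ t (η x))]
    have d1 : (deriv φ x + σ t (η x) * deriv η x) ^ 2 ≤ 4 * deriv φ x ^ 2 := by
      rw [← sq_abs, ← sq_abs (deriv φ x)]
      nlinarith [abs_nonneg (deriv φ x + σ t (η x) * deriv η x)]
    have d2 : Real.cos (φ x + θ t (η x)) ^ 2 ≤ 4 * η x ^ 2 := by
      rw [← sq_abs, ← sq_abs (η x)]
      nlinarith [abs_nonneg (Real.cos (φ x + θ t (η x)))]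
    nlinarith [notch_le_two x, sq_nonneg (deriv φ x), sq_nonneg (η x)]
  · intro t
    exact (mn.mul ((((mslope t).const_mul 2).mul ((ms' t).mul hηm)).sub
      ((msin t).mul (mθ' t)))).aestronglyMeasurable
  · intro t
    exact (mn.mul ((((((((ms' t).mul hηm).pow_const 2).const_mul 2).add
      (((mslope t).const_mul 2).mul ((ms'' t).mul hηm))).sub
      (((Real.measurable_cos.comp ((mθ t).const_mul 2)).const_mul 2).mul ((mθ' t).pow_const 2)))).sub
      ((msin t).mul (mθ'' t)))).aestronglyMeasurable
  · intro t x
    have h1 := ((hv.hasDerivAt_slope t (η x)).mul_const (deriv η x)).const_add (deriv φ x)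
    have h2 := ((hv.hasDerivAt t (η x)).const_add (φ x)).cos
    refine (((h1.pow 2).add (h2.pow 2)).const_mul (notch x)).congr_deriv ?_
    rw [Real.sin_two_mul]
    norm_num
    left; ring
  · intro t x
    have h1 := ((hv.hasDerivAt_slope t (η x)).mul_const (deriv η x)).const_add (deriv φ x)
    have h1' := (hv.hasDerivAt_slope' t (η x)).mul_const (deriv η x)
    have h2 := (((hv.hasDerivAt t (η x)).const_add (φ x)).const_mul 2).sin
    refine ((((h1.const_mul 2).mul h1').sub (h2.mul (hv.hasDerivAt' t (η x)))).const_mul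
      (notch x)).congr_deriv ?_
    ring
  · filter_upwards [hη'] with x hx t ht
    obtain ⟨b1, b2, b3, b4, b5, b6⟩ := hv.bound t ht (η x) (hmem x)
    have hn := notch_pos x
    have hn2 := notch_le_two x
    have c1 : |deriv φ x + σ t (η x) * deriv η x| ≤ 2 * |deriv φ x| := by
      refine (abs_add_le _ _).trans ?_
      rw [abs_mul]
      nlinarith [abs_nonneg (deriv η x)]
    have c2 : |Real.sin (2 * (φ x + θ t (η x)))| ≤ 4 * |η x| := by
      linarith [abs_sin_two_mul_add_le (φ x) (θ t (η x))]
    have c3 : |σ' t (η x) * deriv η x| ≤ |deriv φ x| := by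
      rw [abs_mul]
      nlinarith [abs_nonneg (deriv η x)]
    rw [abs_mul, abs_of_pos hn]
    have d1 : |2 * (deriv φ x + σ t (η x) * deriv η x) * (σ' t (η x) * deriv η x)
        - Real.sin (2 * (φ x + θ t (η x))) * θ' t (η x)|
        ≤ 2 * (2 * |deriv φ x|) * |deriv φ x| + 4 * |η x| * |η x| := by
      refine (abs_sub _ _).trans ?_
      rw [abs_mul, abs_mul 2, abs_two, abs_mul (Real.sin _)]
      gcongr
    have e1 := sq_abs (deriv φ x)
    have e2 := sq_abs (η x)
    calc _ ≤ 2 * (2 * (2 * |deriv φ x|) * |deriv φ x| + 4 * |η x| * |η x|) := by gcongr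
      _ ≤ _ := by nlinarith [sq_nonneg (deriv φ x), sq_nonneg (η x)]
  · filter_upwards [hη'] with x hx t ht
    obtain ⟨b1, b2, b3, b4, b5, b6⟩ := hv.bound t ht (η x) (hmem x)
    have hn := notch_pos x
    have hn2 := notch_le_two x
    have c1 : |deriv φ x + σ t (η x) * deriv η x| ≤ 2 * |deriv φ x| := by
      refine (abs_add_le _ _).trans ?_
      rw [abs_mul]
      nlinarith [abs_nonneg (deriv η x)]
    have c2 : |Real.sin (2 * (φ x + θ t (η x)))| ≤ 4 * |η x| := by
      linarith [abs_sin_two_mul_add_le (φ x) (θ t (η x))]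
    have c3 : |σ' t (η x) * deriv η x| ≤ |deriv φ x| := by
      rw [abs_mul]
      nlinarith [abs_nonneg (deriv η x)]
    have c4 : |σ'' t (η x) * deriv η x| ≤ 8 * |deriv φ x| := by
      rw [abs_mul]
      nlinarith [abs_nonneg (deriv η x)]
    rw [abs_mul, abs_of_pos hn]
    have d1 : |2 * (σ' t (η x) * deriv η x) ^ 2
      + 2 * (deriv φ x + σ t (η x) * deriv η x) * (σ'' t (η x) * deriv η x)
      - 2 * Real.cos (2 * (φ x + θ t (η x))) * θ' t (η x) ^ 2
      - Real.sin (2 * (φ x + θ t (η x))) * θ'' t (η x)|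
        ≤ 2 * |deriv φ x| ^ 2 + 2 * (2 * |deriv φ x|) * (8 * |deriv φ x|)
          + 2 * 1 * |η x| ^ 2 + 4 * |η x| * (2 * |η x|) := by
      refine (abs_sub _ _).trans (add_le_add ((abs_sub _ _).trans
        (add_le_add ((abs_add_le _ _).trans (add_le_add ?_ ?_)) ?_)) ?_)
      · rw [abs_mul, abs_two, abs_pow]; gcongr
      · rw [abs_mul, abs_mul 2, abs_two]; gcongr
      · rw [abs_mul, abs_mul 2, abs_two, abs_pow]
        have := Real.abs_cos_le_one (2 * (φ x + θ t (η x)))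
        gcongr
      · rw [abs_mul]; gcongr
    have e1 := sq_abs (deriv φ x)
    have e2 := sq_abs (η x)
    calc _ ≤ 2 * (2 * |deriv φ x| ^ 2 + 2 * (2 * |deriv φ x|) * (8 * |deriv φ x|)
          + 2 * 1 * |η x| ^ 2 + 4 * |η x| * (2 * |η x|)) := by gcongr
      _ ≤ _ := by nlinarith [sq_nonneg (deriv φ x), sq_nonneg (η x)]
  -- At `t = 0` the terms with `θ''` and `σ''` drop out, so no first-variation term is left.
  · rw [Q, ← integral_const_mul]
    congr 1
    ext x
    obtain ⟨i1, i2, i3, i4, i5, i6⟩ := hv.initial (η x)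
    simp only [i1, i2, i3, i4, i5, i6]
    ring_nf

/-! ### Negativity of the quadratic form in the direction `cos φ` -/

/-- The integrand of `Q φ (cos φ)` in terms of the angle and the flux. -/
noncomputable def instabilityDensity (φ p : ℝ → ℝ) (x : ℝ) : ℝ :=
  notch x * (Real.sin (φ x) * (p x / notch x)) ^ 2
    - notch x * Real.cos (2 * φ x) * Real.cos (φ x) ^ 2

namespace HalfWall

variable {φ p : ℝ → ℝ}

theorem intervalIntegrable_instabilityDensity (w : HalfWall φ p) (x y : ℝ) :
    IntervalIntegrable (instabilityDensity φ p) volume x y := by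
  have h1 := intervalIntegrable_div_notch
    (((w.continuous_sin.mul w.continuous_flux).pow 2).intervalIntegrable (μ := volume) x y)
  have h2 := intervalIntegrable_notch_mul (((Real.continuous_cos.comp
    ((continuous_const (y := (2 : ℝ))).mul w.continuous_angle)).mul (w.continuous_cos.pow 2)).intervalIntegrable
    (μ := volume) x y)
  refine (h1.sub h2).congr_ae (ae_of_all _ fun t => ?_)
  have := notch_pos t
  simp only [instabilityDensity, Pi.pow_apply, Pi.mul_apply, Function.comp_apply]
  field_simp

theorem intervalIntegrable_remainder (w : HalfWall φ p) (x y : ℝ) :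
    IntervalIntegrable (fun t => notch t * (Real.cos (φ t) ^ 2
      * ((p t / notch t) ^ 2 - Real.cos (φ t) ^ 2))) volume x y := by
  have h1 := intervalIntegrable_div_notch
    (((w.continuous_cos.mul w.continuous_flux).pow 2).intervalIntegrable (μ := volume) x y)
  have h2 := intervalIntegrable_notch_mul
    ((w.continuous_cos.pow 4).intervalIntegrable (μ := volume) x y)
  refine (h1.sub h2).congr_ae (ae_of_all _ fun t => ?_)
  have := notch_pos t
  simp only [Pi.pow_apply, Pi.mul_apply]
  field_simp

/-- The integrand is the derivative of `-p sin φ cos φ` plus `a cos² φ (φ'² - cos² φ)`. The boundary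
term is zero at the origin and has a favorable sign at `R`. In the notch the remainder equals `2 *
cos φ ^ 2 * (-(3 / 4) * cos (φ 1) ^ 2)`, and `cos φ ^ 2 ≥ cos (φ 1) ^ 2` there; this gives a bound
independent of `R`. -/
theorem integral_instabilityDensity_le (w : HalfWall φ p) {R : ℝ} (hR : 1 ≤ R) :
    ∫ t in 0..R, instabilityDensity φ p t ≤ -(3 / 2 * Real.cos (φ 1) ^ 4) := by
  have hR0 : 0 ≤ R := zero_le_one.trans hR
  have h1 := integral_eq_of_hasDerivAt_off_countable_of_le
    (fun t => -(p t * (Real.sin (φ t) * Real.cos (φ t))))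
    (fun t => instabilityDensity φ p t - notch t * (Real.cos (φ t) ^ 2
      * ((p t / notch t) ^ 2 - Real.cos (φ t) ^ 2))) hR0 (countable_singleton 1)
    (w.continuous_flux.mul (w.continuous_sin.mul w.continuous_cos)).neg.continuousOn
    (fun t ht => by
      have hd := w.hasDerivAt_angle t ht.1.1 ht.2
      refine ((w.hasDerivAt_flux t ht.1.1 ht.2).mul (hd.sin.mul hd.cos)).neg.congr_deriv ?_
      have hn := notch_pos t
      rw [instabilityDensity, Real.cos_two_mul']
      simp only [Pi.mul_apply]
      field_simp
      ring)
    ((w.intervalIntegrable_instabilityDensity 0 R).sub (w.intervalIntegrable_remainder 0 R))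
  rw [intervalIntegral.integral_sub (w.intervalIntegrable_instabilityDensity 0 R)
    (w.intervalIntegrable_remainder 0 R), w.zero, Real.sin_zero, zero_mul, mul_zero, neg_zero,
    sub_zero] at h1
  have hend : 0 ≤ p R * (Real.sin (φ R) * Real.cos (φ R)) := by
    have hR' : 0 < R := zero_lt_one.trans_le hR
    have := w.flux_pos hR0
    have := w.sin_pos hR'
    have := w.cos_pos hR0
    positivity
  have h2 : ∫ t in 1..R, notch t * (Real.cos (φ t) ^ 2
      * ((p t / notch t) ^ 2 - Real.cos (φ t) ^ 2)) ≤ 0 := by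
    have := intervalIntegral.integral_mono_on hR (w.intervalIntegrable_remainder 1 R)
      (intervalIntegrable_const (c := (0 : ℝ))) fun t ht => by
        have ht0 := zero_le_one.trans ht.1
        have h4 := w.flux_div_notch_le ht0
        have h5 : 0 ≤ p t / notch t := (div_pos (w.flux_pos ht0) (notch_pos t)).le
        refine mul_nonpos_of_nonneg_of_nonpos (notch_pos t).le
          (mul_nonpos_of_nonneg_of_nonpos (sq_nonneg _) (sub_nonpos.2 ?_))
        gcongr
    simpa using this
  have h3 : ∫ t in 0..1, notch t * (Real.cos (φ t) ^ 2
      * ((p t / notch t) ^ 2 - Real.cos (φ t) ^ 2))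
      ≤ ∫ _ in (0 : ℝ)..1, -(3 / 2 * Real.cos (φ 1) ^ 4) := by
    refine intervalIntegral.integral_mono_on_of_le_Ioo zero_le_one
      (w.intervalIntegrable_remainder 0 1) (by simp) fun t ht => ?_
    have hc1 := w.cos_pos (zero_le_one (α := ℝ))
    have ht' : t ∈ Icc (0 : ℝ) 1 := ⟨ht.1.le, ht.2.le⟩
    have hsq := w.flux_sq (w.flux_eq 1 le_rfl) ht'
    rw [notch_of_lt (by rw [abs_of_pos ht.1]; exact ht.2), div_pow, hsq]
    have h4 : Real.cos (φ 1) ^ 2 ≤ Real.cos (φ t) ^ 2 := by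
      have := w.flux_one_le ht'
      have h5 : p 1 ^ 2 ≤ p t ^ 2 := by
        have := w.flux_one_pos
        gcongr
      rw [hsq, w.flux_eq 1 le_rfl] at h5
      linarith
    nlinarith [sq_nonneg (Real.cos (φ 1))]
  rw [intervalIntegral.integral_const, sub_zero, one_smul] at h3
  rw [← intervalIntegral.integral_add_adjacent_intervals (w.intervalIntegrable_remainder 0 1)
    (w.intervalIntegrable_remainder 1 R)] at h1
  linarith

theorem Q_neg (w : HalfWall φ p) (ho : ∀ x, φ (-x) = -φ x) :
    Q notch φ (fun x => Real.cos (φ x)) < 0 := by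
  have hac := w.locAC_of_odd ho
  have habs : ∀ x, φ |x| = φ x ∨ φ |x| = -φ x := by
    intro x
    rcases abs_choice x with h | h
    · left; rw [h]
    · right; rw [h, ho]
  have hQ : Q notch φ (fun x => Real.cos (φ x)) = ∫ x, instabilityDensity φ p |x| := by
    refine integral_congr_ae ?_
    filter_upwards [ae_notMem_jumps] with x hx
    have hn : notch |x| = notch x := by
      rcases abs_choice x with h | h <;> rw [h]
      exact notch_neg x
    rw [(w.hasDerivAt_angle_of_odd ho hx).cos.deriv, instabilityDensity, hn]
    rcases habs x with h | h <;> rw [h]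
    · ring
    · rw [mul_neg, Real.sin_neg, Real.cos_neg, Real.cos_neg]
  have hint : IntegrableOn (instabilityDensity φ p) (Ioi 0) := by
    refine w.integrableOn_multiplier.mono'
      (Measurable.aestronglyMeasurable ?_) (ae_of_all _ fun x => ?_)
    · exact (measurable_notch.mul ((w.continuous_sin.measurable.mul
        (w.continuous_flux.measurable.div measurable_notch)).pow_const 2)).sub
        ((measurable_notch.mul (Real.measurable_cos.comp
        (w.continuous_angle.measurable.const_mul 2))).mul (w.continuous_cos.measurable.pow_const 2))
    · have hn := notch_pos x
      rw [Real.norm_eq_abs, instabilityDensity, multiplier]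
      refine (abs_sub _ _).trans (add_le_add ?_ ?_)
      · rw [abs_of_nonneg (by positivity)]
        calc notch x * (Real.sin (φ x) * (p x / notch x)) ^ 2
            = Real.sin (φ x) ^ 2 * (p x ^ 2 / notch x) := by field_simp
          _ ≤ 1 * (p x ^ 2 / notch x) := by
            gcongr; exact Real.sin_sq_le_one _
          _ = _ := one_mul _
      · rw [abs_mul, abs_mul, abs_of_pos hn, abs_of_nonneg (sq_nonneg (Real.cos (φ x)))]
        have := Real.abs_cos_le_one (2 * φ x)
        calc notch x * |Real.cos (2 * φ x)| * Real.cos (φ x) ^ 2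
            ≤ notch x * 1 * Real.cos (φ x) ^ 2 := by gcongr
          _ = _ := by ring
  rw [hQ, integral_comp_abs]
  have hlim := intervalIntegral_tendsto_integral_Ioi 0 hint tendsto_id
  have hle : ∫ t in Ioi 0, instabilityDensity φ p t ≤ -(3 / 2 * Real.cos (φ 1) ^ 4) := by
    refine le_of_tendsto hlim ?_
    filter_upwards [eventually_ge_atTop 1] with R hR
    exact w.integral_instabilityDensity_le hR
  have hc1 := w.cos_pos (zero_le_one (α := ℝ))
  have : 0 < Real.cos (φ 1) ^ 4 := by positivity
  linarith

theorem memH1_cos (w : HalfWall φ p) (ho : ∀ x, φ (-x) = -φ x) :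
    MemH1 fun x => Real.cos (φ x) := by
  refine ⟨(w.locAC_of_odd ho).cos, w.memLp_cos_of_odd ho, ?_⟩
  refine (w.memLp_deriv_of_odd ho).mono (measurable_deriv _).aestronglyMeasurable ?_
  filter_upwards [ae_notMem_jumps] with x hx
  have hd := w.hasDerivAt_angle_of_odd ho hx
  rw [hd.cos.deriv, hd.deriv, norm_mul, norm_neg]
  exact mul_le_of_le_one_left (norm_nonneg _) (Real.abs_sin_le_one _)

theorem exists_unstable_direction (w : HalfWall φ p) (ho : ∀ x, φ (-x) = -φ x) :
    ∃ η : ℝ → ℝ, MemH1 η ∧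
      IsHalfSecondDerivAtZero (fun t : ℝ => G notch (fun x => φ x + t * η x)) (Q notch φ η) ∧
      Q notch φ η < 0 :=
  ⟨_, w.memH1_cos ho, isHalfSecondDerivAtZero_G (w.locAC_of_odd ho) (w.memLp_deriv_of_odd ho)
    (w.memLp_cos_of_odd ho) angleVariation_linear, w.Q_neg ho⟩

end HalfWall

/-! ### Instability of the sphere-valued minimizer -/

/-- The tangential part `e₁ - m₁ m` of the vector `e₁` along the planar map `m` of angle `φ`. -/
noncomputable def tangentField (φ : ℝ → ℝ) (x : ℝ) : E3 :=
  !₂[Real.cos (φ x) * Real.cos (φ x), -(Real.sin (φ x) * Real.cos (φ x)), 0]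

theorem inner_tangentField_planar (φ : ℝ → ℝ) (x : ℝ) :
    inner ℝ (tangentField φ x) (planar φ x) = 0 := by
  simp [tangentField, planar, PiLp.inner_apply, Fin.sum_univ_three]
  ring

theorem norm_tangentField_sq (φ : ℝ → ℝ) (x : ℝ) :
    ‖tangentField φ x‖ ^ 2 = Real.cos (φ x) ^ 2 := by
  rw [norm_sq_eq]
  simp only [tangentField, PiLp.toLp_apply, Matrix.cons_val]
  linear_combination Real.cos (φ x) ^ 2 * Real.sin_sq_add_cos_sq (φ x)

theorem locAC_tangentField {φ : ℝ → ℝ} (hφ : LocAC φ) : LocAC (tangentField φ) :=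
  locAC_vec (hφ.cos.mul hφ.cos) (hφ.sin.mul hφ.cos).neg (locAC_const 0)

theorem norm_deriv_planar_sq {φ : ℝ → ℝ} (hφ : LocAC φ) :
    ∀ᵐ x, ‖deriv (planar φ) x‖ ^ 2 = deriv φ x ^ 2 := by
  filter_upwards [hφ.planar.ae_norm_deriv_sq, hφ.ae_differentiableAt] with x h hx
  have h0 : deriv (fun y => planar φ y 0) x = Real.cos (φ x) * deriv φ x :=
    hx.hasDerivAt.sin.deriv
  have h1 : deriv (fun y => planar φ y 1) x = -Real.sin (φ x) * deriv φ x :=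
    hx.hasDerivAt.cos.deriv
  have h2 : deriv (fun y => planar φ y 2) x = 0 := deriv_const _ _
  rw [h, h0, h1, h2]
  linear_combination (deriv φ x ^ 2) * Real.sin_sq_add_cos_sq (φ x)

theorem norm_deriv_tangentField_sq {φ : ℝ → ℝ} (hφ : LocAC φ) :
    ∀ᵐ x, ‖deriv (tangentField φ) x‖ ^ 2 = deriv φ x ^ 2 := by
  filter_upwards [(locAC_tangentField hφ).ae_norm_deriv_sq, hφ.ae_differentiableAt] with x h hx
  have hd := hx.hasDerivAt
  have h0 : deriv (fun y => tangentField φ y 0) x = _ := (hd.cos.mul hd.cos).deriv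
  have h1 : deriv (fun y => tangentField φ y 1) x = _ := (hd.sin.mul hd.cos).neg.deriv
  have h2 : deriv (fun y => tangentField φ y 2) x = 0 := deriv_const _ _
  rw [h, h0, h1, h2]
  have := Real.sin_sq_add_cos_sq (φ x)
  linear_combination (deriv φ x ^ 2) * (Real.sin (φ x) ^ 2 + Real.cos (φ x) ^ 2 + 1) * this

/-- The field is `η = cos φ` times the unit tangent `(cos φ, -sin φ, 0)`. Rotation of the tangent
adds `η² φ'²` to `|v'|²`, which the multiplier cancels; what remains of the potential is `sin² φ -
cos² φ = -cos (2φ)`. -/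
theorem T_tangentField {φ : ℝ → ℝ} (hφ : LocAC φ) :
    T notch (planar φ) (tangentField φ) = Q notch φ fun x => Real.cos (φ x) := by
  refine integral_congr_ae ?_
  filter_upwards [norm_deriv_tangentField_sq hφ, norm_deriv_planar_sq hφ, hφ.ae_differentiableAt]
    with x h1 h2 hx
  rw [lagrange, h1, h2, norm_tangentField_sq, hx.hasDerivAt.cos.deriv, Real.cos_two_mul']
  simp only [tangentField, planar, PiLp.toLp_apply, Matrix.cons_val]
  have hs : Real.sin (φ x) ^ 2 = 1 - Real.cos (φ x) ^ 2 := by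
    linarith [Real.sin_sq_add_cos_sq (φ x)]
  ring_nf
  simp only [hs]
  ring

theorem memH1_tangentField {φ : ℝ → ℝ} (hφ : LocAC φ) (hφ' : MemLp (deriv φ) 2 volume)
    (hη : MemLp (fun x => Real.cos (φ x)) 2 volume) : MemH1 (tangentField φ) := by
  have hac := locAC_tangentField hφ
  refine ⟨hac, hη.mono hac.continuous.aestronglyMeasurable (ae_of_all _ fun x => ?_),
    hφ'.mono (stronglyMeasurable_deriv _).aestronglyMeasurable ?_⟩
  · rw [← sq_le_sq₀ (norm_nonneg _) (norm_nonneg _), norm_tangentField_sq, Real.norm_eq_abs, sq_abs]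
  · filter_upwards [norm_deriv_tangentField_sq hφ] with x hx
    rw [← sq_le_sq₀ (norm_nonneg _) (norm_nonneg _), hx, Real.norm_eq_abs, sq_abs]

/-- Adding `t cos φ` times the unit tangent to the unit vector `m` and normalizing rotates `m` in
its plane by the angle whose tangent is `t cos φ`. -/
theorem variation_planar (φ : ℝ → ℝ) (t : ℝ) :
    variation (planar φ) (tangentField φ) t
      = planar fun x => φ x + Real.arctan (t * Real.cos (φ x)) := by
  funext x
  set c := Real.cos (φ x) with hc
  set s := Real.sin (φ x) with hs
  have hsc : s ^ 2 + c ^ 2 = 1 := Real.sin_sq_add_cos_sq _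
  have hpos : 0 < 1 + (t * c) ^ 2 := by positivity
  have hnorm : ‖planar φ x + t • tangentField φ x‖ = √(1 + (t * c) ^ 2) := by
    rw [← Real.sqrt_sq (norm_nonneg _), norm_sq_eq]
    congr 1
    simp only [planar, tangentField, PiLp.add_apply, PiLp.smul_apply, Matrix.cons_val,
      smul_eq_mul, ← hc, ← hs]
    linear_combination (1 + t ^ 2 * c ^ 2) * hsc
  have hr := Real.sqrt_pos.2 hpos
  rw [variation, hnorm]
  ext i
  fin_cases i
  · simp only [planar, tangentField, PiLp.add_apply, PiLp.smul_apply, PiLp.toLp_apply,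
      Matrix.cons_val, smul_eq_mul, Fin.zero_eta, Real.sin_add, Real.cos_arctan, Real.sin_arctan,
      ← hc, ← hs]
    field_simp
  · simp only [planar, tangentField, PiLp.add_apply, PiLp.smul_apply, PiLp.toLp_apply,
      Matrix.cons_val, smul_eq_mul, Fin.mk_one, Real.cos_add, Real.cos_arctan, Real.sin_arctan,
      ← hc, ← hs]
    field_simp
    ring
  · simp [planar, tangentField]

theorem HalfWall.exists_unstable_tangent_direction {φ p : ℝ → ℝ} (w : HalfWall φ p)
    (ho : ∀ x, φ (-x) = -φ x) :
    ∃ v : ℝ → E3, MemH1 v ∧ (∀ x, inner ℝ (v x) (planar φ x) = 0) ∧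
      IsHalfSecondDerivAtZero (fun t : ℝ => F notch (variation (planar φ) v t))
        (T notch (planar φ) v) ∧ T notch (planar φ) v < 0 := by
  have hac := w.locAC_of_odd ho
  refine ⟨tangentField φ, memH1_tangentField hac (w.memLp_deriv_of_odd ho) (w.memLp_cos_of_odd ho),
    inner_tangentField_planar φ, ?_, ?_⟩
  · rw [T_tangentField hac]
    have h := isHalfSecondDerivAtZero_G hac (w.memLp_deriv_of_odd ho) (w.memLp_cos_of_odd ho)
      angleVariation_arctan
    have e : (fun t : ℝ => F notch (variation (planar φ) (tangentField φ) t))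
        = fun t => G notch fun x => φ x + Real.arctan (t * Real.cos (φ x)) :=
      funext fun t => by rw [variation_planar, G]
    rw [e]
    exact h
  · rw [T_tangentField hac]
    exact w.Q_neg ho

/-! ### The lower bound without centering, and why it is not attained -/

theorem two_mul_le_density_algebra {a f g h f' g' h' : ℝ} (ha : 1 ≤ a)
    (hn : f ^ 2 + g ^ 2 + h ^ 2 = 1) (ho : f * f' + g * g' + h * h' = 0) :
    2 * f' ≤ a * (f' ^ 2 + g' ^ 2 + h' ^ 2) + a * (g ^ 2 + h ^ 2) ∧
    (a * (f' ^ 2 + g' ^ 2 + h' ^ 2) + a * (g ^ 2 + h ^ 2) = 2 * f' →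
      f' = 1 - f ^ 2 ∧ (a = 2 → 1 - f ^ 2 = 0)) := by
  set N := f' ^ 2 + g' ^ 2 + h' ^ 2 with hN
  set K := g ^ 2 + h ^ 2 with hK
  have hN0 : 0 ≤ N := by positivity
  have hK0 : 0 ≤ K := by positivity
  have hf : f ^ 2 = 1 - K := by linarith
  -- Write `f' ^ 2 = f ^ 2 * f' ^ 2 + K * f' ^ 2`, replace `f * f'` by `-(g * g' + h * h')` and
  -- apply Cauchy–Schwarz.
  have h1 : f' ^ 2 ≤ N * K := by
    have e : f' ^ 2 = (g * g' + h * h') ^ 2 + f' ^ 2 * K := by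
      have : g * g' + h * h' = -(f * f') := by linarith
      rw [this, neg_sq, mul_pow, hf]; ring
    have c : (g * g' + h * h') ^ 2 ≤ K * (g' ^ 2 + h' ^ 2) := by
      rw [hK]; nlinarith [sq_nonneg (g * h' - h * g')]
    rw [e]; nlinarith
  have h2 : 2 * f' ≤ N + K := by
    refine (abs_le_of_sq_le_sq' ?_ (by positivity)).2
    nlinarith [sq_nonneg (N - K)]
  refine ⟨by nlinarith, fun he => ?_⟩
  have h3 : (a - 1) * (N + K) ≤ 0 := by nlinarith
  have h4 : (a - 1) * (N + K) = 0 := le_antisymm h3 (mul_nonneg (by linarith) (by positivity))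
  have h5 : 2 * f' = N + K := by linarith
  have h6 : N = K := by
    have : (N - K) ^ 2 ≤ 0 := by nlinarith
    nlinarith [sq_eq_zero_iff.1 (le_antisymm this (sq_nonneg _))]
  refine ⟨by linarith, fun ha2 => ?_⟩
  rw [ha2] at h4
  linarith

section LowerBound

variable {m : ℝ → E3}

theorem ae_two_mul_deriv_le_density (hm : m ∈ walls) (hac : LocAC m) :
    ∀ᵐ x, 2 * deriv (fun y => m y 0) x
        ≤ density (fun y => m y 0) (fun y => m y 1) (fun y => m y 2) x ∧
      (density (fun y => m y 0) (fun y => m y 1) (fun y => m y 2) x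
          = 2 * deriv (fun y => m y 0) x →
        deriv (fun y => m y 0) x = 1 - m x 0 ^ 2 ∧ (notch x = 2 → 1 - m x 0 ^ 2 = 0)) := by
  have hsq : ∀ x, m x 0 ^ 2 + m x 1 ^ 2 + m x 2 ^ 2 = 1 := fun x => by
    rw [← norm_sq_eq, hm.1 x, one_pow]
  filter_upwards [(hac.component 0).ae_differentiableAt, (hac.component 1).ae_differentiableAt,
    (hac.component 2).ae_differentiableAt] with x h0 h1 h2
  refine two_mul_le_density_algebra (one_le_notch x) (hsq x) ?_
  have h3 := ((h0.hasDerivAt.pow 2).add (h1.hasDerivAt.pow 2)).add (h2.hasDerivAt.pow 2)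
  have h4 : ((fun y => m y 0) ^ 2 + (fun y => m y 1) ^ 2 + (fun y => m y 2) ^ 2)
      = fun _ => (1 : ℝ) := funext hsq
  rw [h4] at h3
  have := h3.unique (hasDerivAt_const x 1)
  norm_num at this
  linarith

theorem tendsto_component_zero (hm : m ∈ walls) :
    Tendsto (fun x => m x 0) atTop (𝓝 1) ∧ Tendsto (fun x => m x 0) atBot (𝓝 (-1)) := by
  have hc := (EuclideanSpace.proj 0 : E3 →L[ℝ] ℝ).continuous
  constructor
  · simpa [e1, Function.comp_def] using (hc.tendsto _).comp hm.2.1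
  · simpa [e1, Function.comp_def] using (hc.tendsto _).comp hm.2.2

theorem integrable_density_of_F_ne_top (hac : LocAC m) (hF : F notch m ≠ ⊤) :
    Integrable (density (fun y => m y 0) (fun y => m y 1) (fun y => m y 2)) ∧
    F notch m = ENNReal.ofReal
      (∫ x, density (fun y => m y 0) (fun y => m y 1) (fun y => m y 2) x) := by
  have hi : Integrable (density (fun y => m y 0) (fun y => m y 1) (fun y => m y 2)) := by
    refine ⟨(measurable_density (hac.component 1).continuous
      (hac.component 2).continuous).aestronglyMeasurable, ?_⟩
    rw [hasFiniteIntegral_iff_ofReal (ae_of_all _ (density_nonneg _ _ _)), ← F_eq_lintegral hac]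
    exact hF.lt_top
  refine ⟨hi, ?_⟩
  rw [ofReal_integral_eq_lintegral_ofReal hi (ae_of_all _ (density_nonneg _ _ _)),
    F_eq_lintegral hac]

/-- The integrand is nonnegative almost everywhere, so it suffices to enlarge the interval to `[-R,
R]`; there `2 m₁'` integrates to a quantity tending to `2 * (1 - (-1)) = 4`. -/
theorem integral_density_sub_le (hm : m ∈ walls) (hac : LocAC m)
    (hD : Integrable (density (fun y => m y 0) (fun y => m y 1) (fun y => m y 2))) {x y : ℝ}
    (hxy : x ≤ y) :
    ∫ t in x..y, (density (fun y => m y 0) (fun y => m y 1) (fun y => m y 2) t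
      - 2 * deriv (fun y => m y 0) t)
    ≤ (∫ t, density (fun y => m y 0) (fun y => m y 1) (fun y => m y 2) t) - 4 := by
  set D := density (fun y => m y 0) (fun y => m y 1) (fun y => m y 2) with hDdef
  have hlim : Tendsto (fun R : ℝ => (∫ t in (-R)..R, D t) - 2 * (m R 0 - m (-R) 0)) atTop
      (𝓝 ((∫ t, D t) - 2 * (1 - (-1)))) := by
    obtain ⟨h1, h2⟩ := tendsto_component_zero hm
    exact (intervalIntegral_tendsto_integral hD tendsto_neg_atTop_atBot tendsto_id).sub
      ((h1.sub (h2.comp tendsto_neg_atTop_atBot)).const_mul 2)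
  have hi : ∀ u v, IntervalIntegrable (fun t => D t - 2 * deriv (fun y => m y 0) t) volume u v :=
    fun u v => hD.intervalIntegrable.sub
      (((hac.component 0) u v).intervalIntegrable_deriv.const_mul 2)
  have hlim' : Tendsto (fun R : ℝ => ∫ t in (-R)..R, (D t - 2 * deriv (fun y => m y 0) t)) atTop
      (𝓝 ((∫ t, D t) - 2 * (1 - (-1)))) := hlim.congr fun R => by
    rw [intervalIntegral.integral_sub hD.intervalIntegrable
      (((hac.component 0) _ _).intervalIntegrable_deriv.const_mul 2),
      intervalIntegral.integral_const_mul, ((hac.component 0) _ _).integral_deriv_eq_sub]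
  rw [show (2 : ℝ) * (1 - (-1)) = 4 by norm_num] at hlim'
  refine ge_of_tendsto hlim' ?_
  filter_upwards [eventually_ge_atTop (-x), eventually_ge_atTop y] with R h1 h2
  refine intervalIntegral.integral_mono_interval (by linarith) hxy h2 ?_ (hi _ _)
  refine ae_restrict_of_ae ?_
  filter_upwards [ae_two_mul_deriv_le_density hm hac] with t ht
  exact sub_nonneg.2 ht.1

theorem four_le_F (hm : m ∈ walls) : 4 ≤ F notch m := by
  by_cases hF : F notch m = ⊤
  · rw [hF]; exact le_top
  have hac : LocAC m := by
    by_contra hac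
    exact hF (by rw [F, if_neg hac])
  obtain ⟨hD, he⟩ := integrable_density_of_F_ne_top hac hF
  have := integral_density_sub_le hm hac hD (le_refl 0)
  rw [intervalIntegral.integral_same] at this
  rw [he, show (4 : ℝ≥0∞) = ENNReal.ofReal 4 by norm_num]
  exact ENNReal.ofReal_le_ofReal (by linarith)

theorem eq_const_of_hasDerivAt_mul {u k : ℝ → ℝ} (hk : Continuous k)
    (hu : ∀ x, HasDerivAt u (k x * u x) x) {x₀ : ℝ} (h0 : u x₀ = 0) (x : ℝ) : u x = 0 := by
  have hd : ∀ t, HasDerivAt (fun t => u t * Real.exp (-∫ s in 0..t, k s)) 0 t := fun t => by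
    have h1 := (hk.integral_hasStrictDerivAt 0 t).hasDerivAt.neg.exp
    refine ((hu t).mul h1).congr_deriv ?_
    ring
  have := is_const_of_deriv_eq_zero (fun t => (hd t).differentiableAt) (fun t => (hd t).deriv) x x₀
  rw [h0, zero_mul] at this
  exact (mul_eq_zero.1 this).resolve_right (Real.exp_pos _).ne'

/-- Equality in the pointwise bound gives `m₁' = 1 - m₁²` with `m₁² = 1` somewhere in the notch. The
equilibria `±1` cannot be reached by other solutions, so `m₁` is constant, against its two limits.
-/
theorem four_ne_F (hm : m ∈ walls) : F notch m ≠ 4 := by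
  intro hF
  have hFt : F notch m ≠ ⊤ := by rw [hF]; norm_num
  have hac : LocAC m := by
    by_contra hac
    exact hFt (by rw [F, if_neg hac])
  obtain ⟨hD, he⟩ := integrable_density_of_F_ne_top hac hFt
  set D := density (fun y => m y 0) (fun y => m y 1) (fun y => m y 2) with hDdef
  have h4 : ∫ x, D x = 4 := by
    rw [hF, show (4 : ℝ≥0∞) = ENNReal.ofReal 4 by norm_num] at he
    exact ((ENNReal.ofReal_eq_ofReal_iff (by norm_num)
      (integral_nonneg (density_nonneg _ _ _))).1 he).symm
  have hfac := hac.component 0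
  have hnn : ∀ᵐ t, 0 ≤ D t - 2 * deriv (fun y => m y 0) t := by
    filter_upwards [ae_two_mul_deriv_le_density hm hac] with t ht
    exact sub_nonneg.2 ht.1
  have hzero : ∀ᵐ x, D x = 2 * deriv (fun y => m y 0) x := by
    have h : ∀ᵐ x, ∀ n : ℕ, x ∈ Ioc (-(n : ℝ)) n → D x = 2 * deriv (fun y => m y 0) x := by
      refine ae_all_iff.2 fun n => ?_
      have hn : -(n : ℝ) ≤ n := by linarith [n.cast_nonneg (α := ℝ)]
      have h1 := integral_density_sub_le hm hac hD hn
      rw [← hDdef, h4, sub_self] at h1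
      have h2 : 0 ≤ ∫ t in (-(n : ℝ))..n, (D t - 2 * deriv (fun y => m y 0) t) :=
        intervalIntegral.integral_nonneg_of_ae hn hnn
      have h3 := (intervalIntegral.integral_eq_zero_iff_of_le_of_nonneg_ae hn
        (ae_restrict_of_ae hnn) (hD.intervalIntegrable.sub
          ((hfac _ _).intervalIntegrable_deriv.const_mul 2))).1 (le_antisymm h1 h2)
      rw [EventuallyEq, ae_restrict_iff' measurableSet_Ioc] at h3
      filter_upwards [h3] with x hx hmem
      exact sub_eq_zero.1 (hx hmem)
    filter_upwards [h] with x hx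
    obtain ⟨n, hn⟩ := exists_nat_gt |x|
    exact hx n ⟨(abs_lt.1 hn).1, (abs_lt.1 hn).2.le⟩
  have hcons : ∀ᵐ x, deriv (fun y => m y 0) x = 1 - m x 0 ^ 2 ∧
      (notch x = 2 → 1 - m x 0 ^ 2 = 0) := by
    filter_upwards [ae_two_mul_deriv_le_density hm hac, hzero] with x h1 h2
    exact h1.2 h2
  -- The notch has positive measure, so the almost-everywhere constraint holds at some point of it.
  obtain ⟨x₀, hx₀⟩ : ∃ x₀, 1 - m x₀ 0 ^ 2 = 0 := by
    have hne : (volume.restrict (Ioo (-1 : ℝ) 1)) ≠ 0 := by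
      rw [Ne, Measure.restrict_eq_zero]; simp
    have : (ae (volume.restrict (Ioo (-1 : ℝ) 1))).NeBot := ae_neBot.2 hne
    obtain ⟨x, hx, hx'⟩ := ((ae_restrict_of_ae (s := Ioo (-1 : ℝ) 1) hcons).and
      (ae_restrict_mem measurableSet_Ioo)).exists
    exact ⟨x, hx.2 (notch_of_lt (abs_lt.2 hx'))⟩
  have hfc := hfac.continuous
  -- The weak derivative agrees almost everywhere with a continuous function, so the equation holds
  -- classically at every point.
  have hf : ∀ x, HasDerivAt (fun y => m y 0) (1 - m x 0 ^ 2) x := by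
    intro x
    have hc : Continuous fun x => 1 - m x 0 ^ 2 := continuous_const.sub (hfc.pow 2)
    have h1 := (hc.integral_hasStrictDerivAt 0 x).hasDerivAt.const_add (m 0 0)
    refine h1.congr_of_eventuallyEq (Eventually.of_forall fun t => ?_)
    have h2 := (hfac 0 t).integral_deriv_eq_sub
    have h3 : ∫ s in 0..t, deriv (fun y => m y 0) s = ∫ s in 0..t, (1 - m s 0 ^ 2) :=
      intervalIntegral.integral_congr_ae (by filter_upwards [hcons] with s hs _ using hs.1)
    simp only
    rw [← h3, h2]; ring
  obtain ⟨ht, hb⟩ := tendsto_component_zero hm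
  have hcase : (1 - m x₀ 0) * (1 + m x₀ 0) = 0 := by linarith [hx₀]
  rcases mul_eq_zero.1 hcase with h | h
  · have hall := eq_const_of_hasDerivAt_mul (u := fun x => 1 - m x 0) (k := fun x => -(1 + m x 0))
      (continuous_const.add hfc).neg (fun x => ((hf x).const_sub 1).congr_deriv (by ring)) h
    have : Tendsto (fun x => m x 0) atBot (𝓝 1) :=
      tendsto_const_nhds.congr fun x => by linarith [hall x]
    have := tendsto_nhds_unique this hb
    norm_num at this
  · have hall := eq_const_of_hasDerivAt_mul (u := fun x => 1 + m x 0) (k := fun x => 1 - m x 0)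
      (continuous_const.sub hfc) (fun x => ((hf x).const_add 1).congr_deriv (by ring)) h
    have : Tendsto (fun x => m x 0) atTop (𝓝 (-1)) :=
      tendsto_const_nhds.congr fun x => by linarith [hall x]
    have := tendsto_nhds_unique this ht
    norm_num at this

end LowerBound

/-! ### Walls escaping to infinity -/

section Translates

/-- The domain wall of the constant weight, centered at `R`. -/
noncomputable def translatedAngle (R x : ℝ) : ℝ := Real.arctan (Real.sinh (x - R))

theorem hasDerivAt_translatedAngle (R x : ℝ) :
    HasDerivAt (translatedAngle R) (Real.cos (translatedAngle R x)) x := by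
  have := (hasDerivAt_arctan_sinh (x - R)).comp x ((hasDerivAt_id x).sub_const R)
  exact this.congr_deriv (mul_one _)

theorem continuous_translatedAngle (R : ℝ) : Continuous (translatedAngle R) :=
  continuous_iff_continuousAt.2 fun x => (hasDerivAt_translatedAngle R x).continuousAt

theorem locAC_translatedAngle (R : ℝ) : LocAC (translatedAngle R) :=
  (lipschitzWith_of_nnnorm_deriv_le (C := 1)
    (fun x => (hasDerivAt_translatedAngle R x).differentiableAt) fun x => by
      rw [(hasDerivAt_translatedAngle R x).deriv, ← NNReal.coe_le_coe, coe_nnnorm]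
      exact Real.abs_cos_le_one _).locAC

theorem tendsto_translatedAngle (R : ℝ) :
    Tendsto (translatedAngle R) atTop (𝓝 (Real.pi / 2)) ∧
    Tendsto (translatedAngle R) atBot (𝓝 (-(Real.pi / 2))) :=
  ⟨tendsto_arctan_sinh_atTop.comp (tendsto_atTop_add_const_right _ (-R) tendsto_id),
    tendsto_arctan_sinh_atBot.comp (tendsto_atBot_add_const_right _ (-R) tendsto_id)⟩

/-- By `ψ' = cos ψ` the density is `a` times the derivative of `2 sin ψ`. The weight `1` contributes
`4`, and the extra weight contributes only the increment over `(-1, 1)`, which vanishes in the limit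
as the center `R` moves away. -/
theorem F_planar_translatedAngle (R : ℝ) :
    F notch (planar (translatedAngle R)) = ENNReal.ofReal
      (4 + 2 * (Real.sin (translatedAngle R 1) - Real.sin (translatedAngle R (-1)))) := by
  set ψ := translatedAngle R with hψ
  set k : ℝ → ℝ := fun x => 2 * Real.cos (ψ x) ^ 2 with hk
  have hkc : Continuous k :=
    continuous_const.mul ((Real.continuous_cos.comp (continuous_translatedAngle R)).pow 2)
  have hk0 : ∀ x, 0 ≤ k x := fun x => by positivity
  have hd : ∀ x, HasDerivAt (fun x => 2 * Real.sin (ψ x)) (k x) x := fun x =>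
    ((hasDerivAt_translatedAngle R x).sin.const_mul 2).congr_deriv (by simp only [hk, hψ]; ring)
  have htop : Tendsto (fun x => 2 * Real.sin (ψ x)) atTop (𝓝 (2 * 1)) := by
    have := (Real.continuous_sin.tendsto _).comp (tendsto_translatedAngle R).1
    rw [Real.sin_pi_div_two] at this
    exact this.const_mul 2
  have hbot : Tendsto (fun x => 2 * Real.sin (ψ x)) atBot (𝓝 (2 * (-1))) := by
    have := (Real.continuous_sin.tendsto _).comp (tendsto_translatedAngle R).2
    rw [Real.sin_neg, Real.sin_pi_div_two] at this
    exact this.const_mul 2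
  have hki : Integrable k := by
    refine integrable_of_intervalIntegral_norm_bounded 4 (fun n : ℕ => hkc.integrableOn_Ioc)
      (tendsto_neg_atTop_atBot.comp tendsto_natCast_atTop_atTop) tendsto_natCast_atTop_atTop
      (Eventually.of_forall fun n => ?_)
    simp_rw [Real.norm_of_nonneg (hk0 _)]
    rw [intervalIntegral.integral_eq_sub_of_hasDerivAt (fun x _ => hd x)
      (hkc.intervalIntegrable _ _)]
    linarith [Real.sin_le_one (ψ n), Real.neg_one_le_sin (ψ ((Neg.neg ∘ Nat.cast) n))]
  have hkint : ∫ x, k x = 4 := by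
    rw [integral_of_hasDerivAt_of_tendsto hd hki hbot htop]; norm_num
  have hnk : (fun x => notch x * k x) = fun x => k x + (Ioo (-1 : ℝ) 1).indicator k x := by
    funext x
    by_cases hx : x ∈ Ioo (-1 : ℝ) 1
    · rw [notch_of_lt (abs_lt.2 hx), indicator_of_mem hx]; ring
    · rw [notch_of_ge (not_lt.1 fun h => hx (abs_lt.1 h)), indicator_of_notMem hx]; ring
  have hii : Integrable ((Ioo (-1 : ℝ) 1).indicator k) := hki.indicator measurableSet_Ioo
  have hni : Integrable fun x => notch x * k x := by rw [hnk]; exact hki.add hii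
  have hval : ∫ x, notch x * k x = 4 + 2 * (Real.sin (ψ 1) - Real.sin (ψ (-1))) := by
    rw [hnk, integral_add hki hii, hkint, integral_indicator measurableSet_Ioo,
      ← integral_Ioc_eq_integral_Ioo, ← intervalIntegral.integral_of_le (by norm_num),
      intervalIntegral.integral_eq_sub_of_hasDerivAt (fun x _ => hd x)
        (hkc.intervalIntegrable _ _)]
    ring
  rw [← hval, ofReal_integral_eq_lintegral_ofReal hni
    (ae_of_all _ fun x => mul_nonneg (notch_pos x).le (hk0 x))]
  refine (G_eq_lintegral (locAC_translatedAngle R)).trans (lintegral_congr fun x => ?_)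
  rw [(hasDerivAt_translatedAngle R x).deriv]
  simp only [hk, hψ]
  ring_nf

theorem isGLB_F_walls : IsGLB (F notch '' walls) 4 := by
  refine ⟨?_, fun b hb => ?_⟩
  · rintro _ ⟨m, hm, rfl⟩
    exact four_le_F hm
  · have hlim : ∀ c : ℝ, Tendsto (fun R => Real.sin (translatedAngle R c)) atTop (𝓝 (-1)) := by
      intro c
      have h1 : Tendsto (fun R => translatedAngle R c) atTop (𝓝 (-(Real.pi / 2))) :=
        tendsto_arctan_sinh_atBot.comp (tendsto_atBot_add_const_left _ c tendsto_neg_atTop_atBot)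
      have := (Real.continuous_sin.tendsto _).comp h1
      rwa [Real.sin_neg, Real.sin_pi_div_two] at this
    have h1 : Tendsto (fun R => ENNReal.ofReal
        (4 + 2 * (Real.sin (translatedAngle R 1) - Real.sin (translatedAngle R (-1))))) atTop
        (𝓝 (ENNReal.ofReal (4 + 2 * (-1 - -1)))) :=
      ENNReal.tendsto_ofReal ((((hlim 1).sub (hlim (-1))).const_mul 2).const_add 4)
    have h2 : ENNReal.ofReal (4 + 2 * (-1 - -1)) = 4 := by norm_num
    rw [h2] at h1
    refine ge_of_tendsto h1 (Eventually.of_forall fun R => ?_)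
    rw [← F_planar_translatedAngle]
    exact hb ⟨_, planar_mem_walls (tendsto_translatedAngle R).1 (tendsto_translatedAngle R).2, rfl⟩

end Translates

theorem not_exists_isMinimizer_walls : ¬ ∃ m : ℝ → E3, IsMinimizer notch walls m := by
  rintro ⟨m, hm, hmin⟩
  refine four_ne_F hm (le_antisymm ?_ (four_le_F hm))
  refine isGLB_F_walls.2 ?_
  rintro _ ⟨m', hm', rfl⟩
  exact hmin m' hm'

/-! ### Uniqueness of the pendulum solution -/

namespace IsPendulumSolution

variable {φ ψ : ℝ → ℝ}

theorem halfCompetitor (h : IsPendulumSolution notch φ) :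
    HalfCompetitor (fun x => Real.sin (φ x)) (fun x => Real.cos (φ x)) (fun _ => 0) where
  locAC_f := h.memHdot1.1.sin
  locAC_g := h.memHdot1.1.cos
  locAC_h := locAC_const 0
  norm_sq x := by rw [Real.sin_sq_add_cos_sq]; norm_num
  f_zero := by rw [h.zero, Real.sin_zero]
  g_zero := by rw [h.zero, Real.cos_zero]
  h_zero := rfl
  tendsto := by
    have := (Real.continuous_sin.tendsto _).comp h.tendsto_atTop
    rwa [Real.sin_pi_div_two] at this

/-- Both solutions are half-line minimizers and each is a competitor for the other, so their
energies agree. The equality case identifies the sines, and sine is injective on the range of the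
angles. -/
theorem eqOn_Ici (h : IsPendulumSolution notch φ) (k : IsPendulumSolution notch ψ) :
    EqOn φ ψ (Ici 0) := by
  intro x hx
  obtain ⟨p, w⟩ := h.exists_halfWall
  obtain ⟨q, v⟩ := k.exists_halfWall
  have hle := v.halfEnergy_le h.halfCompetitor
  rw [w.halfEnergy_eq] at hle
  have hs := (w.eq_of_halfEnergy_le k.halfCompetitor (v.halfEnergy_eq.trans_le hle) hx).1
  rcases eq_or_lt_of_le (mem_Ici.1 hx) with rfl | hx
  · rw [h.zero, k.zero]
  · obtain ⟨-, -, a, b⟩ := h.bounds x hx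
    obtain ⟨-, -, c, d⟩ := k.bounds x hx
    exact Real.injOn_sin ⟨by linarith, b⟩ ⟨by linarith, d⟩ hs.symm

/-- Transfers uniqueness to the negative half-line; no oddness of the solution is assumed. -/
theorem reflect (h : IsPendulumSolution notch φ) :
    IsPendulumSolution notch (fun x => -φ (-x)) := by
  have hd : deriv (fun x => -φ (-x)) = fun x => deriv φ (-x) := by
    funext x
    rw [deriv.fun_neg, deriv_comp_neg, neg_neg]
  refine ⟨⟨h.memHdot1.1.comp_neg.neg, ?_⟩, fun η hη hc hs => ?_, ?_, ?_, ?_, fun x hx => ?_⟩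
  · rw [hd]
    exact h.memHdot1.2.comp_measurePreserving (Measure.measurePreserving_neg volume)
  · have hη' : ContDiff ℝ ∞ fun x => η (-x) := hη.comp contDiff_neg
    have hc' : HasCompactSupport fun x => η (-x) := hc.comp_homeomorph (Homeomorph.neg ℝ)
    have hs' : tsupport (fun x => η (-x)) ⊆ {0}ᶜ := by
      have := tsupport_comp_eq_preimage η (Homeomorph.neg ℝ)
      rw [show (fun x => η (-x)) = η ∘ Homeomorph.neg ℝ from rfl, this]
      intro x hx h0
      exact hs hx (by simpa using h0)
    have key := h.pendulum _ hη' hc' hs'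
    rw [← integral_neg_eq_self] at key
    conv_rhs at key => rw [← integral_neg_eq_self]
    simp only [deriv_comp_neg, notch_neg, neg_neg, mul_neg, integral_neg] at key
    simp only [hd, Real.sin_neg, Real.cos_neg, mul_neg, neg_mul, integral_neg]
    linarith
  · simp [h.zero]
  · simpa using (h.tendsto_atBot.comp tendsto_neg_atTop_atBot).neg
  · exact (h.tendsto_atTop.comp tendsto_neg_atBot_atTop).neg
  · obtain ⟨a, b, c, d⟩ := h.bounds x hx
    rw [neg_neg]
    exact ⟨by linarith, by linarith, by linarith, by linarith⟩

theorem unique (h : IsPendulumSolution notch φ) (k : IsPendulumSolution notch ψ) : φ = ψ := by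
  funext x
  rcases le_total 0 x with hx | hx
  · exact h.eqOn_Ici k hx
  · have := h.reflect.eqOn_Ici k.reflect (mem_Ici.2 (neg_nonneg.2 hx))
    simpa using this

end IsPendulumSolution

end DomainWall

theorem proposition1 :
    -- the solution of the pendulum equation exists, is unique, and is unstable
    (∃! φ : ℝ → ℝ, DomainWall.IsPendulumSolution DomainWall.notch φ) ∧
    (∀ φ : ℝ → ℝ, DomainWall.IsPendulumSolution DomainWall.notch φ →
      ∃ η : ℝ → ℝ, DomainWall.MemH1 η ∧
        DomainWall.IsHalfSecondDerivAtZero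
          (fun t : ℝ => DomainWall.G DomainWall.notch (fun x => φ x + t * η x))
          (DomainWall.Q DomainWall.notch φ η) ∧
        DomainWall.Q DomainWall.notch φ η < 0) ∧
    -- the minimizer with fixed center exists, is unique, and is unstable
    (∃! m : ℝ → DomainWall.E3,
      DomainWall.IsMinimizer DomainWall.notch DomainWall.centeredWalls m) ∧
    (∀ m : ℝ → DomainWall.E3,
      DomainWall.IsMinimizer DomainWall.notch DomainWall.centeredWalls m →
      ∃ v : ℝ → DomainWall.E3, DomainWall.MemH1 v ∧ (∀ x, inner ℝ (v x) (m x) = 0) ∧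
        DomainWall.IsHalfSecondDerivAtZero
          (fun t : ℝ => DomainWall.F DomainWall.notch (DomainWall.variation m v t))
          (DomainWall.T DomainWall.notch m v) ∧
        DomainWall.T DomainWall.notch m v < 0) ∧
    -- without the constraint on the center, the infimum is 4 and there is no minimizer
    IsGLB (DomainWall.F DomainWall.notch '' DomainWall.walls) 4 ∧
    (¬ ∃ m : ℝ → DomainWall.E3,
      DomainWall.IsMinimizer DomainWall.notch DomainWall.walls m) := by
  obtain ⟨φ₀, p, w₀⟩ := DomainWall.exists_halfWall
  -- A `HalfWall` is free on the negative axis apart from continuity; the odd extension fixes it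
  -- there.
  have w := w₀.oddExtension
  have ho := DomainWall.oddExtension_neg w₀.zero
  have hsol := w.isPendulumSolution ho
  refine ⟨⟨_, hsol, fun ψ hψ => hψ.unique hsol⟩, fun ψ hψ => ?_,
    ⟨_, w.isMinimizer_planar ho, fun m hm => w.eq_planar_of_isMinimizer ho hm⟩, fun m hm => ?_,
    DomainWall.isGLB_F_walls, DomainWall.not_exists_isMinimizer_walls⟩
  · rw [hψ.unique hsol]
    exact w.exists_unstable_direction ho
  · rw [w.eq_planar_of_isMinimizer ho hm]
    exact w.exists_unstable_tangent_direction ho
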